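/- Let $n\ge 2$, let $\mathbb T^n=\mathbb R^n/\Gamma$ for a lattice $\Gamma\subset\mathbb R^n$ of full rank, let $I\subseteq\mathbb R$ be an open interval (possibly unbounded), and let $0<\beta<\alpha<1$. Let $v:I\times\mathbb T^n\to\mathbb R^n$ be a measurable vector field in $L^\infty_tC^\alpha_x$, i.e. $$\operatorname*{ess\,sup}_{t\in I}\|v(t,\cdot)\|_{C^\alpha(\mathbb T^n)}<\infty ,$$ and let $p$ be a distribution on $I\times\mathbb T^n$ such that $(v,p)$ solves the incompressible Euler equations $$\partial_t v^l+\sum_j\partial_j(v^jv^l)+\partial_l p=0\quad(l=1,\dots,n),\qquad \sum_j\partial_jv^j=0$$ in the sense of distributions on $I\times\mathbb T^n$. Suppose that $p$ is normalized by $\int_{\mathbb T^n}p(t,x)\,dx=0$, in the sense that $p$ vanishes on all test functions on $I\times\mathbb T^n$ that depend on $t$ only. For $0<s\le1$ write $f\in C^s_{t,x}$ if $f$ is bounded on $I\times\mathbb T^n$ and there is a constant $C$ with $|f(t,x)-f(t',x')|\le C(|t-t'|+|x-x'|)^s$ for all $t,t'\in I$ and all $x,x'\in\mathbb R^n$ ($f$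 being regarded as periodic in $x$); for $s=1$ we require in addition that $f$ be continuously differentiable. Then: 1. There is $V\in C^\alpha_{t,x}$ with $v(t,\cdot)=V(t,\cdot)$ for almost every $t\in I$. If $t\mapsto v(t,x)$ is continuous on $I$ for every $x$ (in particular, if $v\in C_tC^\alpha_x$), then $v$ itself belongs to $C^\alpha_{t,x}$. 2. If $\beta\le\frac12$, then $p$ is a function in $C^{2\beta}_{t,x}$. 3. If $\beta>\frac12$, then $p$ is a function that has classical partial derivatives $\partial_tp$ and $\nabla p$ everywhere on $I\times\mathbb T^n$, and $\partial_tp,\nabla p\in C^{2\beta-1}_{t,x}$. -/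

import Mathlib

open MeasureTheory TopologicalSpace
open scoped Distributions LineDeriv

namespace EulerReg

/-- Euclidean space `ℝⁿ`. The torus is `ℝⁿ / Γ` for a lattice `Γ` of full rank; functions and
distributions on the torus are regarded as `Γ`-periodic ones on `ℝⁿ`. -/
abbrev Space (n : ℕ) : Type := EuclideanSpace ℝ (Fin n)

/-- The open subset `I × ℝⁿ` of space-time `ℝ × ℝⁿ`. -/
def slab (n : ℕ) (I : Opens ℝ) : Opens (ℝ × Space n) :=
  ⟨(I : Set ℝ) ×ˢ Set.univ, I.isOpen.prod isOpen_univ⟩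

/-- The unit vector of space-time in the time direction. -/
def eTime (n : ℕ) : ℝ × Space n := (1, 0)

/-- The `j`-th spatial unit vector of space-time. -/
noncomputable def eSpace {n : ℕ} (j : Fin n) : ℝ × Space n := (0, EuclideanSpace.single j 1)

/-- A function `f` on `I × ℝⁿ` is `Γ`-periodic in space. -/
def IsPeriodic {n : ℕ} {F : Type*} (Γ : Submodule ℤ (Space n)) (I : Opens ℝ)
    (f : ℝ → Space n → F) : Prop :=
  ∀ t ∈ I, ∀ γ ∈ Γ, ∀ x, f t (x + γ) = f t x

/-- A distribution `p` on `I × ℝⁿ` is `Γ`-periodic in space, that is, a distribution on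
`I × ℝⁿ/Γ`: it takes the same value on a test function and on its translates by `Γ`. -/
def IsPeriodicDistribution {n : ℕ} (Γ : Submodule ℤ (Space n)) {I : Opens ℝ}
    (p : 𝓓'(slab n I, ℝ)) : Prop :=
  ∀ γ ∈ Γ, ∀ φ ψ : 𝓓(slab n I, ℝ), (∀ t x, ψ (t, x) = φ (t, x + γ)) → p ψ = p φ

/-- A `Γ`-periodic distribution `p` on `I × ℝⁿ` has integral zero over the torus at each time.

A periodic `p` acts on a test function `θ` on `I × ℝⁿ/Γ` as `p φ`, where `φ` is any test function
on `I × ℝⁿ` with periodization `∑_γ φ(t, x + γ) = θ(t, x)`. The condition says that this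
pairing vanishes for all `θ` that depend on `t` only. If `p` is a locally integrable function, then
`p φ = ∫_I θ(t) (∫_{ℝⁿ/Γ} p(t, x) dx) dt` for such `θ`, so the condition says that
`∫_{ℝⁿ/Γ} p(t, x) dx = 0` for almost every `t` in `I`. The sum over `γ` has finitely many nonzero
terms. -/
def HasMeanZero {n : ℕ} (Γ : Submodule ℤ (Space n)) {I : Opens ℝ}
    (p : 𝓓'(slab n I, ℝ)) : Prop :=
  ∀ (φ : 𝓓(slab n I, ℝ)) (θ : ℝ → ℝ),
    (∀ t x, ∑' γ : Γ, φ (t, x + (γ : Space n)) = θ t) → p φ = 0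

/-- `(v, p)` solves the incompressible Euler equations
`∂ₜ vˡ + ∑ⱼ ∂ⱼ (vʲ vˡ) + ∂ₗ p = 0` and `∑ⱼ ∂ⱼ vʲ = 0` in the sense of distributions on
`I × ℝⁿ`. -/
structure IsWeakEulerSolution {n : ℕ} (I : Opens ℝ) (v : ℝ → Space n → Space n)
    (p : 𝓓'(slab n I, ℝ)) : Prop where
  momentum : ∀ (φ : 𝓓(slab n I, ℝ)) (l : Fin n),
    (∫ z in (slab n I : Set (ℝ × Space n)),
      (v z.1 z.2 l * (∂_{eTime n} φ) z
        + ∑ j : Fin n, v z.1 z.2 j * v z.1 z.2 l * (∂_{eSpace j} φ) z))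
      + p (∂_{eSpace l} φ) = 0
  divergence_free : ∀ φ : 𝓓(slab n I, ℝ),
    ∫ z in (slab n I : Set (ℝ × Space n)),
      ∑ j : Fin n, v z.1 z.2 j * (∂_{eSpace j} φ) z = 0

/-- `v ∈ L^∞_t C^α_x` on `I × ℝⁿ`: `v` is measurable in space-time and the essential supremum over
`t ∈ I` of the Hölder norms `‖v(t, ·)‖_{C^α}` is finite. -/
structure MemLinftyHolder {n : ℕ} (α : ℝ) (I : Opens ℝ) (v : ℝ → Space n → Space n) : Prop where
  measurable : AEStronglyMeasurable (fun z : ℝ × Space n => v z.1 z.2)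
    (volume.restrict (slab n I : Set (ℝ × Space n)))
  bounded : ∃ C : ℝ, ∀ᵐ t ∂(volume.restrict (I : Set ℝ)),
    (∀ x, ‖v t x‖ ≤ C) ∧ ∀ x y, ‖v t x - v t y‖ ≤ C * ‖x - y‖ ^ α

/-- `f ∈ C^s_{t,x}` on `I × ℝⁿ`, for an exponent `0 < s ≤ 1`: `f` is bounded and Hölder continuous
with exponent `s` jointly in time and space. For `s = 1` we ask in addition that `f` be continuously
differentiable (its first derivatives are then bounded by the Lipschitz constant), so that the
reading of `C^1` as continuously differentiable and the one as Lipschitz are both covered. -/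
structure MemHolderTX {n : ℕ} {F : Type*} [NormedAddCommGroup F] [NormedSpace ℝ F]
    (s : ℝ) (I : Opens ℝ) (f : ℝ → Space n → F) : Prop where
  bounded : ∃ C : ℝ, ∀ t ∈ I, ∀ x, ‖f t x‖ ≤ C
  holder : ∃ C : ℝ, ∀ t ∈ I, ∀ t' ∈ I, ∀ x x',
    ‖f t x - f t' x'‖ ≤ C * (|t - t'| + ‖x - x'‖) ^ s
  contDiff_of_eq_one : s = 1 →
    ContDiffOn ℝ 1 (fun z : ℝ × Space n => f z.1 z.2) (slab n I : Set (ℝ × Space n))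

/-- The distribution `p` on `I × ℝⁿ` is the (locally integrable) function `P`. -/
def IsRepresentedBy {n : ℕ} {I : Opens ℝ} (p : 𝓓'(slab n I, ℝ)) (P : ℝ → Space n → ℝ) : Prop :=
  LocallyIntegrableOn (fun z : ℝ × Space n => P z.1 z.2) (slab n I : Set (ℝ × Space n)) ∧
  ∀ φ : 𝓓(slab n I, ℝ),
    p φ = ∫ z in (slab n I : Set (ℝ × Space n)), P z.1 z.2 * φ z

end EulerReg

open Filter Topology
open scoped ContDiff Pointwise
set_option linter.unusedSectionVars false

/-! The pressure formally solves `-Δp = ∑ ∂ᵢ∂ⱼ(vⁱvʲ)`. The operators `∂ᵢ∂ⱼΔ⁻¹` are realised by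
averages `mol κ r` at scale `r`. `exists_profile` supplies `ρ` of integral one and `ψ` with `mol ρ
(r/2) - mol ρ r = mol (Δψ) r`, so `∂ᵢ∂ⱼΔ⁻¹` becomes `czSum (pd i (pd j ψ))`, a sum of averages over
the scales `2⁻ᵏ`, `k ∈ ℤ`. A weight of mean zero gains `rˢ` on `s`-Hölder functions, which controls
small scales, and `1/r` on periodic functions, which controls large ones. Hence `czSum` maps `Cˢ` to
bounded functions, and to `Cˢ` for `0 < s < 1` (`abs_czSum_sub_le`). Testing the momentum equation
with second derivatives of averaged test functions, where the time derivative drops out by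
incompressibility, identifies the given distribution with this sum (`apply_eq_integral_pressure`).

Regularity of `v` in time: by the momentum equation the average of `v` at scale `r` has a weak time
derivative of size `r^(α-1)`, while it differs from `v` by `O(r^α)`. Taking `r` comparable to `|t -
t'|` gives `|v(t) - v(t')| ≲ |t - t'|^α` off a null set of times (`exists_ae_holder_time`), and a
McShane extension yields the version `V` (`exists_holder_version`).

Doubling of the exponent for the pressure: let `p_λ` be the pressure of the average `v_λ`. Then `p =
p₁ + ∑ (p_{λ/2} - p_λ)` over `λ = 2⁻ᵐ`, `m ≥ 0`. Here `v_{λ/2} ⊗ v_{λ/2} - v_λ ⊗ v_λ` is the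
symmetrised product of `w = v_{λ/2} - v_λ` with `S = v_{λ/2} + v_λ`, and incompressibility makes `w`
the divergence of an antisymmetric matrix `B` of size `λ^(1+a)`. The term `∂ᵢ∂ⱼ∂ₖ(Bₖᵢ Sⱼ)` vanishes
by antisymmetry, leaving `Bₖᵢ ∂ₖSⱼ`, of size `λ^(2a)` (`sum_mol_mul_sub`). Every derivative, in
space or, through the momentum equation, in time, costs `λ⁻¹`; this is what `IsScaledC1` records.
Since `czSum` is not bounded on bounded functions it costs `λ^(-ε)`. Summing the dyadic series gives
joint Hölder exponents below `2a - ε`, and termwise differentiation when this exceeds one. With `β <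
a < α` and `ε = a - β` one has `2a - ε = a + β > 2β`, so all losses are absorbed by the gap between
`β` and `α`. -/

namespace EulerReg

/-! ### Averages at scale `r` with smooth compactly supported weights -/

section Kernels

variable {n : ℕ} {G : Type*} [NormedAddCommGroup G] [NormedSpace ℝ G]

/-- The `j`-th partial derivative of a function on `ℝⁿ`. -/
noncomputable def pd (j : Fin n) (κ : Space n → ℝ) (y : Space n) : ℝ :=
  fderiv ℝ κ y (EuclideanSpace.single j 1)

/-- Smooth and compactly supported functions on `ℝⁿ`. -/
structure IsKernel (κ : Space n → ℝ) : Prop where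
  smooth : ContDiff ℝ ∞ κ
  compact : HasCompactSupport κ

/-- The average `∫ κ(y) f(x - r y) dy` of `f` at scale `r` with weight `κ`. -/
noncomputable def mol (κ : Space n → ℝ) (r : ℝ) (f : Space n → G) (x : Space n) : G :=
  ∫ y, κ y • f (x - r • y)

/-- The absolute moment of order `α` of `κ`. -/
noncomputable def absMoment (α : ℝ) (κ : Space n → ℝ) : ℝ := ∫ y, |κ y| * ‖y‖ ^ α

lemma absMoment_nonneg (α : ℝ) (κ : Space n → ℝ) : 0 ≤ absMoment α κ :=
  integral_nonneg fun y => by positivity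

namespace IsKernel

variable {κ κ' : Space n → ℝ}

lemma continuous (h : IsKernel κ) : Continuous κ := h.smooth.continuous

lemma integrable (h : IsKernel κ) : Integrable κ :=
  h.continuous.integrable_of_hasCompactSupport h.compact

lemma differentiable (h : IsKernel κ) : Differentiable ℝ κ :=
  h.smooth.differentiable (by simp)

lemma pd (h : IsKernel κ) (j : Fin n) : IsKernel (pd j κ) where
  smooth := (h.smooth.fderiv_right (m := ∞) (by simp)).clm_apply contDiff_const
  compact := by
    have := h.compact.fderiv (𝕜 := ℝ)
    exact this.comp_left (g := fun L : Space n →L[ℝ] ℝ => L (EuclideanSpace.single j 1)) (by simp)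

lemma add (h : IsKernel κ) (h' : IsKernel κ') : IsKernel (fun y => κ y + κ' y) :=
  ⟨h.smooth.add h'.smooth, h.compact.add h'.compact⟩

lemma const_mul (h : IsKernel κ) (c : ℝ) : IsKernel (fun y => c * κ y) :=
  ⟨contDiff_const.mul h.smooth, h.compact.mul_left⟩

lemma comp_smul (h : IsKernel κ) {c : ℝ} (hc : c ≠ 0) : IsKernel (fun y => κ (c • y)) :=
  ⟨h.smooth.comp (contDiff_const_smul c), h.compact.comp_smul hc⟩

lemma pd_comm (h : IsKernel κ) (i j : Fin n) :
    EulerReg.pd i (EulerReg.pd j κ) = EulerReg.pd j (EulerReg.pd i κ) := by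
  have key : ∀ (i j : Fin n) (y : Space n), EulerReg.pd i (EulerReg.pd j κ) y =
      fderiv ℝ (fderiv ℝ κ) y (EuclideanSpace.single i 1) (EuclideanSpace.single j 1) := by
    intro i j y
    have hd : DifferentiableAt ℝ (fderiv ℝ κ) y :=
      ((h.smooth.fderiv_right (m := ∞) (by simp)).differentiable (by simp)).differentiableAt
    unfold EulerReg.pd
    rw [fderiv_clm_apply hd (differentiableAt_const _)]
    simp
  ext y
  rw [key, key]
  have h2 : (2 : WithTop ℕ∞) ≤ ∞ := WithTop.coe_le_coe.2 (le_top (a := (2 : ℕ∞)))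
  exact (h.smooth.contDiffAt.isSymmSndFDerivAt (by simpa using h2)) _ _

lemma integrable_abs_mul_rpow (h : IsKernel κ) {α : ℝ} (hα : 0 ≤ α) :
    Integrable (fun y => |κ y| * ‖y‖ ^ α) := by
  refine Continuous.integrable_of_hasCompactSupport ?_ ?_
  · exact h.continuous.abs.mul (continuous_norm.rpow_const fun x => Or.inr hα)
  · exact (h.compact.comp_left (g := fun s : ℝ => |s|) abs_zero).mul_right

lemma integrable_smul_comp (h : IsKernel κ) {f : Space n → G} (hf : Continuous f) (r : ℝ)
    (x : Space n) : Integrable (fun y => κ y • f (x - r • y)) := by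
  refine Continuous.integrable_of_hasCompactSupport ?_ ?_
  · exact h.continuous.smul (by fun_prop)
  · exact h.compact.smul_right

lemma integral_mul_pd (h : IsKernel κ) {g : Space n → ℝ} (hg : ContDiff ℝ 1 g) (j : Fin n) :
    ∫ y, EulerReg.pd j κ y * g y = - ∫ y, κ y * fderiv ℝ g y (EuclideanSpace.single j 1) := by
  have hg' := hg.continuous
  have hgd : Continuous fun y => fderiv ℝ g y (EuclideanSpace.single j 1) :=
    (hg.continuous_fderiv (by simp)).clm_apply continuous_const
  have := integral_mul_fderiv_eq_neg_fderiv_mul_of_integrable (μ := volume) (f := κ) (g := g)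
    (v := EuclideanSpace.single j (1 : ℝ)) ?_ ?_ ?_ (fun x _ => h.differentiable x)
    (fun x _ => hg.differentiable (by simp) x)
  · rw [this, neg_neg]; rfl
  · exact ((h.pd j).continuous.mul hg').integrable_of_hasCompactSupport (h.pd j).compact.mul_right
  · exact (h.continuous.mul hgd).integrable_of_hasCompactSupport h.compact.mul_right
  · exact (h.continuous.mul hg').integrable_of_hasCompactSupport h.compact.mul_right

/-- Integrate by parts against the constant one. This is the source of all cancellation below:
weights of derivative type annihilate constants. -/
lemma integral_pd (h : IsKernel κ) (j : Fin n) : ∫ y, EulerReg.pd j κ y = 0 := by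
  simpa using h.integral_mul_pd (g := fun _ => 1) contDiff_const j

end IsKernel

variable {κ : Space n → ℝ} {r A α : ℝ} {f g : Space n → G}

lemma norm_mol_le (hκ : Integrable κ) (hf : ∀ x, ‖f x‖ ≤ A) (x : Space n) :
    ‖mol κ r f x‖ ≤ (∫ y, |κ y|) * A := by
  rw [← integral_mul_const]
  refine norm_integral_le_of_norm_le (hκ.abs.mul_const A) (Eventually.of_forall fun y => ?_)
  rw [norm_smul, Real.norm_eq_abs]
  exact mul_le_mul_of_nonneg_left (hf _) (abs_nonneg _)

lemma mol_sub (hκ : IsKernel κ) (hf : Continuous f) (hg : Continuous g) (x : Space n) :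
    mol κ r (fun y => f y - g y) x = mol κ r f x - mol κ r g x := by
  simp only [mol, smul_sub]
  exact integral_sub (hκ.integrable_smul_comp hf r x) (hκ.integrable_smul_comp hg r x)

lemma mol_add (hκ : IsKernel κ) (hf : Continuous f) (hg : Continuous g) (x : Space n) :
    mol κ r (fun y => f y + g y) x = mol κ r f x + mol κ r g x := by
  simp only [mol, smul_add]
  exact integral_add (hκ.integrable_smul_comp hf r x) (hκ.integrable_smul_comp hg r x)

lemma mol_sum {ι : Type*} (s : Finset ι) {f : ι → Space n → G} (hκ : IsKernel κ)
    (hf : ∀ i, Continuous (f i)) (x : Space n) :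
    mol κ r (fun y => ∑ i ∈ s, f i y) x = ∑ i ∈ s, mol κ r (f i) x := by
  simp only [mol, Finset.smul_sum]
  exact integral_finsetSum _ fun i _ => hκ.integrable_smul_comp (hf i) r x

lemma mol_kernel_add {κ' : Space n → ℝ} (hκ : IsKernel κ) (hκ' : IsKernel κ') (hf : Continuous f)
    (x : Space n) : mol (fun y => κ y + κ' y) r f x = mol κ r f x + mol κ' r f x := by
  simp only [mol, add_smul]
  exact integral_add (hκ.integrable_smul_comp hf r x) (hκ'.integrable_smul_comp hf r x)

lemma mol_kernel_sum {ι : Type*} (s : Finset ι) {κ : ι → Space n → ℝ} (hκ : ∀ i, IsKernel (κ i))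
    (hf : Continuous f) (x : Space n) :
    mol (fun y => ∑ i ∈ s, κ i y) r f x = ∑ i ∈ s, mol (κ i) r f x := by
  simp only [mol, Finset.sum_smul]
  exact integral_finsetSum _ fun i _ => (hκ i).integrable_smul_comp hf r x

lemma mol_translate (x h : Space n) : mol κ r (fun y => f (y + h)) x = mol κ r f (x + h) := by
  simp only [mol]
  congr 1; ext y; congr 2; abel

/-- The difference is `∫ κ(y) (f(x - r y) - f(x)) dy`, and the increment of `f` is at most `A |r|^α
‖y‖^α`. For a weight of mean zero this is the gain at small scales. -/
lemma norm_mol_sub_le [CompleteSpace G] (hκ : IsKernel κ) (hα : 0 ≤ α) (hfc : Continuous f)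
    (hf : ∀ x y, ‖f x - f y‖ ≤ A * ‖x - y‖ ^ α) (x : Space n) :
    ‖mol κ r f x - (∫ y, κ y) • f x‖ ≤ absMoment α κ * (A * |r| ^ α) := by
  have h1 : mol κ r f x - (∫ y, κ y) • f x = ∫ y, κ y • (f (x - r • y) - f x) := by
    simp only [mol, smul_sub]
    rw [integral_sub (hκ.integrable_smul_comp hfc r x) (hκ.integrable.smul_const _),
      integral_smul_const]
  rw [h1, absMoment, ← integral_mul_const]
  refine norm_integral_le_of_norm_le ((hκ.integrable_abs_mul_rpow hα).mul_const _)
    (Eventually.of_forall fun y => ?_)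
  rw [norm_smul, Real.norm_eq_abs, mul_assoc]
  refine mul_le_mul_of_nonneg_left ((hf _ _).trans (le_of_eq ?_)) (abs_nonneg _)
  rw [sub_sub_cancel_left, norm_neg, norm_smul, Real.mul_rpow (norm_nonneg _) (norm_nonneg _),
    Real.norm_eq_abs]
  ring

lemma norm_mol_le_of_holder [CompleteSpace G] (hκ : IsKernel κ) (h0 : ∫ y, κ y = 0) (hα : 0 ≤ α)
    (hfc : Continuous f) (hf : ∀ x y, ‖f x - f y‖ ≤ A * ‖x - y‖ ^ α) (x : Space n) :
    ‖mol κ r f x‖ ≤ absMoment α κ * (A * |r| ^ α) := by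
  simpa [h0] using norm_mol_sub_le (r := r) hκ hα hfc hf x

lemma continuous_mol (hκ : IsKernel κ) (hf : Continuous f) : Continuous (mol κ r f) := by
  have hK : IsCompact (tsupport κ) := hκ.compact
  have : mol κ r f = fun x => ∫ y in tsupport κ, κ y • f (x - r • y) := by
    ext x
    refine (setIntegral_eq_integral_of_forall_compl_eq_zero fun y hy => ?_).symm
    rw [image_eq_zero_of_notMem_tsupport hy, zero_smul]
  rw [this]
  refine continuous_parametric_integral_of_continuous ?_ hK
  exact (hκ.continuous.comp continuous_snd).smul (by fun_prop)

/-- Integration by parts in `y`: differentiating `g(x - r y)` produces a factor `-r`. -/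
lemma mol_pd_eq (hκ : IsKernel κ) {g : Space n → ℝ} (hg : ContDiff ℝ 1 g) (j : Fin n) (r : ℝ)
    (x : Space n) :
    mol (pd j κ) r g x = r * mol κ r (fun y => fderiv ℝ g y (EuclideanSpace.single j 1)) x := by
  have hc : ContDiff ℝ 1 (fun y => g (x - r • y)) :=
    hg.comp (contDiff_const.sub (contDiff_const_smul r))
  have := hκ.integral_mul_pd hc j
  simp only [mol, smul_eq_mul]
  rw [this, ← integral_neg, ← integral_const_mul]
  congr 1; ext y
  have h1 : HasFDerivAt (fun y : Space n => x - r • y) (-(r • ContinuousLinearMap.id ℝ (Space n))) y := by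
    simpa using ((hasFDerivAt_id y).const_smul r).const_sub x
  have h2 := (hg.differentiable (by simp) (x - r • y)).hasFDerivAt.comp y h1
  have h3 : fderiv ℝ (fun y => g (x - r • y)) y = _ := h2.fderiv
  rw [h3]
  simp
  ring

/-- Up to the Jacobian of the dilation the average is a convolution with `κ(·/r)`. The derivative
therefore falls on the weight, at the price `r⁻¹`, and `f` need only be continuous. -/
lemma hasFDerivAt_mol (hκ : IsKernel κ) (hr : r ≠ 0) {f : Space n → ℝ} (hf : Continuous f)
    (x : Space n) :
    HasFDerivAt (mol κ r f)
      (∑ j, (r⁻¹ * mol (pd j κ) r f x) • (EuclideanSpace.proj j : Space n →L[ℝ] ℝ)) x := by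
  have hκr : ContDiff ℝ 1 (fun y => κ (r⁻¹ • y)) :=
    (hκ.smooth.of_le (by simp)).comp (contDiff_const_smul _)
  have hcs : HasCompactSupport (fun y => κ (r⁻¹ • y)) := hκ.compact.comp_smul (inv_ne_zero hr)
  have key := hcs.hasFDerivAt_convolution_left (ContinuousLinearMap.mul ℝ ℝ) (μ := volume) hκr
    hf.locallyIntegrable x
  have hconv : ∀ (k : Space n → ℝ) (x : Space n), ∫ y, k (r⁻¹ • y) * f (x - y) =
      |r ^ Module.finrank ℝ (Space n)| * mol k r f x := by
    intro k x
    have := Measure.integral_comp_inv_smul (volume : Measure (Space n))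
      (fun y => k y * f (x - r • y)) r
    simp only [smul_inv_smul₀ hr, smul_eq_mul] at this
    simp only [mol, smul_eq_mul]
    rw [← this]
  set c := |r ^ Module.finrank ℝ (Space n)| with hc
  have hc0 : c ≠ 0 := by positivity
  have hfun : mol κ r f = fun x => c⁻¹ * convolution (fun y => κ (r⁻¹ • y)) f
      (ContinuousLinearMap.mul ℝ ℝ) volume x := by
    ext x
    simp only [convolution, ContinuousLinearMap.mul_apply']
    rw [hconv, inv_mul_cancel_left₀ hc0]
  rw [hfun]
  convert! key.const_mul c⁻¹ using 1
  have hint : Integrable (fun y => ((ContinuousLinearMap.mul ℝ ℝ).precompL (Space n))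
      (fderiv ℝ (fun y => κ (r⁻¹ • y)) y) (f (x - y))) := by
    refine Continuous.integrable_of_hasCompactSupport ?_ ?_
    · have := hκr.continuous_fderiv (by simp)
      fun_prop
    · refine (hcs.fderiv (𝕜 := ℝ)).mono ?_
      intro y hy
      contrapose! hy
      simp only [Function.mem_support, not_not] at hy
      simp [hy]
  ext v
  rw [smul_apply, convolution, ContinuousLinearMap.integral_apply hint,
    sum_apply]
  have hd : ∀ y, fderiv ℝ (fun y => κ (r⁻¹ • y)) y v = ∑ j, v j * (r⁻¹ * pd j κ (r⁻¹ • y)) := by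
    intro y
    have h2 : HasFDerivAt (fun y : Space n => κ (r⁻¹ • y))
        ((fderiv ℝ κ (r⁻¹ • y)).comp (r⁻¹ • ContinuousLinearMap.id ℝ (Space n))) y :=
      ((hκ.differentiable (r⁻¹ • y)).hasFDerivAt).comp y
        ((ContinuousLinearMap.id ℝ (Space n)).hasFDerivAt.const_smul r⁻¹)
    rw [h2.fderiv]
    have hv : v = ∑ j, v j • EuclideanSpace.single j (1 : ℝ) := by
      simpa using ((EuclideanSpace.basisFun (Fin n) ℝ).sum_repr v).symm
    conv_lhs => rw [hv]
    simp only [map_sum, map_smul, ContinuousLinearMap.comp_apply, smul_apply,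
      ContinuousLinearMap.id_apply, smul_eq_mul, pd]
  have h4 : ∀ y, ((ContinuousLinearMap.mul ℝ ℝ).precompL (Space n))
      (fderiv ℝ (fun y => κ (r⁻¹ • y)) y) (f (x - y)) v =
      ∑ j, (v j * r⁻¹) * (pd j κ (r⁻¹ • y) * f (x - y)) := by
    intro y
    rw [ContinuousLinearMap.precompL_apply, ContinuousLinearMap.mul_apply', hd, Finset.sum_mul]
    exact Finset.sum_congr rfl fun j _ => by ring
  simp only [h4]
  rw [integral_finsetSum _ fun j _ => ?_]
  · rw [smul_eq_mul, Finset.mul_sum]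
    refine Finset.sum_congr rfl fun j _ => ?_
    rw [integral_const_mul, hconv]
    simp only [smul_apply, smul_eq_mul]
    field_simp
    rfl
  · refine Integrable.const_mul ?_ _
    refine Continuous.integrable_of_hasCompactSupport ?_ ?_
    · exact ((hκ.pd j).continuous.comp (continuous_const_smul _)).mul (by fun_prop)
    · exact ((hκ.pd j).compact.comp_smul (inv_ne_zero hr)).mul_right

lemma contDiff_one_mol (hκ : IsKernel κ) (hr : r ≠ 0) {f : Space n → ℝ} (hf : Continuous f) :
    ContDiff ℝ 1 (mol κ r f) := by
  rw [contDiff_one_iff_hasFDerivAt]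
  exact ⟨_, continuous_finsetSum _ fun j _ =>
    (continuous_const.mul (continuous_mol (hκ.pd j) hf)).smul continuous_const, hasFDerivAt_mol hκ hr hf⟩

lemma fderiv_mol_single (hκ : IsKernel κ) (hr : r ≠ 0) {f : Space n → ℝ} (hf : Continuous f)
    (x : Space n) (j : Fin n) :
    fderiv ℝ (mol κ r f) x (EuclideanSpace.single j 1) = r⁻¹ * mol (pd j κ) r f x := by
  rw [(hasFDerivAt_mol hκ hr hf x).fderiv, sum_apply,
    Finset.sum_eq_single j]
  · simp
  · intro i _ hij
    simp [hij]
  · simp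

lemma abs_mol_sub_mol_le (hκ : IsKernel κ) (hr : r ≠ 0) {f : Space n → ℝ} (hf : Continuous f)
    {B : Fin n → ℝ} (hB : ∀ j x, |mol (pd j κ) r f x| ≤ B j) (x y : Space n) :
    |mol κ r f x - mol κ r f y| ≤ |r|⁻¹ * (∑ j, B j) * ‖x - y‖ := by
  have := (convex_univ (E := Space n)).norm_image_sub_le_of_norm_hasFDerivWithin_le
    (f := mol κ r f) (C := |r|⁻¹ * ∑ j, B j)
    (fun z _ => (hasFDerivAt_mol hκ hr hf z).hasFDerivWithinAt) (fun z _ => ?_)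
    (Set.mem_univ y) (Set.mem_univ x)
  · simpa using this
  · refine (norm_sum_le _ _).trans ?_
    rw [Finset.mul_sum]
    refine Finset.sum_le_sum fun j _ => ?_
    rw [norm_smul, norm_mul, norm_inv, Real.norm_eq_abs, Real.norm_eq_abs]
    have hp : ‖(EuclideanSpace.proj j : Space n →L[ℝ] ℝ)‖ ≤ 1 :=
      ContinuousLinearMap.opNorm_le_bound _ zero_le_one fun v => by
        simpa using PiLp.norm_apply_le v j
    calc |r|⁻¹ * |mol (pd j κ) r f z| * ‖(EuclideanSpace.proj j : Space n →L[ℝ] ℝ)‖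
        ≤ |r|⁻¹ * |mol (pd j κ) r f z| * 1 := by gcongr
      _ ≤ |r|⁻¹ * B j := by rw [mul_one]; gcongr; exact hB j z

end Kernels

/-! ### Smooth dependence of integrals on parameters, for measures carried by compact sets -/

section ParametricIntegral

lemma integrable_of_continuous_of_compact {A : Type*} [NormedAddCommGroup A] [MeasurableSpace A] [BorelSpace A]
    [SecondCountableTopology A] {G : Type*} [NormedAddCommGroup G] {μ : Measure A}
    [IsFiniteMeasure μ] {K : Set A} (hK : IsCompact K) (hμ : μ Kᶜ = 0) {f : A → G}
    (hf : Continuous f) : Integrable f μ := by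
  obtain ⟨C, hC⟩ := hK.exists_bound_of_continuousOn hf.continuousOn
  refine Integrable.of_bound hf.aestronglyMeasurable C ?_
  have : ∀ᵐ a ∂μ, a ∈ K := by rwa [ae_iff]
  filter_upwards [this] with a ha using hC a ha

variable {E A : Type} [NormedAddCommGroup E] [NormedSpace ℝ E] [ProperSpace E]
  [NormedAddCommGroup A] [NormedSpace ℝ A] [MeasurableSpace A] [BorelSpace A]
  [SecondCountableTopology A]

lemma hasFDerivAt_integral_of_compact {G : Type} [NormedAddCommGroup G] [NormedSpace ℝ G]
    {μ : Measure A} [IsFiniteMeasure μ] {K : Set A} (hK : IsCompact K) (hμ : μ Kᶜ = 0)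
    {f : E × A → G} (hf : ContDiff ℝ 1 f) (x : E) :
    HasFDerivAt (fun x => ∫ a, f (x, a) ∂μ)
      (∫ a, (fderiv ℝ f (x, a)).comp (ContinuousLinearMap.inl ℝ E A) ∂μ) x := by
  have hc : Continuous fun z : E × A => (fderiv ℝ f z).comp (ContinuousLinearMap.inl ℝ E A) :=
    (hf.continuous_fderiv (by simp)).clm_comp continuous_const
  -- Since `μ` is carried by `K`, a bound on ball times `K` is a constant integrable majorant for
  -- the derivatives.
  obtain ⟨C, hC⟩ := ((isCompact_closedBall x 1).prod hK).exists_bound_of_continuousOn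
    hc.continuousOn
  have hae : ∀ᵐ a ∂μ, a ∈ K := by rwa [ae_iff]
  refine hasFDerivAt_integral_of_dominated_of_fderiv_le (bound := fun _ => C)
    (F' := fun x a => (fderiv ℝ f (x, a)).comp (ContinuousLinearMap.inl ℝ E A))
    (Metric.closedBall_mem_nhds x one_pos) ?_ ?_ ?_ ?_ (integrable_const C) ?_
  · exact Eventually.of_forall fun y => (hf.continuous.comp (by fun_prop)).aestronglyMeasurable
  · exact integrable_of_continuous_of_compact hK hμ (hf.continuous.comp (by fun_prop))
  · exact (hc.comp (by fun_prop : Continuous fun a : A => (x, a))).aestronglyMeasurable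
  · filter_upwards [hae] with a ha y hy using hC (y, a) ⟨hy, ha⟩
  · refine Eventually.of_forall fun a y _ => ?_
    exact ((hf.differentiable (by simp)) (y, a)).hasFDerivAt.comp y (hasFDerivAt_prodMk_left y a)

/-- Induction on the order of differentiability. Each step replaces `G` by `E →L[ℝ] G`, so the
target is generalised and all spaces are kept in one universe. -/
lemma contDiff_integral_of_compact {G : Type} [NormedAddCommGroup G] [NormedSpace ℝ G]
    {μ : Measure A} [IsFiniteMeasure μ] {K : Set A} (hK : IsCompact K) (hμ : μ Kᶜ = 0)
    {f : E × A → G} (hf : ContDiff ℝ ∞ f) : ContDiff ℝ ∞ (fun x => ∫ a, f (x, a) ∂μ) := by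
  rw [contDiff_infty]
  intro k
  induction k generalizing G with
  | zero =>
    simp only [CharP.cast_eq_zero, contDiff_zero]
    rw [continuous_iff_continuousAt]
    intro x
    exact (hasFDerivAt_integral_of_compact hK hμ (hf.of_le (by simp)) x).continuousAt
  | succ k ih =>
    have := contDiff_succ_iff_hasFDerivAt (𝕜 := ℝ) (n := k) (f := fun x => ∫ a, f (x, a) ∂μ)
    push_cast
    rw [this]
    refine ⟨fun x => ∫ a, (fderiv ℝ f (x, a)).comp (ContinuousLinearMap.inl ℝ E A) ∂μ, ?_,
      hasFDerivAt_integral_of_compact hK hμ (hf.of_le (by simp))⟩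
    exact ih (f := fun z => (fderiv ℝ f z).comp (ContinuousLinearMap.inl ℝ E A))
      ((hf.fderiv_right (m := ∞) (by simp)).clm_comp contDiff_const)

end ParametricIntegral

/-! ### A weight whose dyadic increments are Laplacians -/

section Profile

variable {n : ℕ}

/-- The average of `k` over the dilations `y ↦ e^s y`, `0 ≤ s ≤ log 2`, with weight `e^{q s}`. -/
noncomputable def dilationMean (q : ℝ) (k : Space n → ℝ) (y : Space n) : ℝ :=
  ∫ s in Set.Icc 0 (Real.log 2), Real.exp (q * s) * k (Real.exp s • y)

lemma contDiff_dilationMean_integrand (q : ℝ) {k : Space n → ℝ} (hk : ContDiff ℝ ∞ k) :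
    ContDiff ℝ ∞ (fun z : Space n × ℝ => Real.exp (q * z.2) * k (Real.exp z.2 • z.1)) := by
  fun_prop

lemma restrict_Icc_compl (a b : ℝ) : (volume.restrict (Set.Icc a b)) (Set.Icc a b)ᶜ = 0 := by
  rw [Measure.restrict_apply measurableSet_Icc.compl]
  simp

lemma IsKernel.dilationMean (q : ℝ) {k : Space n → ℝ} (hk : IsKernel k) :
    IsKernel (dilationMean q k) where
  smooth := contDiff_integral_of_compact isCompact_Icc (restrict_Icc_compl 0 (Real.log 2))
    (contDiff_dilationMean_integrand q hk.smooth)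
  compact := by
    obtain ⟨R, hR⟩ := hk.compact.isCompact.isBounded.subset_closedBall 0
    refine HasCompactSupport.intro (isCompact_closedBall (0 : Space n) R) fun y hy => ?_
    have : ∀ s ∈ Set.Icc 0 (Real.log 2), Real.exp (q * s) * k (Real.exp s • y) = 0 := by
      intro s hs
      rw [image_eq_zero_of_notMem_tsupport (f := k), mul_zero]
      intro h
      have h1 := hR h
      rw [mem_closedBall_zero_iff, norm_smul, Real.norm_eq_abs, Real.abs_exp] at h1
      apply hy
      rw [mem_closedBall_zero_iff]
      have h2 : 1 ≤ Real.exp s := Real.one_le_exp hs.1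
      nlinarith [norm_nonneg y]
    rw [EulerReg.dilationMean, setIntegral_congr_fun measurableSet_Icc this]
    simp

/-- Differentiating `k(eˢ y)` brings out a factor `eˢ`, which raises the exponent of the weight by
one. -/
lemma pd_dilationMean (q : ℝ) {k : Space n → ℝ} (hk : IsKernel k) (j : Fin n) :
    pd j (dilationMean q k) = dilationMean (q + 1) (pd j k) := by
  ext y
  have hf := contDiff_dilationMean_integrand q hk.smooth
  have h := hasFDerivAt_integral_of_compact isCompact_Icc (restrict_Icc_compl 0 (Real.log 2))
    (hf.of_le (by simp)) y
  have hi : Integrable (fun s => (fderiv ℝ (fun z : Space n × ℝ => Real.exp (q * z.2) *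
      k (Real.exp z.2 • z.1)) (y, s)).comp (ContinuousLinearMap.inl ℝ (Space n) ℝ))
      (volume.restrict (Set.Icc 0 (Real.log 2))) := by
    refine integrable_of_continuous_of_compact isCompact_Icc (restrict_Icc_compl 0 (Real.log 2)) ?_
    have := hf.continuous_fderiv (by simp)
    fun_prop
  unfold pd dilationMean
  rw [h.fderiv, ContinuousLinearMap.integral_apply hi]
  congr 1; ext s
  have h1 : HasFDerivAt (fun y : Space n => Real.exp (q * s) * k (Real.exp s • y))
      (Real.exp (q * s) • (fderiv ℝ k (Real.exp s • y)).comp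
        (Real.exp s • ContinuousLinearMap.id ℝ (Space n))) y :=
    (((hk.differentiable (Real.exp s • y)).hasFDerivAt).comp y
        ((ContinuousLinearMap.id ℝ (Space n)).hasFDerivAt.const_smul (Real.exp s))).const_mul _
  have h2 := ((hf.differentiable (by simp)) (y, s)).hasFDerivAt.comp y
    (hasFDerivAt_prodMk_left (𝕜 := ℝ) y s)
  have h3 := h2.unique h1
  rw [h3]
  simp only [smul_apply, ContinuousLinearMap.comp_apply,
    ContinuousLinearMap.id_apply, map_smul, smul_eq_mul]
  rw [add_mul, Real.exp_add, one_mul]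
  ring

/-- The integrand is the derivative in `s` of `e^(ns) ρ(eˢ y)`, evaluated between `s = 0` and `s =
log 2`. Note that `nρ + y·∇ρ` is the divergence of `ρ(y) y`. -/
lemma integral_exp_dilation {ρ : Space n → ℝ} (hρ : IsKernel ρ) (y : Space n) :
    ∫ s in Set.Icc 0 (Real.log 2), Real.exp (n * s) *
      (n * ρ (Real.exp s • y) + fderiv ℝ ρ (Real.exp s • y) (Real.exp s • y)) =
      2 ^ n * ρ ((2 : ℝ) • y) - ρ y := by
  have hlog : 0 ≤ Real.log 2 := Real.log_nonneg (by norm_num)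
  rw [integral_Icc_eq_integral_Ioc, ← intervalIntegral.integral_of_le hlog]
  have hd : ∀ s : ℝ, HasDerivAt (fun s => Real.exp (n * s) * ρ (Real.exp s • y))
      (Real.exp (n * s) *
      (n * ρ (Real.exp s • y) + fderiv ℝ ρ (Real.exp s • y) (Real.exp s • y))) s := by
    intro s
    have h1 : HasDerivAt (fun s : ℝ => Real.exp (n * s)) (Real.exp (n * s) * n) s := by
      simpa using ((hasDerivAt_id s).const_mul (n : ℝ)).exp
    have h2 : HasDerivAt (fun s => ρ (Real.exp s • y))
        (fderiv ℝ ρ (Real.exp s • y) (Real.exp s • y)) s :=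
      (hρ.differentiable (Real.exp s • y)).hasFDerivAt.comp_hasDerivAt s
        ((Real.hasDerivAt_exp s).smul_const y)
    convert! h1.mul h2 using 1
    ring
  rw [intervalIntegral.integral_eq_sub_of_hasDerivAt (fun s _ => hd s)]
  · rw [Real.exp_log (by norm_num), mul_comm (n : ℝ) (Real.log 2),
      ← Real.rpow_def_of_pos (by norm_num)]
    simp
  · refine Continuous.intervalIntegrable ?_ _ _
    have := hρ.smooth.continuous_fderiv (by simp)
    have := hρ.continuous
    fun_prop

lemma fderiv_apply_self (ρ : Space n → ℝ) (y : Space n) :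
    fderiv ℝ ρ y y = ∑ j, y j * pd j ρ y := by
  have hv : y = ∑ j, y j • EuclideanSpace.single j (1 : ℝ) := by
    simpa using ((EuclideanSpace.basisFun (Fin n) ℝ).sum_repr y).symm
  conv_lhs => rw [hv]
  simp only [map_sum, map_smul, smul_eq_mul, pd]
  rw [← hv]

/-- A kernel `ρ` of integral one whose dyadic increments are Laplacians of a fixed kernel. -/
lemma exists_profile (hn : 0 < n) : ∃ ρ ψ : Space n → ℝ, IsKernel ρ ∧ IsKernel ψ ∧
    ∫ y, ρ y = 1 ∧ ∀ y, ∑ j, pd j (pd j ψ) y = 2 ^ n * ρ ((2 : ℝ) • y) - ρ y := by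
  -- `g` is smooth, nonincreasing and vanishes on `[1, ∞)`. With `ρ₀ = 2 g'(|y|²)` one has
  -- `∇(g(|y|²)) = ρ₀(y) y`, so the Laplacian of `g(|y|²)` is `div(ρ₀ y)`, the integrand of
  -- `integral_exp_dilation`.
  set g : ℝ → ℝ := fun u => expNegInvGlue (1 - u) with hg
  have hgs : ContDiff ℝ ∞ g := expNegInvGlue.contDiff.comp (contDiff_const.sub contDiff_id)
  have hgd : Differentiable ℝ g := hgs.differentiable (by simp)
  have hg1 : ∀ u, 1 ≤ u → g u = 0 := fun u hu => expNegInvGlue.zero_of_nonpos (by linarith)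
  have hga : Antitone g := fun a b hab => expNegInvGlue.monotone (by linarith)
  have hg's : ContDiff ℝ ∞ (deriv g) := hgs.deriv'
  have hg'1 : ∀ u, 1 < u → deriv g u = 0 := by
    intro u hu
    have : g =ᶠ[𝓝 u] fun _ => 0 := by
      filter_upwards [lt_mem_nhds hu] with v hv using hg1 v hv.le
    rw [this.deriv_eq]; simp
  set ρ₀ : Space n → ℝ := fun y => 2 * deriv g (‖y‖ ^ 2) with hρ₀
  have hρ₀k : IsKernel ρ₀ := by
    refine ⟨contDiff_const.mul (hg's.comp (contDiff_norm_sq ℝ)), ?_⟩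
    refine HasCompactSupport.intro (isCompact_closedBall (0 : Space n) 1) fun y hy => ?_
    rw [mem_closedBall_zero_iff, not_le] at hy
    simp only [hρ₀]
    rw [hg'1 _ (by nlinarith), mul_zero]
  -- `ρ₀` has one sign. A zero integral would force `g' = 0` on `[0, 1)`, read off at points of norm
  -- `√u`, hence `g 0 = g 1 = 0`, although `g 0 > 0`.
  have hI : ∫ y, ρ₀ y ≠ 0 := by
    intro h0
    have hle : ∀ y, 0 ≤ -ρ₀ y := fun y => by
      have := hga.deriv_nonpos (x := ‖y‖ ^ 2)
      simp only [hρ₀]; linarith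
    have h1 : ∫ y, -ρ₀ y = 0 := by rw [integral_neg, h0, neg_zero]
    have h2 : (fun y => -ρ₀ y) = 0 := hρ₀k.continuous.neg.ae_eq_iff_eq volume continuous_zero |>.1
      ((integral_eq_zero_iff_of_nonneg hle hρ₀k.integrable.neg).1 h1)
    have h3 : ∀ u ∈ Set.Ico (0 : ℝ) 1, deriv g u = 0 := by
      intro u hu
      have := congrFun h2 (EuclideanSpace.single ⟨0, hn⟩ (Real.sqrt u))
      simp only [Pi.zero_apply, neg_eq_zero, hρ₀, mul_eq_zero, PiLp.norm_single,
        Real.norm_eq_abs, sq_abs, Real.sq_sqrt hu.1] at this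
      simpa using this
    have h4 := constant_of_derivWithin_zero (f := g) (a := 0) (b := 1) hgd.differentiableOn
      (fun u hu => by
        rw [(hgd u).derivWithin (uniqueDiffOn_Icc zero_lt_one u ⟨hu.1, hu.2.le⟩), h3 u hu]) 1
      (by simp)
    rw [hg1 1 le_rfl] at h4
    have h5 : 0 < g 0 := expNegInvGlue.pos_of_pos (by norm_num)
    linarith
  set c := (∫ y, ρ₀ y)⁻¹ with hc
  set ρ : Space n → ℝ := fun y => c * ρ₀ y with hρ
  have hρk : IsKernel ρ := hρ₀k.const_mul c
  set ψ₀ : Space n → ℝ := fun y => c * g (‖y‖ ^ 2) with hψ₀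
  have hψ₀k : IsKernel ψ₀ := by
    refine ⟨contDiff_const.mul (hgs.comp (contDiff_norm_sq ℝ)), ?_⟩
    refine HasCompactSupport.intro (isCompact_closedBall (0 : Space n) 1) fun y hy => ?_
    rw [mem_closedBall_zero_iff, not_le] at hy
    simp only [hψ₀]
    rw [hg1 _ (by nlinarith), mul_zero]
  have hpd1 : ∀ j, pd j ψ₀ = fun y => ρ y * y j := by
    intro j; ext y
    have h1 : HasFDerivAt (fun y : Space n => ‖y‖ ^ 2) (2 • innerSL ℝ y) y :=
      (hasStrictFDerivAt_norm_sq y).hasFDerivAt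
    have h2 := ((hgd (‖y‖ ^ 2)).hasDerivAt.comp_hasFDerivAt y h1).const_mul c
    have h3 : fderiv ℝ ψ₀ y = _ := h2.fderiv
    unfold pd
    rw [h3]
    simp [hρ, hρ₀, EuclideanSpace.inner_single_right]
    ring
  have hpd2 : ∀ j y, pd j (pd j ψ₀) y = ρ y + y j * pd j ρ y := by
    intro j y
    rw [hpd1 j]
    have h1 := (hρk.differentiable y).hasFDerivAt.mul
      (EuclideanSpace.proj j : Space n →L[ℝ] ℝ).hasFDerivAt
    have h3 : fderiv ℝ (fun y : Space n => ρ y * y j) y = _ := h1.fderiv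
    rw [pd, h3]
    simp [pd]
  -- The exponent `n - 2` becomes `n` after the two derivatives of the Laplacian, as
  -- `integral_exp_dilation` requires.
  refine ⟨ρ, dilationMean (n - 2) ψ₀, hρk, hψ₀k.dilationMean _, ?_, fun y => ?_⟩
  · simp only [hρ]
    rw [integral_const_mul, hc, inv_mul_cancel₀ hI]
  · rw [← integral_exp_dilation hρk y]
    simp only [pd_dilationMean _ hψ₀k, fun j => pd_dilationMean (n - 2 + 1) (hψ₀k.pd j) j]
    unfold dilationMean
    rw [← integral_finsetSum]
    · refine integral_congr_ae (Eventually.of_forall fun s => ?_)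
      simp only
      rw [← Finset.mul_sum, show (n : ℝ) - 2 + 1 + 1 = n by ring]
      simp only [hpd2, Finset.sum_add_distrib, fderiv_apply_self]
      simp
    · intro j _
      refine integrable_of_continuous_of_compact isCompact_Icc
        (restrict_Icc_compl 0 (Real.log 2)) ?_
      have := ((hψ₀k.pd j).pd j).continuous
      fun_prop

/-- The dyadic increments of `mol ρ` in terms of `mol (Δ ψ)`. -/
lemma mol_half_sub_mol {ρ ψ : Space n → ℝ} (hρ : IsKernel ρ) (hψ : IsKernel ψ)
    (h : ∀ y, ∑ j, pd j (pd j ψ) y = 2 ^ n * ρ ((2 : ℝ) • y) - ρ y) {f : Space n → ℝ}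
    (hf : Continuous f) (r : ℝ) (x : Space n) :
    mol ρ (r / 2) f x - mol ρ r f x = ∑ j, mol (pd j (pd j ψ)) r f x := by
  rw [← mol_kernel_sum _ (fun j => (hψ.pd j).pd j) hf]
  simp only [mol, h, smul_eq_mul, sub_mul]
  have h2 : IsKernel (fun y => 2 ^ n * ρ ((2 : ℝ) • y)) := (hρ.comp_smul two_ne_zero).const_mul _
  have hi := h2.integrable_smul_comp hf r x
  have hi' := hρ.integrable_smul_comp hf r x
  simp only [smul_eq_mul] at hi hi'
  rw [integral_sub hi hi']
  congr 1
  -- The substitution `y ↦ 2y` turns the weight `2ⁿ ρ(2·)` at scale `r` into `ρ` at scale `r/2`.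
  have := Measure.integral_comp_smul (volume : Measure (Space n))
    (fun y => ρ y * f (x - (r / 2) • y)) 2
  simp only [smul_smul, div_mul_cancel₀ r (two_ne_zero' ℝ), finrank_euclideanSpace,
    Fintype.card_fin, smul_eq_mul] at this
  simp only [mul_assoc]
  rw [integral_const_mul, this, abs_of_pos (by positivity), mul_inv_cancel_left₀ (by positivity)]

end Profile

/-! ### Means over a fundamental domain and decay of averages at large scales -/

section PeriodicMean

variable {n : ℕ}

/-- A probability measure with bounded support against which every `Γ`-periodic function has the
same average as all its translates, and whose convolution with a compactly supported function has
a constant periodization. -/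
structure IsPeriodicMean (Γ : Submodule ℤ (Space n)) (ν : Measure (Space n)) (K : Set (Space n)) :
    Prop where
  isProbabilityMeasure : IsProbabilityMeasure ν
  isCompact : IsCompact K
  compl : ν Kᶜ = 0
  integral_const : ∀ f : Space n → ℝ, (∀ γ ∈ Γ, ∀ x, f (x + γ) = f x) →
    ∀ x, ∫ h, f (x - h) ∂ν = ∫ h, f (-h) ∂ν
  tsum_const : ∃ c : ℝ, ∀ φ : Space n → ℝ, Integrable φ →
    ∀ x, ∑' γ : Γ, ∫ h, φ (x + γ + h) ∂ν = c * ∫ y, φ y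

/-- Take normalised Lebesgue measure on a fundamental domain, with its closure as the compact set.
-/
lemma exists_isPeriodicMean (Γ : Submodule ℤ (Space n)) [DiscreteTopology Γ] [IsZLattice ℝ Γ] :
    ∃ ν K, IsPeriodicMean Γ ν K := by
  have : Module.Finite ℤ Γ := ZLattice.module_finite ℝ Γ
  have : Module.Free ℤ Γ := ZLattice.module_free ℝ Γ
  let b := Module.Free.chooseBasis ℤ Γ
  set D := ZSpan.fundamentalDomain (b.ofZLatticeBasis ℝ) with hD
  have hfd : IsAddFundamentalDomain Γ D (volume : Measure (Space n)) :=
    ZLattice.isAddFundamentalDomain b volume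
  have : VAddInvariantMeasure Γ (Space n) volume :=
    inferInstanceAs (VAddInvariantMeasure Γ.toAddSubgroup (Space n) volume)
  have : MeasurableVAdd Γ (Space n) := inferInstanceAs (MeasurableVAdd Γ.toAddSubgroup (Space n))
  have hDm : MeasurableSet D := ZSpan.fundamentalDomain_measurableSet _
  have hDb : Bornology.IsBounded D := ZSpan.fundamentalDomain_isBounded _
  have hD0 : volume D ≠ 0 := ZSpan.measure_fundamentalDomain_ne_zero _
  have hDt : volume D ≠ ⊤ := hDb.measure_lt_top.ne
  refine ⟨(volume D)⁻¹ • volume.restrict D, closure D, ⟨?_⟩, hDb.isCompact_closure, ?_, ?_, ?_⟩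
  · simp [ENNReal.inv_mul_cancel hD0 hDt]
  · have h1 : (volume.restrict D) (closure D)ᶜ = 0 := by
      rw [Measure.restrict_apply isClosed_closure.measurableSet.compl]
      refine measure_mono_null (t := ∅) (fun x hx => hx.1 (subset_closure hx.2)) (by simp)
    simp [h1]
  · intro f hf x
    rw [integral_smul_measure, integral_smul_measure]
    congr 1
    -- A translate of a fundamental domain is again one, and a periodic function has the same
    -- integral over both.
    have h2 : IsAddFundamentalDomain Γ ((-x) +ᵥ D) (volume : Measure (Space n)) :=
      hfd.vadd_of_comm (-x)
    have h3 := hfd.setIntegral_eq h2 (f := fun h => f (-h)) (fun γ h => by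
      have := hf _ (-γ).2 (-h)
      have e : -(γ +ᵥ h) = -h + ((-γ : Γ) : Space n) := by
        rw [Submodule.vadd_def]; simp [add_comm]
      rw [e, this])
    rw [h3]
    have h4 := (measurePreserving_add_left (volume : Measure (Space n)) (-x)).setIntegral_image_emb
      (measurableEmbedding_addLeft (-x)) (fun h => f (-h)) D
    have h5 : (-x) +ᵥ D = (fun h => -x + h) '' D := rfl
    rw [h5, h4]
    refine integral_congr_ae (Eventually.of_forall fun h => ?_)
    simp only [neg_add, neg_neg, sub_eq_add_neg]
  · refine ⟨((volume D)⁻¹).toReal, fun φ hφ x => ?_⟩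
    simp only [integral_smul_measure, smul_eq_mul, tsum_mul_left]
    congr 1
    -- The lattice translates of `D` tile space, so the sum over `Γ` unfolds to the full integral of
    -- `φ`.
    have h1 := hfd.integral_eq_tsum'' (fun h => φ (x + h)) (hφ.comp_add_left x)
    rw [integral_add_left_eq_self φ x] at h1
    rw [h1]
    refine tsum_congr fun γ => integral_congr_ae (Eventually.of_forall fun h => ?_)
    simp only [Submodule.vadd_def, vadd_eq_add, add_assoc]

variable {G : Type*} [NormedAddCommGroup G] [NormedSpace ℝ G] {κ : Space n → ℝ} {r A : ℝ}
  {Γ : Submodule ℤ (Space n)} {ν : Measure (Space n)} {K : Set (Space n)}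

/-- The constant in the decay of `mol κ r f` at large scales `r` for periodic `f`. -/
noncomputable def decayConst (ν : Measure (Space n)) (κ : Space n → ℝ) : ℝ :=
  (∑ j, ∫ y, |pd j κ y|) * ∫ h, ‖h‖ ∂ν

lemma decayConst_nonneg (ν : Measure (Space n)) (κ : Space n → ℝ) : 0 ≤ decayConst ν κ :=
  mul_nonneg (Finset.sum_nonneg fun _ _ => integral_nonneg fun _ => abs_nonneg _)
    (integral_nonneg fun _ => norm_nonneg _)

lemma IsPeriodicMean.ae_mem (hν : IsPeriodicMean Γ ν K) : ∀ᵐ h ∂ν, h ∈ K :=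
  ae_iff.2 hν.compl

/-- After exchanging the integrals, the inner `ν`-average of `f` no longer depends on the
translation `x - r y`. -/
lemma integral_mol_sub (hν : IsPeriodicMean Γ ν K) (hκ : IsKernel κ) {f : Space n → ℝ}
    (hf : Continuous f) (hper : ∀ γ ∈ Γ, ∀ x, f (x + γ) = f x) (x : Space n) :
    ∫ h, mol κ r f (x - h) ∂ν = (∫ y, κ y) * ∫ h, f (-h) ∂ν := by
  have := hν.isProbabilityMeasure
  simp only [mol, smul_eq_mul]
  rw [integral_integral_swap]
  · rw [← integral_mul_const]
    congr 1; ext y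
    rw [integral_const_mul]
    congr 1
    rw [← hν.integral_const f hper (x - r • y)]
    congr 1; ext h
    congr 1; abel
  · have hc : Continuous (Function.uncurry fun (h y : Space n) => κ y * f (x - h - r • y)) :=
      (hκ.continuous.comp continuous_snd).mul (by fun_prop)
    obtain ⟨C, hC⟩ := (hν.isCompact.prod hκ.compact.isCompact).exists_bound_of_continuousOn
      hc.continuousOn
    refine Integrable.mono' (g := fun z => |C| * Set.indicator (tsupport κ) 1 z.2) ?_
      hc.aestronglyMeasurable ?_
    · refine Integrable.const_mul ?_ _
      have h1 : Integrable (Set.indicator (tsupport κ) (1 : Space n → ℝ)) volume :=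
        (integrableOn_const (hκ.compact.isCompact.measure_lt_top.ne)).integrable_indicator
          (isClosed_tsupport κ).measurableSet
      exact h1.comp_snd ν
    · have : ∀ᵐ z ∂(ν.prod (volume : Measure (Space n))), z.1 ∈ K :=
        Measure.quasiMeasurePreserving_fst.ae hν.ae_mem
      filter_upwards [this] with z hz
      by_cases hy : z.2 ∈ tsupport κ
      · simp only [hy, Set.indicator_of_mem, Pi.one_apply, mul_one]
        exact (hC z ⟨hz, hy⟩).trans (le_abs_self C)
      · simp [Function.uncurry, image_eq_zero_of_notMem_tsupport hy, hy]

/-- The average at scale `r` has Lipschitz constant `O(1/r)`, so it is within `O(1/r)` of its own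
mean over the bounded set carrying `ν`; that mean is the constant computed in `integral_mol_sub`. -/
lemma abs_mol_sub_mean_le (hν : IsPeriodicMean Γ ν K) (hκ : IsKernel κ) (hr : r ≠ 0)
    {f : Space n → ℝ} (hf : Continuous f) (hper : ∀ γ ∈ Γ, ∀ x, f (x + γ) = f x)
    (hA : ∀ x, |f x| ≤ A) (x : Space n) :
    |mol κ r f x - (∫ y, κ y) * ∫ h, f (-h) ∂ν| ≤ decayConst ν κ * |r|⁻¹ * A := by
  have := hν.isProbabilityMeasure
  rw [← integral_mol_sub hν hκ hf hper x (r := r)]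
  have hi : Integrable (fun h => mol κ r f (x - h)) ν :=
    integrable_of_continuous_of_compact hν.isCompact hν.compl
      ((continuous_mol hκ hf).comp (by fun_prop))
  have h1 : mol κ r f x - ∫ h, mol κ r f (x - h) ∂ν = ∫ h, (mol κ r f x - mol κ r f (x - h)) ∂ν := by
    rw [integral_sub (integrable_const _) hi]
    simp
  rw [h1, decayConst]
  have h2 : (∑ j, ∫ y, |pd j κ y|) * (∫ h, ‖h‖ ∂ν) * |r|⁻¹ * A =
      ∫ h, |r|⁻¹ * (∑ j, (∫ y, |pd j κ y|) * A) * ‖h‖ ∂ν := by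
    rw [integral_const_mul, Finset.sum_mul, ← Finset.sum_mul, ← Finset.sum_mul]
    ring
  rw [h2, ← Real.norm_eq_abs]
  refine norm_integral_le_of_norm_le ?_ (Eventually.of_forall fun h => ?_)
  · exact integrable_of_continuous_of_compact hν.isCompact hν.compl (by fun_prop)
  · have := abs_mol_sub_mol_le hκ hr hf (B := fun j => (∫ y, |pd j κ y|) * A)
      (fun j x => norm_mol_le (f := f) (r := r) (A := A) (hκ.pd j).integrable hA x) x (x - h)
    simpa using this

lemma norm_mol_le_of_periodic [CompleteSpace G] (hν : IsPeriodicMean Γ ν K) (hκ : IsKernel κ)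
    (h0 : ∫ y, κ y = 0) (hr : r ≠ 0) {f : Space n → G} (hf : Continuous f)
    (hper : ∀ γ ∈ Γ, ∀ x, f (x + γ) = f x) (hA : ∀ x, ‖f x‖ ≤ A) (x : Space n) :
    ‖mol κ r f x‖ ≤ decayConst ν κ * |r|⁻¹ * A := by
  have hA0 : 0 ≤ A := (norm_nonneg _).trans (hA 0)
  have hM : 0 ≤ decayConst ν κ * |r|⁻¹ * A := by
    have := decayConst_nonneg ν κ
    positivity
  -- Vector values are reduced to the scalar case by testing with continuous functionals.
  refine NormedSpace.norm_le_dual_bound (𝕜 := ℝ) (E := G) (mol κ r f x) hM fun L => ?_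
  have h1 : L (mol κ r f x) = mol κ r (fun x => L (f x)) x := by
    simp only [mol]
    rw [← ContinuousLinearMap.integral_comp_comm L (hκ.integrable_smul_comp hf r x)]
    simp
  have h2 := abs_mol_sub_mean_le hν hκ hr (f := fun x => L (f x)) (A := ‖L‖ * A) (by fun_prop)
    (fun γ hγ x => by rw [hper γ hγ]) (fun x => (L.le_opNorm_of_le (hA x))) x
  rw [h0, zero_mul, sub_zero] at h2
  rw [h1, Real.norm_eq_abs]
  linarith

end PeriodicMean

/-! ### Weighted averages of spatial translates, a common form for convolutions and periodic means
-/

section TranslationMeans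

variable {n : ℕ} {A : Type} [NormedAddCommGroup A] [NormedSpace ℝ A] [MeasurableSpace A]
  [BorelSpace A] [SecondCountableTopology A] {μ : Measure A} {K : Set A} {w : A → ℝ}
  {c : A → Space n} {I : Opens ℝ}

/-- The weighted average `∫ w(a) g(t, x + c(a)) dμ(a)` of spatial translates of `g`. -/
noncomputable def transMean (μ : Measure A) (w : A → ℝ) (c : A → Space n) (g : ℝ × Space n → ℝ)
    (z : ℝ × Space n) : ℝ :=
  ∫ a, w a * g (z.1, z.2 + c a) ∂μ

lemma contDiff_transMean [IsFiniteMeasure μ] (hK : IsCompact K) (hμ : μ Kᶜ = 0)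
    (hw : ContDiff ℝ ∞ w) (hc : ContDiff ℝ ∞ c) {g : ℝ × Space n → ℝ} (hg : ContDiff ℝ ∞ g) :
    ContDiff ℝ ∞ (transMean μ w c g) := by
  have : ContDiff ℝ ∞ (fun q : (ℝ × Space n) × A => w q.2 * g (q.1.1, q.1.2 + c q.2)) := by
    fun_prop
  exact contDiff_integral_of_compact hK hμ this

lemma fderiv_transMean [IsFiniteMeasure μ] (hK : IsCompact K) (hμ : μ Kᶜ = 0)
    (hw : ContDiff ℝ ∞ w) (hc : ContDiff ℝ ∞ c) {g : ℝ × Space n → ℝ} (hg : ContDiff ℝ ∞ g)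
    (z e : ℝ × Space n) :
    fderiv ℝ (transMean μ w c g) z e = transMean μ w c (fun z => fderiv ℝ g z e) z := by
  have hf : ContDiff ℝ ∞ (fun q : (ℝ × Space n) × A => w q.2 * g (q.1.1, q.1.2 + c q.2)) := by
    fun_prop
  have h := hasFDerivAt_integral_of_compact hK hμ (hf.of_le (by simp)) z
  have hi : Integrable (fun a => (fderiv ℝ (fun q : (ℝ × Space n) × A =>
      w q.2 * g (q.1.1, q.1.2 + c q.2)) (z, a)).comp
      (ContinuousLinearMap.inl ℝ (ℝ × Space n) A)) μ := by
    refine integrable_of_continuous_of_compact hK hμ ?_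
    have := hf.continuous_fderiv (by simp)
    fun_prop
  have h' : fderiv ℝ (transMean μ w c g) z = _ := h.fderiv
  rw [h', ContinuousLinearMap.integral_apply hi]
  unfold transMean
  congr 1; ext a
  have h1 : HasFDerivAt (fun z : ℝ × Space n => (z.1, z.2 + c a))
      (ContinuousLinearMap.id ℝ (ℝ × Space n)) z :=
    by
    have h := (hasFDerivAt_id (𝕜 := ℝ) z).add_const ((0, c a) : ℝ × Space n)
    convert! h using 1
    ext y <;> simp
  have h2 : HasFDerivAt (fun z : ℝ × Space n => w a * g (z.1, z.2 + c a))
      (w a • (fderiv ℝ g (z.1, z.2 + c a)).comp (ContinuousLinearMap.id ℝ (ℝ × Space n))) z :=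
    (((hg.differentiable (by simp)) (z.1, z.2 + c a)).hasFDerivAt.comp z h1).const_mul (w a)
  have h3 := ((hf.differentiable (by simp)) (z, a)).hasFDerivAt.comp z
    (hasFDerivAt_prodMk_left (𝕜 := ℝ) z a)
  rw [h3.unique h2]
  simp

/-- The compact set containing the support of an average of translates. -/
def translateSupport (c : A → Space n) (K : Set A) (g : ℝ × Space n → ℝ) : Set (ℝ × Space n) :=
  (fun q : (ℝ × Space n) × A => (q.1.1, q.1.2 - c q.2)) '' (tsupport g ×ˢ K)

lemma isCompact_translateSupport (hK : IsCompact K) (hc : Continuous c) {g : ℝ × Space n → ℝ}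
    (hg : HasCompactSupport g) : IsCompact (translateSupport c K g) :=
  (hg.isCompact.prod hK).image (by fun_prop)

lemma eq_zero_of_notMem_translateSupport {g : ℝ × Space n → ℝ} {z : ℝ × Space n}
    (hz : z ∉ translateSupport c K g) {a : A} (ha : a ∈ K) : g (z.1, z.2 + c a) = 0 := by
  by_contra h
  exact hz ⟨((z.1, z.2 + c a), a), ⟨subset_tsupport g h, ha⟩, by simp⟩

lemma transMean_eq_zero (hμ : μ Kᶜ = 0) {g : ℝ × Space n → ℝ} {z : ℝ × Space n}
    (hz : z ∉ translateSupport c K g) : transMean μ w c g z = 0 := by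
  have hae : ∀ᵐ a ∂μ, a ∈ K := ae_iff.2 hμ
  rw [transMean, integral_congr_ae (g := fun _ => 0)]
  · simp
  · filter_upwards [hae] with a ha
    rw [eq_zero_of_notMem_translateSupport hz ha, mul_zero]

lemma exists_testFunction_transMean [IsFiniteMeasure μ] (hK : IsCompact K) (hμ : μ Kᶜ = 0)
    (hw : ContDiff ℝ ∞ w) (hc : ContDiff ℝ ∞ c) (φ : 𝓓(slab n I, ℝ)) :
    ∃ ψ : 𝓓(slab n I, ℝ), ⇑ψ = transMean μ w c φ := by
  have hcomp := isCompact_translateSupport hK hc.continuous φ.hasCompactSupport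
  refine ⟨⟨transMean μ w c φ, contDiff_transMean hK hμ hw hc φ.contDiff,
    HasCompactSupport.intro hcomp fun z hz => transMean_eq_zero hμ hz, ?_⟩, rfl⟩
  refine Set.Subset.trans (closure_minimal (t := translateSupport c K φ) (fun z hz => ?_)
    hcomp.isClosed) ?_
  · by_contra h
    exact hz (transMean_eq_zero hμ h)
  · rintro _ ⟨q, ⟨hq, -⟩, rfl⟩
    have := φ.tsupport_subset hq
    exact ⟨this.1, Set.mem_univ _⟩

lemma measurePreserving_translate [SFinite μ] (hc : Continuous c) :
    MeasurePreserving (fun q : A × (ℝ × Space n) => (q.1, (q.2.1, q.2.2 + c q.1)))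
      (μ.prod volume) (μ.prod volume) := by
  refine (MeasurePreserving.id μ).skew_product (g := fun a (z : ℝ × Space n) => (z.1, z.2 + c a))
    ?_ (Eventually.of_forall fun a => ?_)
  · exact (by fun_prop : Continuous (Function.uncurry fun (a : A) (z : ℝ × Space n) =>
      (z.1, z.2 + c a))).measurable
  · have h : (fun z : ℝ × Space n => (z.1, z.2 + c a)) = fun z => z + (0, c a) := by
      ext z <;> simp
    rw [h]
    have : (volume : Measure (ℝ × Space n)).IsAddRightInvariant := by
      rw [Measure.volume_eq_prod]; infer_instance
    exact (measurePreserving_add_right volume ((0, c a) : ℝ × Space n)).map_eq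

/-- Duality between averages of translates: `∫ F (T g) = ∫ (T* F) g`. -/
lemma integral_mul_transMean [IsFiniteMeasure μ] (hK : IsCompact K) (hμ : μ Kᶜ = 0)
    (hw : Continuous w) (hc : Continuous c) {F g : ℝ × Space n → ℝ} {C : ℝ}
    (hF : AEStronglyMeasurable F volume) (hFC : ∀ z, |F z| ≤ C) (hg : Continuous g)
    (hgc : HasCompactSupport g) :
    Integrable (fun z => transMean μ w (fun a => -c a) F z * g z) ∧
    ∫ z, F z * transMean μ w c g z = ∫ z, transMean μ w (fun a => -c a) F z * g z := by
  have hae : ∀ᵐ a ∂μ, a ∈ K := ae_iff.2 hμ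
  -- Integrating `H` over `a` gives the right-hand integrand. Composing with the measure-preserving
  -- shear `(a, z) ↦ (a, z + c(a))` first gives the left-hand one, so the identity is Fubini on both
  -- sides.
  set H : A × (ℝ × Space n) → ℝ := fun q => w q.1 * F (q.2.1, q.2.2 + -c q.1) * g q.2 with hH
  have hmp := measurePreserving_translate (μ := μ) (c := fun a => -c a) (by fun_prop)
  have hFm : AEStronglyMeasurable (fun q : A × (ℝ × Space n) => F (q.2.1, q.2.2 + -c q.1))
      (μ.prod volume) := by
    have h1 : AEStronglyMeasurable (fun q : A × (ℝ × Space n) => F q.2) (μ.prod volume) :=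
      hF.comp_quasiMeasurePreserving Measure.quasiMeasurePreserving_snd
    exact h1.comp_measurePreserving hmp
  obtain ⟨Cg, hCg⟩ := hg.bounded_above_of_compact_support hgc
  obtain ⟨Cw, hCw⟩ := hK.exists_bound_of_continuousOn hw.continuousOn
  have hC0 : 0 ≤ C := (abs_nonneg _).trans (hFC 0)
  have hHi : Integrable H (μ.prod volume) := by
    refine Integrable.mono' (g := fun q => (|Cw| * C * |Cg|) *
      Set.indicator (tsupport g) 1 q.2) ?_ ?_ ?_
    · refine Integrable.const_mul ?_ _
      have h1 : Integrable (Set.indicator (tsupport g) (1 : ℝ × Space n → ℝ)) volume :=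
        (integrableOn_const (hgc.isCompact.measure_lt_top.ne)).integrable_indicator
          (isClosed_tsupport g).measurableSet
      exact h1.comp_snd μ
    · exact ((hw.comp continuous_fst).aestronglyMeasurable.mul hFm).mul
        (hg.comp continuous_snd).aestronglyMeasurable
    · have : ∀ᵐ q ∂(μ.prod (volume : Measure (ℝ × Space n))), q.1 ∈ K :=
        Measure.quasiMeasurePreserving_fst.ae hae
      filter_upwards [this] with q hq
      by_cases hy : q.2 ∈ tsupport g
      · simp only [hH, hy, Set.indicator_of_mem, Pi.one_apply, mul_one, norm_mul]
        have h1 := (hCw _ hq).trans (le_abs_self Cw)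
        have h2 : ‖F (q.2.1, q.2.2 + -c q.1)‖ ≤ C := hFC _
        have h3 := (hCg q.2).trans (le_abs_self Cg)
        gcongr
      · simp [hH, image_eq_zero_of_notMem_tsupport hy, hy]
  have hmp' := measurePreserving_translate (μ := μ) (c := c) hc
  have hswap : ∀ z, ∫ a, H (a, z) ∂μ = transMean μ w (fun a => -c a) F z * g z := by
    intro z
    simp only [hH, transMean]
    rw [integral_mul_const]
  constructor
  · have := hHi.integral_prod_right
    simpa only [hswap] using this
  · have hi2 : Integrable (fun q : A × (ℝ × Space n) =>
        H (q.1, (q.2.1, q.2.2 + c q.1))) (μ.prod volume) :=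
      hmp'.integrable_comp_of_integrable hHi
    have hL : ∀ z, ∫ a, H (a, (z.1, z.2 + c a)) ∂μ = F z * transMean μ w c g z := by
      intro z
      rw [transMean, ← integral_const_mul]
      refine integral_congr_ae (Eventually.of_forall fun a => ?_)
      simp only [hH, add_neg_cancel_right]
      ring
    have hswap' : ∀ z, transMean μ w (fun a => -c a) F z * g z = ∫ a, H (a, z) ∂μ :=
      fun z => (hswap z).symm
    have e1 : ∫ z, F z * transMean μ w c g z =
        ∫ q : A × (ℝ × Space n), H (q.1, (q.2.1, q.2.2 + c q.1)) ∂(μ.prod volume) := by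
      rw [integral_prod_symm _ hi2]
      simp only [hL]
    have e2 : ∫ z, transMean μ w (fun a => -c a) F z * g z =
        ∫ q : A × (ℝ × Space n), H q ∂(μ.prod volume) := by
      rw [integral_prod_symm _ hHi]
      simp only [hswap']
    rw [e1, e2]
    have hmap := hmp'.map_eq
    conv_rhs => rw [← hmap]
    rw [integral_map hmp'.measurable.aemeasurable]
    rw [hmap]; exact hHi.aestronglyMeasurable

end TranslationMeans

/-! ### Bounded periodic fields, Hölder in space uniformly over all times -/

section UniformlyHolder

variable {n : ℕ} {G : Type*} [NormedAddCommGroup G] [NormedSpace ℝ G]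
  {Γ : Submodule ℤ (Space n)} {α C : ℝ}

/-- Measurable functions on space-time that are periodic, bounded and `α`-Hölder continuous in
space, uniformly in time. -/
structure IsUniformlyHolder (Γ : Submodule ℤ (Space n)) (α C : ℝ) (f : ℝ → Space n → G) :
    Prop where
  aestronglyMeasurable : AEStronglyMeasurable (fun z : ℝ × Space n => f z.1 z.2) volume
  bound : ∀ t x, ‖f t x‖ ≤ C
  holder : ∀ t x y, ‖f t x - f t y‖ ≤ C * ‖x - y‖ ^ α
  periodic : ∀ t, ∀ γ ∈ Γ, ∀ x, f t (x + γ) = f t x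

namespace IsUniformlyHolder

variable {f : ℝ → Space n → G} {v : ℝ → Space n → Space n}

lemma nonneg (h : IsUniformlyHolder Γ α C f) : 0 ≤ C := (norm_nonneg _).trans (h.bound 0 0)

lemma continuous (h : IsUniformlyHolder Γ α C f) (hα : 0 < α) (t : ℝ) : Continuous (f t) := by
  rw [continuous_iff_continuousAt]
  intro x
  rw [ContinuousAt, tendsto_iff_norm_sub_tendsto_zero]
  have h1 : Tendsto (fun y : Space n => C * ‖y - x‖ ^ α) (𝓝 x) (𝓝 (C * ‖x - x‖ ^ α)) := by
    refine Continuous.tendsto ?_ x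
    exact continuous_const.mul ((continuous_id.sub continuous_const).norm.rpow_const
      fun _ => Or.inr hα.le)
  rw [sub_self, norm_zero, Real.zero_rpow hα.ne', mul_zero] at h1
  exact squeeze_zero (fun _ => norm_nonneg _) (fun y => h.holder t y x) h1

lemma apply (h : IsUniformlyHolder Γ α C v) (l : Fin n) :
    IsUniformlyHolder Γ α C (fun t x => v t x l) where
  aestronglyMeasurable := (EuclideanSpace.proj l : Space n →L[ℝ] ℝ).continuous.comp_aestronglyMeasurable
    h.aestronglyMeasurable
  bound t x := (PiLp.norm_apply_le _ l).trans (h.bound t x)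
  holder t x y := (PiLp.norm_apply_le (v t x - v t y) l).trans (h.holder t x y)
  periodic t γ hγ x := by rw [h.periodic t γ hγ x]

lemma mul {f g : ℝ → Space n → ℝ} (hf : IsUniformlyHolder Γ α C f)
    (hg : IsUniformlyHolder Γ α C g) :
    IsUniformlyHolder Γ α (2 * C ^ 2) (fun t x => f t x * g t x) where
  aestronglyMeasurable := hf.aestronglyMeasurable.mul hg.aestronglyMeasurable
  bound t x := by
    rw [norm_mul]
    have := mul_le_mul (hf.bound t x) (hg.bound t x) (norm_nonneg _) hf.nonneg
    nlinarith [hf.nonneg]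
  holder t x y := by
    have h0 := hf.nonneg
    have hr : 0 ≤ ‖x - y‖ ^ α := by positivity
    have e : f t x * g t x - f t y * g t y =
        (f t x - f t y) * g t x + f t y * (g t x - g t y) := by ring
    rw [e]
    refine (norm_add_le _ _).trans ?_
    rw [norm_mul, norm_mul]
    have h1 := mul_le_mul (hf.holder t x y) (hg.bound t x) (norm_nonneg _) (by positivity)
    have h2 := mul_le_mul (hf.bound t y) (hg.holder t x y) (norm_nonneg _) h0
    nlinarith
  periodic t γ hγ x := by rw [hf.periodic t γ hγ x, hg.periodic t γ hγ x]

end IsUniformlyHolder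

end UniformlyHolder

/-! ### Averages of test functions -/

section TestFunctions

variable {n : ℕ} {I : Opens ℝ} {κ : Space n → ℝ}

lemma testDeriv_apply (φ : 𝓓(slab n I, ℝ)) (e z : ℝ × Space n) :
    (∂_{e} φ) z = fderiv ℝ φ z e := by
  rw [TestFunction.lineDerivOp_eq_lineDerivCLM (𝕜 := ℝ),
    TestFunction.lineDerivCLM_apply_of_le le_top]
  exact ((φ.contDiff.differentiable (by simp)) z).lineDeriv_eq_fderiv

lemma testDeriv_comm (φ : 𝓓(slab n I, ℝ)) (e e' : ℝ × Space n) :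
    ∂_{e} (∂_{e'} φ) = ∂_{e'} (∂_{e} φ) := by
  have key : ∀ (e e' z : ℝ × Space n), (∂_{e} (∂_{e'} φ)) z = fderiv ℝ (fderiv ℝ φ) z e e' := by
    intro e e' z
    rw [testDeriv_apply]
    have h1 : (⇑(∂_{e'} φ : 𝓓(slab n I, ℝ))) = fun z => fderiv ℝ φ z e' :=
      funext fun z => testDeriv_apply φ e' z
    have hd : DifferentiableAt ℝ (fderiv ℝ φ) z :=
      ((φ.contDiff.fderiv_right (m := ∞) (by simp)).differentiable (by simp)).differentiableAt
    rw [h1, fderiv_clm_apply hd (differentiableAt_const _)]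
    simp
  ext z
  rw [key, key]
  have h2 : (2 : WithTop ℕ∞) ≤ ∞ := WithTop.coe_le_coe.2 (le_top (a := (2 : ℕ∞)))
  exact (φ.contDiff.contDiffAt.isSymmSndFDerivAt (by simpa using h2)) _ _

lemma contDiff_test_slice (φ : 𝓓(slab n I, ℝ)) (t : ℝ) : ContDiff ℝ ∞ (fun x => φ (t, x)) :=
  φ.contDiff.comp (contDiff_const.prodMk contDiff_id)

lemma hasCompactSupport_test_slice (φ : 𝓓(slab n I, ℝ)) (t : ℝ) :
    HasCompactSupport (fun x => φ (t, x)) := by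
  refine HasCompactSupport.intro (φ.hasCompactSupport.isCompact.image continuous_snd)
    fun x hx => ?_
  by_contra h
  exact hx ⟨(t, x), subset_tsupport _ h, rfl⟩

lemma fderiv_test_slice (φ : 𝓓(slab n I, ℝ)) (t : ℝ) (x : Space n) (j : Fin n) :
    fderiv ℝ (fun x => φ (t, x)) x (EuclideanSpace.single j 1) = (∂_{eSpace j} φ) (t, x) := by
  rw [testDeriv_apply]
  have h := ((φ.contDiff.differentiable (by simp)) (t, x)).hasFDerivAt.comp x
    (hasFDerivAt_prodMk_right (𝕜 := ℝ) t x)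
  have h' : fderiv ℝ (fun x => φ (t, x)) x = _ := h.fderiv
  rw [h']
  rfl

/-- Restricting Lebesgue measure to the support of `κ` changes nothing and, for a kernel, makes the
measure finite and carried by a compact set, so the results on averages of translates apply. -/
lemma mol_eq_transMean (κ : Space n → ℝ) (r : ℝ) (F : ℝ × Space n → ℝ) (z : ℝ × Space n) :
    mol κ r (fun x => F (z.1, x)) z.2 =
      transMean (volume.restrict (tsupport κ)) κ (fun y => -(r • y)) F z := by
  rw [mol, transMean]
  refine (setIntegral_eq_integral_of_forall_compl_eq_zero fun y hy => ?_).symm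
  rw [image_eq_zero_of_notMem_tsupport hy, zero_smul]

lemma restrict_tsupport_compl (κ : Space n → ℝ) :
    (volume.restrict (tsupport κ)) (tsupport κ)ᶜ = 0 := by
  rw [Measure.restrict_apply (isClosed_tsupport κ).measurableSet.compl]
  simp

lemma IsKernel.isFiniteMeasure (hκ : IsKernel κ) :
    IsFiniteMeasure ((volume : Measure (Space n)).restrict (tsupport κ)) :=
  isFiniteMeasure_restrict.2 hκ.compact.isCompact.measure_lt_top.ne

lemma exists_test_mol (hκ : IsKernel κ) (r : ℝ) (φ : 𝓓(slab n I, ℝ)) :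
    ∃ ψ : 𝓓(slab n I, ℝ), (∀ z, ψ z = mol κ r (fun x => φ (z.1, x)) z.2) ∧
      ∀ e z : ℝ × Space n, (∂_{e} ψ) z = mol κ r (fun x => (∂_{e} φ) (z.1, x)) z.2 := by
  have := hκ.isFiniteMeasure
  have hc : ContDiff ℝ ∞ (fun y : Space n => -(r • y)) := by fun_prop
  obtain ⟨ψ, hψ⟩ := exists_testFunction_transMean hκ.compact.isCompact (restrict_tsupport_compl κ)
    hκ.smooth hc φ
  refine ⟨ψ, fun z => by rw [hψ, mol_eq_transMean], fun e z => ?_⟩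
  rw [testDeriv_apply, hψ, fderiv_transMean hκ.compact.isCompact (restrict_tsupport_compl κ) hκ.smooth hc
    φ.contDiff, mol_eq_transMean]
  simp only [← testDeriv_apply]

/-- The adjoint of translation by `-r y` is translation by `r y`; passing from the test function to
`F` reverses the sign of the scale. -/
lemma integral_mul_mol (hκ : IsKernel κ) (r : ℝ) {F : ℝ → Space n → ℝ} {C : ℝ}
    (hF : AEStronglyMeasurable (fun z : ℝ × Space n => F z.1 z.2) volume)
    (hFC : ∀ t x, |F t x| ≤ C) (φ : 𝓓(slab n I, ℝ)) :
    Integrable (fun z : ℝ × Space n => mol κ r (F z.1) z.2 * φ z) ∧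
    ∫ z : ℝ × Space n, F z.1 z.2 * mol κ (-r) (fun x => φ (z.1, x)) z.2 =
      ∫ z : ℝ × Space n, mol κ r (F z.1) z.2 * φ z := by
  have := hκ.isFiniteMeasure
  have h := integral_mul_transMean (c := fun y => r • y) hκ.compact.isCompact (restrict_tsupport_compl κ)
    hκ.continuous (by fun_prop) hF (fun z => hFC z.1 z.2) φ.continuous φ.hasCompactSupport
  have e1 : ∀ z : ℝ × Space n, mol κ r (F z.1) z.2 = transMean (volume.restrict (tsupport κ)) κ
      (fun y => -(r • y)) (fun z : ℝ × Space n => F z.1 z.2) z := fun z =>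
    mol_eq_transMean κ r (fun z : ℝ × Space n => F z.1 z.2) z
  have e2 : ∀ z : ℝ × Space n, mol κ (-r) (fun x => φ (z.1, x)) z.2 =
      transMean (volume.restrict (tsupport κ)) κ (fun y => r • y) φ z := fun z => by
    rw [mol_eq_transMean]
    simp only [neg_smul, neg_neg]
  simp only [e1, e2]
  exact h

lemma integrable_mul_test {F : ℝ × Space n → ℝ} {C : ℝ} (hF : AEStronglyMeasurable F volume)
    (hFC : ∀ z, |F z| ≤ C) (φ : 𝓓(slab n I, ℝ)) : Integrable (fun z => F z * φ z) := by
  have h : Integrable (⇑φ) volume :=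
    φ.continuous.integrable_of_hasCompactSupport φ.hasCompactSupport
  exact h.bdd_mul hF (Eventually.of_forall hFC)

lemma setIntegral_slab_mul_test (F : ℝ × Space n → ℝ) (φ : 𝓓(slab n I, ℝ)) :
    ∫ z in (slab n I : Set (ℝ × Space n)), F z * φ z = ∫ z, F z * φ z := by
  refine setIntegral_eq_integral_of_forall_compl_eq_zero fun z hz => ?_
  rw [image_eq_zero_of_notMem_tsupport (fun h => hz (φ.tsupport_subset h)), mul_zero]

lemma transMean_comm {A B : Type} [NormedAddCommGroup A] [NormedSpace ℝ A] [MeasurableSpace A]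
    [BorelSpace A] [SecondCountableTopology A] [NormedAddCommGroup B] [NormedSpace ℝ B]
    [MeasurableSpace B] [BorelSpace B] [SecondCountableTopology B] {μ : Measure A}
    {μ' : Measure B} [IsFiniteMeasure μ] [IsFiniteMeasure μ'] {K : Set A} {K' : Set B}
    (hK : IsCompact K) (hμ : μ Kᶜ = 0) (hK' : IsCompact K') (hμ' : μ' K'ᶜ = 0) {w : A → ℝ}
    {w' : B → ℝ} {c : A → Space n} {c' : B → Space n} (hw : Continuous w) (hw' : Continuous w')
    (hc : Continuous c) (hc' : Continuous c') {g : ℝ × Space n → ℝ} (hg : Continuous g)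
    (z : ℝ × Space n) :
    transMean μ w c (transMean μ' w' c' g) z = transMean μ' w' c' (transMean μ w c g) z := by
  simp only [transMean, ← integral_const_mul]
  rw [integral_integral_swap]
  · congr 1; ext b; congr 1; ext a
    rw [add_right_comm]; ring
  · have hae : ∀ᵐ a ∂μ, a ∈ K := ae_iff.2 hμ
    have hae' : ∀ᵐ a ∂μ', a ∈ K' := ae_iff.2 hμ'
    refine integrable_of_continuous_of_compact (K := K ×ˢ K') (hK.prod hK') ?_ ?_
    · have : ∀ᵐ q ∂(μ.prod μ'), q ∈ K ×ˢ K' := by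
        filter_upwards [Measure.quasiMeasurePreserving_fst.ae hae,
          Measure.quasiMeasurePreserving_snd.ae hae'] with q h1 h2 using ⟨h1, h2⟩
      exact ae_iff.1 this
    · simp only [Function.uncurry_def]
      fun_prop

end TestFunctions

/-! ### The weak Euler equations and removal of the spatial mean of a test function -/

section PressureFormula

variable {n : ℕ} {I : Opens ℝ} {Γ : Submodule ℤ (Space n)} {ν : Measure (Space n)}
  {K : Set (Space n)} {α C : ℝ} {v : ℝ → Space n → Space n} {p : 𝓓'(slab n I, ℝ)}

/-- The weak Euler equations with integrals over all of space-time, one for each product. -/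
structure IsPairedEulerSolution (v : ℝ → Space n → Space n) (p : 𝓓'(slab n I, ℝ)) : Prop where
  momentum : ∀ (φ : 𝓓(slab n I, ℝ)) (l : Fin n),
    (∫ z : ℝ × Space n, v z.1 z.2 l * (∂_{eTime n} φ) z)
      + ∑ j : Fin n, (∫ z : ℝ × Space n, (v z.1 z.2 j * v z.1 z.2 l) * (∂_{eSpace j} φ) z)
      + p (∂_{eSpace l} φ) = 0
  divergence_free : ∀ φ : 𝓓(slab n I, ℝ),
    ∑ j : Fin n, ∫ z : ℝ × Space n, v z.1 z.2 j * (∂_{eSpace j} φ) z = 0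

lemma IsWeakEulerSolution.paired (hv : IsUniformlyHolder Γ α C v)
    (h : IsWeakEulerSolution I v p) : IsPairedEulerSolution v p where
  momentum φ l := by
    rw [← h.momentum φ l]
    congr 1
    have i1 := integrable_mul_test (hv.apply l).aestronglyMeasurable
      (fun z => (hv.apply l).bound z.1 z.2) (∂_{eTime n} φ)
    have i2 := fun j => integrable_mul_test ((hv.apply j).mul (hv.apply l)).aestronglyMeasurable
      (fun z => ((hv.apply j).mul (hv.apply l)).bound z.1 z.2) (∂_{eSpace j} φ)
    rw [integral_add i1.integrableOn (integrable_finsetSum _ fun j _ => (i2 j).integrableOn),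
      integral_finsetSum _ fun j _ => (i2 j).integrableOn,
      setIntegral_slab_mul_test (fun z => v z.1 z.2 l)]
    congr 1
    exact Finset.sum_congr rfl fun j _ =>
      (setIntegral_slab_mul_test (fun z => v z.1 z.2 j * v z.1 z.2 l) _).symm
  divergence_free φ := by
    rw [← h.divergence_free φ]
    have i2 := fun j => integrable_mul_test (hv.apply j).aestronglyMeasurable
      (fun z => (hv.apply j).bound z.1 z.2) (∂_{eSpace j} φ)
    rw [integral_finsetSum _ fun j _ => (i2 j).integrableOn]
    exact Finset.sum_congr rfl fun j _ =>
      (setIntegral_slab_mul_test (fun z => v z.1 z.2 j) _).symm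

lemma exists_test_mean (hν : IsPeriodicMean Γ ν K) (φ : 𝓓(slab n I, ℝ)) :
    ∃ η : 𝓓(slab n I, ℝ), ⇑η = transMean ν (fun _ => 1) id φ := by
  have := hν.isProbabilityMeasure
  exact exists_testFunction_transMean hν.isCompact hν.compl contDiff_const contDiff_id φ

/-- The periodization of a `ν`-average is constant in space by `tsum_const`, so it depends on time
only and the normalization of `p` applies. -/
lemma apply_mean_eq_zero (hν : IsPeriodicMean Γ ν K) (hp : HasMeanZero Γ p)
    {φ η : 𝓓(slab n I, ℝ)} (hη : ⇑η = transMean ν (fun _ => 1) id φ) : p η = 0 := by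
  obtain ⟨c, hc⟩ := hν.tsum_const
  refine hp η (fun t => c * ∫ y, φ (t, y)) fun t x => ?_
  have hi : Integrable (fun y => φ (t, y)) := by
    exact Continuous.integrable_of_hasCompactSupport (by fun_prop)
      (hasCompactSupport_test_slice φ t)
  rw [← hc _ hi x, hη]
  simp [transMean]

/-- A test function differs from its periodic mean by spatial derivatives of test functions. -/
lemma exists_mean_decomposition (hν : IsPeriodicMean Γ ν K) (φ : 𝓓(slab n I, ℝ)) :
    ∃ ψ : Fin n → 𝓓(slab n I, ℝ), ∀ z,
      φ z = transMean ν (fun _ => 1) id φ z + ∑ l, (∂_{eSpace l} (ψ l)) z := by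
  have := hν.isProbabilityMeasure
  -- Averaging `φ(x) - φ(x + h) = -∫₀¹ h·∇φ(x + s h) ds` over `h` with respect to `ν` exhibits `φ`
  -- minus its mean as a divergence. Hence `ψₗ` is the average of `-hₗ φ(t, x + s h)` over `(s, h)`.
  set μ : Measure (ℝ × Space n) := (volume.restrict (Set.Icc (0 : ℝ) 1)).prod ν with hμ
  have hae : ∀ᵐ q ∂μ, q ∈ Set.Icc (0 : ℝ) 1 ×ˢ K := by
    have h1 : ∀ᵐ s ∂(volume.restrict (Set.Icc (0 : ℝ) 1)), s ∈ Set.Icc (0 : ℝ) 1 :=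
      ae_restrict_mem measurableSet_Icc
    filter_upwards [Measure.quasiMeasurePreserving_fst.ae h1,
      Measure.quasiMeasurePreserving_snd.ae hν.ae_mem] with q h1 h2 using ⟨h1, h2⟩
  have hK : IsCompact (Set.Icc (0 : ℝ) 1 ×ˢ K) := isCompact_Icc.prod hν.isCompact
  have hw : ∀ l : Fin n, ContDiff ℝ ∞ (fun q : ℝ × Space n => -q.2 l) := fun l => by fun_prop
  have hc : ContDiff ℝ ∞ (fun q : ℝ × Space n => q.1 • q.2) := by fun_prop
  choose ψ hψ using fun l => exists_testFunction_transMean hK (ae_iff.1 hae) (hw l) hc φ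
  refine ⟨ψ, fun z => ?_⟩
  have hd : ∀ l, (∂_{eSpace l} (ψ l)) z = ∫ q, -q.2 l *
      fderiv ℝ φ (z.1, z.2 + q.1 • q.2) (eSpace l) ∂μ := by
    intro l
    rw [testDeriv_apply, hψ l, fderiv_transMean hK (ae_iff.1 hae) (hw l) hc φ.contDiff]
    rfl
  have hcd : Continuous (fderiv ℝ φ) := φ.contDiff.continuous_fderiv (by simp)
  have hint : ∀ l : Fin n, Integrable (fun q : ℝ × Space n => -q.2 l *
      fderiv ℝ φ (z.1, z.2 + q.1 • q.2) (eSpace l)) μ := fun l =>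
    integrable_of_continuous_of_compact hK (ae_iff.1 hae) (by fun_prop)
  simp only [hd]
  rw [← integral_finsetSum _ fun l _ => hint l]
  have hsum : ∀ q : ℝ × Space n, ∑ l, -q.2 l * fderiv ℝ φ (z.1, z.2 + q.1 • q.2) (eSpace l) =
      - fderiv ℝ φ (z.1, z.2 + q.1 • q.2) (0, q.2) := by
    intro q
    have hv : ((0, q.2) : ℝ × Space n) = ∑ l, q.2 l • eSpace l := by
      have h1 : q.2 = ∑ j, q.2 j • EuclideanSpace.single j (1 : ℝ) := by
        simpa using ((EuclideanSpace.basisFun (Fin n) ℝ).sum_repr q.2).symm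
      ext1
      · simp [eSpace, Prod.fst_sum]
      · simp only [eSpace, Prod.snd_sum, Prod.smul_mk]
        exact h1
    rw [hv]
    simp [map_sum, map_smul]
  simp only [hsum]
  have hint2 : Integrable (fun q : ℝ × Space n =>
      - fderiv ℝ φ (z.1, z.2 + q.1 • q.2) (0, q.2)) μ :=
    integrable_of_continuous_of_compact hK (ae_iff.1 hae) (by fun_prop)
  rw [hμ, integral_prod_symm _ hint2]
  have hin : ∀ h : Space n, ∫ s in Set.Icc (0 : ℝ) 1,
      - fderiv ℝ φ (z.1, z.2 + s • h) (0, h) = φ z - φ (z.1, z.2 + h) := by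
    intro h
    rw [integral_Icc_eq_integral_Ioc, ← intervalIntegral.integral_of_le zero_le_one]
    have hder : ∀ s : ℝ, HasDerivAt (fun s => - φ (z.1, z.2 + s • h))
        (- fderiv ℝ φ (z.1, z.2 + s • h) (0, h)) s := by
      intro s
      have h1 : HasDerivAt (fun s : ℝ => ((z.1, z.2 + s • h) : ℝ × Space n)) (0, h) s := by
        have h2 := ((hasDerivAt_id s).smul_const h).const_add z.2
        simpa using (hasDerivAt_const s z.1).prodMk h2
      exact ((((φ.contDiff.differentiable (by simp)) _).hasFDerivAt).comp_hasDerivAt s h1).neg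
    rw [intervalIntegral.integral_eq_sub_of_hasDerivAt (fun s _ => hder s)]
    · simp only [one_smul, zero_smul, add_zero]; ring
    · exact Continuous.intervalIntegrable (by fun_prop) _ _
  simp only [hin]
  have hi3 : Integrable (fun h => φ (z.1, z.2 + h)) ν :=
    integrable_of_continuous_of_compact hν.isCompact hν.compl (by fun_prop)
  rw [integral_sub (integrable_const _) hi3]
  simp [transMean]

end PressureFormula

/-! ### Dyadic increments of the averaged pressure in terms of the velocity -/

section PressureFormula

variable {n : ℕ} {I : Opens ℝ} {Γ : Submodule ℤ (Space n)} {ν : Measure (Space n)}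
  {K : Set (Space n)} {α C : ℝ} {v : ℝ → Space n → Space n} {p : 𝓓'(slab n I, ℝ)}
  {ρ ψ : Space n → ℝ}

/-- Convolution at scale `r` of a test function, as a test function. -/
noncomputable def testMol (κ : Space n → ℝ) (hκ : IsKernel κ) (r : ℝ) (φ : 𝓓(slab n I, ℝ)) :
    𝓓(slab n I, ℝ) :=
  (exists_test_mol hκ r φ).choose

lemma testMol_apply {κ : Space n → ℝ} (hκ : IsKernel κ) (r : ℝ) (φ : 𝓓(slab n I, ℝ))
    (z : ℝ × Space n) : testMol κ hκ r φ z = mol κ r (fun x => φ (z.1, x)) z.2 :=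
  (exists_test_mol hκ r φ).choose_spec.1 z

lemma testDeriv_testMol {κ : Space n → ℝ} (hκ : IsKernel κ) (r : ℝ) (φ : 𝓓(slab n I, ℝ))
    (e : ℝ × Space n) : ∂_{e} (testMol κ hκ r φ) = testMol κ hκ r (∂_{e} φ) := by
  ext z
  rw [testMol_apply]
  exact (exists_test_mol hκ r φ).choose_spec.2 e z

lemma testMol_pd {κ : Space n → ℝ} (hκ : IsKernel κ) (r : ℝ) (φ : 𝓓(slab n I, ℝ)) (j : Fin n) :
    testMol (pd j κ) (hκ.pd j) r φ = r • testMol κ hκ r (∂_{eSpace j} φ) := by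
  ext z
  rw [testMol_apply, mol_pd_eq hκ ((contDiff_test_slice φ z.1).of_le (by simp))]
  simp only [fderiv_test_slice]
  rw [smul_apply, smul_eq_mul, testMol_apply]

lemma testMol_half {hρ : IsKernel ρ} (hψ : IsKernel ψ)
    (h : ∀ y, ∑ j, pd j (pd j ψ) y = 2 ^ n * ρ ((2 : ℝ) • y) - ρ y) (r : ℝ)
    (φ : 𝓓(slab n I, ℝ)) :
    testMol ρ hρ (r / 2) φ - testMol ρ hρ r φ =
      ∑ j, testMol (pd j (pd j ψ)) ((hψ.pd j).pd j) r φ := by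
  ext z
  rw [sub_apply, sum_apply]
  simp only [testMol_apply]
  exact mol_half_sub_mol hρ hψ h (contDiff_test_slice φ z.1).continuous r z.2

lemma integral_mul_testMol {κ : Space n → ℝ} (hκ : IsKernel κ) (r : ℝ) {F : ℝ → Space n → ℝ}
    (hF : IsUniformlyHolder Γ α C F) (φ : 𝓓(slab n I, ℝ)) :
    ∫ z : ℝ × Space n, F z.1 z.2 * testMol κ hκ (-r) φ z =
      ∫ z : ℝ × Space n, mol κ r (F z.1) z.2 * φ z := by
  simp only [testMol_apply]
  exact (integral_mul_mol hκ r hF.aestronglyMeasurable hF.bound φ).2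

/-- The increments of `r ↦ p (testMol ρ r φ)` in terms of the velocity. -/
lemma apply_testMol_half_sub (hE : IsPairedEulerSolution v p) (hv : IsUniformlyHolder Γ α C v)
    (hρ : IsKernel ρ) (hψ : IsKernel ψ)
    (h : ∀ y, ∑ j, pd j (pd j ψ) y = 2 ^ n * ρ ((2 : ℝ) • y) - ρ y) (r : ℝ)
    (φ : 𝓓(slab n I, ℝ)) :
    p (testMol ρ hρ (-(r / 2)) φ) - p (testMol ρ hρ (-r) φ) =
      - ∑ i, ∑ j, ∫ z : ℝ × Space n,
        mol (pd i (pd j ψ)) r (fun x => v z.1 x i * v z.1 x j) z.2 * φ z := by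
  -- Weights `∂ᵢ∂ⱼψ` at scale `-r` are `r²` times second derivatives of a single averaged test
  -- function `ξ`, which makes the Euler equations applicable.
  have h2 : ∀ i j, testMol (pd i (pd j ψ)) ((hψ.pd j).pd i) (-r) φ =
      r ^ 2 • ∂_{eSpace i} (∂_{eSpace j} (testMol ψ hψ (-r) φ)) := by
    intro i j
    rw [testMol_pd (hψ.pd j), testMol_pd hψ, testDeriv_testMol, testDeriv_testMol,
      testDeriv_comm φ (eSpace i) (eSpace j), smul_smul]
    congr 1; ring
  rw [← map_sub, ← neg_div, testMol_half hψ h, map_sum]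
  set ξ := testMol ψ hψ (-r) φ with hξ
  have h3 : ∀ l, p (testMol (pd l (pd l ψ)) ((hψ.pd l).pd l) (-r) φ) =
      - (r ^ 2 * ∫ z : ℝ × Space n, v z.1 z.2 l * (∂_{eSpace l} (∂_{eTime n} ξ)) z) -
        ∑ j, ∫ z : ℝ × Space n, (v z.1 z.2 j * v z.1 z.2 l) *
          testMol (pd j (pd l ψ)) ((hψ.pd l).pd j) (-r) φ z := by
    intro l
    -- Testing with `∂ₗξ` produces the pressure term `p(∂ₗ²ξ)`. The velocity term is `∫ vₗ ∂ₗ∂ₜξ`,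
    -- whose sum over `l` vanishes by the divergence-free condition tested with `∂ₜξ`.
    have hm := hE.momentum (∂_{eSpace l} ξ) l
    rw [testDeriv_comm ξ (eTime n) (eSpace l)] at hm
    rw [h2, map_smul, smul_eq_mul]
    simp only [h2, smul_apply, smul_eq_mul]
    have h4 : ∀ j, ∫ z : ℝ × Space n, (v z.1 z.2 j * v z.1 z.2 l) *
        (r ^ 2 * (∂_{eSpace j} (∂_{eSpace l} ξ)) z) = r ^ 2 * ∫ z : ℝ × Space n,
          (v z.1 z.2 j * v z.1 z.2 l) * (∂_{eSpace j} (∂_{eSpace l} ξ)) z := by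
      intro j
      rw [← integral_const_mul]
      congr 1; ext z; ring
    simp only [h4, ← Finset.mul_sum]
    linear_combination r ^ 2 * hm
  simp only [h3, Finset.sum_sub_distrib, Finset.sum_neg_distrib, ← Finset.mul_sum]
  rw [hE.divergence_free (∂_{eTime n} ξ), mul_zero, neg_zero, zero_sub, Finset.sum_comm]
  congr 1
  refine Finset.sum_congr rfl fun i _ => Finset.sum_congr rfl fun j _ => ?_
  exact integral_mul_testMol ((hψ.pd j).pd i) r ((hv.apply i).mul (hv.apply j)) φ

/-- The partial sums of the series defining the pressure in terms of the velocity. -/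
noncomputable def pressureSum (ψ : Space n → ℝ) (v : ℝ → Space n → Space n) (N : ℕ) (t : ℝ)
    (x : Space n) : ℝ :=
  - ∑ k ∈ Finset.Icc (-(N : ℤ)) N, ∑ i, ∑ j,
    mol (pd i (pd j ψ)) ((2 : ℝ) ^ (-k)) (fun x => v t x i * v t x j) x

lemma sum_Icc_neg_sub (a : ℤ → ℝ) (N : ℕ) :
    ∑ k ∈ Finset.Icc (-(N : ℤ)) N, (a (k + 1) - a k) = a (N + 1) - a (-N) := by
  induction N with
  | zero => simp
  | succ N ih =>
    have h1 : Finset.Icc (-((N + 1 : ℕ) : ℤ)) ((N + 1 : ℕ) : ℤ) =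
        insert (-((N : ℤ) + 1)) (insert ((N : ℤ) + 1) (Finset.Icc (-(N : ℤ)) N)) := by
      ext k; simp only [Finset.mem_insert, Finset.mem_Icc]; push_cast; omega
    rw [h1, Finset.sum_insert, Finset.sum_insert, ih]
    · push_cast
      rw [show -((N : ℤ) + 1) + 1 = -N by ring]
      ring
    · simp
    · simp only [Finset.mem_insert, Finset.mem_Icc]; omega

/-- The increments between consecutive dyadic scales telescope. The smallest scale left is
`2^(-(N+1))`, since each increment reaches down to half its own scale, and the largest is `2^N`. -/
lemma integral_pressureSum (hE : IsPairedEulerSolution v p) (hv : IsUniformlyHolder Γ α C v)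
    (hρ : IsKernel ρ) (hψ : IsKernel ψ)
    (h : ∀ y, ∑ j, pd j (pd j ψ) y = 2 ^ n * ρ ((2 : ℝ) • y) - ρ y) (N : ℕ)
    (φ : 𝓓(slab n I, ℝ)) :
    ∫ z : ℝ × Space n, pressureSum ψ v N z.1 z.2 * φ z =
      p (testMol ρ hρ (-(2 : ℝ) ^ (-((N : ℤ) + 1))) φ) -
        p (testMol ρ hρ (-(2 : ℝ) ^ (N : ℤ)) φ) := by
  have h1 := sum_Icc_neg_sub (fun k : ℤ => p (testMol ρ hρ (-(2 : ℝ) ^ (-k)) φ)) N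
  simp only [neg_neg] at h1
  rw [← h1]
  have h2 : ∀ k : ℤ, (2 : ℝ) ^ (-(k + 1)) = (2 : ℝ) ^ (-k) / 2 := by
    intro k
    rw [neg_add, zpow_add₀ two_ne_zero, zpow_neg_one, div_eq_mul_inv]
  simp only [h2, apply_testMol_half_sub hE hv hρ hψ h, pressureSum]
  have hi : ∀ (k : ℤ) (i j : Fin n), Integrable (fun z : ℝ × Space n =>
      mol (pd i (pd j ψ)) ((2 : ℝ) ^ (-k)) (fun x => v z.1 x i * v z.1 x j) z.2 * φ z) :=
    fun k i j => (integral_mul_mol ((hψ.pd j).pd i) _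
      ((hv.apply i).mul (hv.apply j)).aestronglyMeasurable
      ((hv.apply i).mul (hv.apply j)).bound φ).1
  simp only [neg_mul, Finset.sum_mul]
  rw [integral_neg, integral_finsetSum _ fun k _ => integrable_finsetSum _ fun i _ =>
    integrable_finsetSum _ fun j _ => hi k i j, Finset.sum_neg_distrib]
  congr 1
  refine Finset.sum_congr rfl fun k _ => ?_
  rw [integral_finsetSum _ fun i _ => integrable_finsetSum _ fun j _ => hi k i j]
  exact Finset.sum_congr rfl fun i _ => integral_finsetSum _ fun j _ => hi k i j

end PressureFormula

/-! ### Passage to the limit in the telescoped pressure -/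

section PressureFormula

variable {n : ℕ} {I : Opens ℝ} {Γ : Submodule ℤ (Space n)} {ν : Measure (Space n)}
  {K : Set (Space n)} {α C : ℝ} {v : ℝ → Space n → Space n} {p : 𝓓'(slab n I, ℝ)}
  {ρ ψ : Space n → ℝ}

lemma transMean_sum {A ι : Type} [NormedAddCommGroup A] [MeasurableSpace A]
    [BorelSpace A] [SecondCountableTopology A] {μ : Measure A} [IsFiniteMeasure μ] {K : Set A}
    (hK : IsCompact K) (hμ : μ Kᶜ = 0) {w : A → ℝ} {c : A → Space n} (hw : Continuous w)
    (hc : Continuous c) (s : Finset ι) {g : ι → ℝ × Space n → ℝ} (hg : ∀ i, Continuous (g i))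
    (z : ℝ × Space n) :
    transMean μ w c (fun z => ∑ i ∈ s, g i z) z = ∑ i ∈ s, transMean μ w c (g i) z := by
  simp only [transMean, Finset.mul_sum]
  refine integral_finsetSum _ fun i _ => integrable_of_continuous_of_compact hK hμ ?_
  have := hg i
  fun_prop

/-- The mean of `φ` is killed by the normalization, and the momentum equation evaluates `p` on each
`∂ₗ gₗ`. With `p φ` expressed through the velocity, limits over scales become limits of integrals
and continuity of `p` is not used. -/
lemma apply_eq_of_mean_decomposition (hE : IsPairedEulerSolution v p)
    (hν : IsPeriodicMean Γ ν K) (hp : HasMeanZero Γ p) {φ : 𝓓(slab n I, ℝ)}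
    {g : Fin n → 𝓓(slab n I, ℝ)}
    (hg : ∀ z, φ z = transMean ν (fun _ => 1) id φ z + ∑ l, (∂_{eSpace l} (g l)) z) :
    p φ = - ∑ l, ((∫ z : ℝ × Space n, v z.1 z.2 l * (∂_{eTime n} (g l)) z)
      + ∑ j : Fin n, (∫ z : ℝ × Space n,
        (v z.1 z.2 j * v z.1 z.2 l) * (∂_{eSpace j} (g l)) z)) := by
  obtain ⟨η, hη⟩ := exists_test_mean hν φ
  have h1 : φ = η + ∑ l, ∂_{eSpace l} (g l) := by
    ext z
    rw [hg z, ← hη, add_apply, sum_apply]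
  rw [h1, map_add, apply_mean_eq_zero hν hp hη, zero_add, map_sum, ← Finset.sum_neg_distrib]
  exact Finset.sum_congr rfl fun l _ => by linarith [hE.momentum (g l) l]

lemma testMol_mean_decomposition (hν : IsPeriodicMean Γ ν K) (hρ : IsKernel ρ) (r : ℝ)
    {φ : 𝓓(slab n I, ℝ)} {g : Fin n → 𝓓(slab n I, ℝ)}
    (hg : ∀ z, φ z = transMean ν (fun _ => 1) id φ z + ∑ l, (∂_{eSpace l} (g l)) z)
    (z : ℝ × Space n) :
    testMol ρ hρ r φ z = transMean ν (fun _ => 1) id (testMol ρ hρ r φ) z +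
      ∑ l, (∂_{eSpace l} (testMol ρ hρ r (g l))) z := by
  have := hν.isProbabilityMeasure
  have := hρ.isFiniteMeasure
  have hK := hρ.compact.isCompact
  have hc : Continuous (fun y : Space n => -(r • y)) := by fun_prop
  have e : ∀ χ : 𝓓(slab n I, ℝ), ⇑(testMol ρ hρ r χ) =
      transMean (volume.restrict (tsupport ρ)) ρ (fun y => -(r • y)) χ := by
    intro χ; ext z
    rw [testMol_apply, mol_eq_transMean]
  -- The mean and the `n` derivatives are written as one sum over `Option (Fin n)`, so that
  -- linearity is applied once.
  have hφ : (⇑φ : ℝ × Space n → ℝ) = fun z => ∑ o : Option (Fin n),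
      (o.elim (transMean ν (fun _ => 1) id φ) (fun l => ⇑(∂_{eSpace l} (g l) : 𝓓(slab n I, ℝ)))) z := by
    ext z
    simp [Fintype.sum_option, hg z]
  have hcont : ∀ o : Option (Fin n), Continuous
      (o.elim (transMean ν (fun _ => 1) id φ) (fun l => ⇑(∂_{eSpace l} (g l) : 𝓓(slab n I, ℝ)))) := by
    rintro (_ | l)
    · exact (contDiff_transMean hν.isCompact hν.compl contDiff_const contDiff_id
        φ.contDiff).continuous
    · exact (∂_{eSpace l} (g l)).continuous
  conv_lhs => rw [e, hφ, transMean_sum hK (restrict_tsupport_compl ρ) hρ.continuous hc _ hcont]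
  rw [Fintype.sum_option]
  simp only [Option.elim_none, Option.elim_some]
  congr 1
  · rw [e, transMean_comm hK (restrict_tsupport_compl ρ) hν.isCompact hν.compl hρ.continuous
      continuous_const hc continuous_id φ.continuous]
  · refine Finset.sum_congr rfl fun l _ => ?_
    rw [testDeriv_testMol, e]

lemma tendsto_integral_of_uniform {F : ℝ → Space n → ℝ} {F' : ℕ → ℝ → Space n → ℝ} {ε : ℕ → ℝ}
    (φ : 𝓓(slab n I, ℝ)) (hF : Integrable (fun z : ℝ × Space n => F z.1 z.2 * φ z))
    (hF' : ∀ N, Integrable (fun z : ℝ × Space n => F' N z.1 z.2 * φ z))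
    (hε : Tendsto ε atTop (𝓝 0)) (h : ∀ᶠ N in atTop, ∀ t x, |F' N t x - F t x| ≤ ε N) :
    Tendsto (fun N => ∫ z : ℝ × Space n, F' N z.1 z.2 * φ z) atTop
      (𝓝 (∫ z : ℝ × Space n, F z.1 z.2 * φ z)) := by
  have hφ : Integrable (fun z : ℝ × Space n => |φ z|) :=
    (φ.continuous.integrable_of_hasCompactSupport φ.hasCompactSupport).abs
  rw [tendsto_iff_norm_sub_tendsto_zero]
  have h0 : Tendsto (fun N => ε N * ∫ z : ℝ × Space n, |φ z|) atTop (𝓝 0) := by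
    simpa using hε.mul_const (∫ z : ℝ × Space n, |φ z|)
  refine squeeze_zero' (Eventually.of_forall fun _ => norm_nonneg _) ?_ h0
  filter_upwards [h] with N hN
  rw [← integral_sub (hF' N) hF, ← integral_const_mul]
  refine norm_integral_le_of_norm_le (hφ.const_mul _) (Eventually.of_forall fun z => ?_)
  rw [← sub_mul, norm_mul]
  exact mul_le_mul_of_nonneg_right (hN _ _) (abs_nonneg _)

lemma tendsto_integral_mol_small (hα : 0 < α) (hρ : IsKernel ρ) (hρ1 : ∫ y, ρ y = 1)
    {F : ℝ → Space n → ℝ} (hF : IsUniformlyHolder Γ α C F) {r : ℕ → ℝ}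
    (hr : Tendsto r atTop (𝓝 0)) (φ : 𝓓(slab n I, ℝ)) :
    Tendsto (fun N => ∫ z : ℝ × Space n, mol ρ (r N) (F z.1) z.2 * φ z) atTop
      (𝓝 (∫ z : ℝ × Space n, F z.1 z.2 * φ z)) := by
  refine tendsto_integral_of_uniform (F' := fun N t => mol ρ (r N) (F t))
    (ε := fun N => absMoment α ρ * (C * |r N| ^ α)) φ
    (integrable_mul_test hF.aestronglyMeasurable (fun z => hF.bound z.1 z.2) φ)
    (fun N => (integral_mul_mol hρ (r N) hF.aestronglyMeasurable hF.bound φ).1) ?_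
    (Eventually.of_forall fun N t x => ?_)
  · have h1 : Tendsto (fun N => |r N| ^ α) atTop (𝓝 0) := by
      have := (hr.abs).rpow_const (p := α) (Or.inr hα.le)
      simpa [Real.zero_rpow hα.ne'] using this
    simpa using (h1.const_mul C).const_mul (absMoment α ρ)
  · have := norm_mol_sub_le (r := r N) hρ hα.le (hF.continuous hα t) (hF.holder t) x
    simpa [hρ1] using this

/-- Averages of a periodic function at large scales converge uniformly to its mean, at rate `1/r`;
duality then moves the mean onto the test function. -/
lemma tendsto_integral_mol_large (hα : 0 < α) (hν : IsPeriodicMean Γ ν K) (hρ : IsKernel ρ)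
    (hρ1 : ∫ y, ρ y = 1)
    {F : ℝ → Space n → ℝ} (hF : IsUniformlyHolder Γ α C F) {r : ℕ → ℝ}
    (hr : Tendsto r atTop atTop) (φ : 𝓓(slab n I, ℝ)) :
    Tendsto (fun N => ∫ z : ℝ × Space n, mol ρ (r N) (F z.1) z.2 * φ z) atTop
      (𝓝 (∫ z : ℝ × Space n, F z.1 z.2 * transMean ν (fun _ => 1) id φ z)) := by
  have := hν.isProbabilityMeasure
  have hd := integral_mul_transMean (c := id) hν.isCompact hν.compl (w := fun _ => 1)
    continuous_const continuous_id hF.aestronglyMeasurable (fun z => hF.bound z.1 z.2)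
    φ.continuous φ.hasCompactSupport
  rw [hd.2]
  refine tendsto_integral_of_uniform (F' := fun N t => mol ρ (r N) (F t))
    (F := fun t x => transMean ν (fun _ => 1) (fun h => -id h) (fun z => F z.1 z.2) (t, x))
    (ε := fun N => decayConst ν ρ * |r N|⁻¹ * C) φ hd.1
    (fun N => (integral_mul_mol hρ (r N) hF.aestronglyMeasurable hF.bound φ).1) ?_ ?_
  · have h1 : Tendsto (fun N => |r N|⁻¹) atTop (𝓝 0) :=
      tendsto_inv_atTop_zero.comp (tendsto_abs_atTop_atTop.comp hr)
    simpa using (h1.const_mul (decayConst ν ρ)).mul_const C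
  · filter_upwards [hr.eventually_gt_atTop 0] with N hN t x
    have := abs_mol_sub_mean_le hν hρ hN.ne' (hF.continuous hα t) (hF.periodic t) (hF.bound t) x
    rw [hρ1, one_mul, ← hν.integral_const _ (hF.periodic t) x] at this
    simpa [transMean, sub_eq_add_neg] using this

/-- The pressure is the limit of the partial sums of its series in terms of the velocity. -/
theorem tendsto_integral_pressureSum (hα : 0 < α) (hE : IsPairedEulerSolution v p)
    (hv : IsUniformlyHolder Γ α C v) (hν : IsPeriodicMean Γ ν K) (hp : HasMeanZero Γ p)
    (hρ : IsKernel ρ) (hψ : IsKernel ψ) (hρ1 : ∫ y, ρ y = 1)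
    (h : ∀ y, ∑ j, pd j (pd j ψ) y = 2 ^ n * ρ ((2 : ℝ) • y) - ρ y) (φ : 𝓓(slab n I, ℝ)) :
    Tendsto (fun N : ℕ => ∫ z : ℝ × Space n, pressureSum ψ v N z.1 z.2 * φ z) atTop
      (𝓝 (p φ)) := by
  have := hν.isProbabilityMeasure
  obtain ⟨g, hg⟩ := exists_mean_decomposition hν φ
  -- The fields `gₗ` from the decomposition of `φ` are fixed for all `r`; by adjointness only the
  -- averages of `v` and of its products vary with the scale.
  have hmol : ∀ r, p (testMol ρ hρ (-r) φ) = - ∑ l,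
      ((∫ z : ℝ × Space n, mol ρ r (fun x => v z.1 x l) z.2 * (∂_{eTime n} (g l)) z)
      + ∑ j : Fin n, (∫ z : ℝ × Space n,
        mol ρ r (fun x => v z.1 x j * v z.1 x l) z.2 * (∂_{eSpace j} (g l)) z)) := by
    intro r
    rw [apply_eq_of_mean_decomposition hE hν hp (testMol_mean_decomposition hν hρ (-r) hg)]
    congr 1
    refine Finset.sum_congr rfl fun l _ => ?_
    simp only [testDeriv_testMol]
    congr 1
    · exact integral_mul_testMol hρ r (hv.apply l) _
    · exact Finset.sum_congr rfl fun j _ =>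
        integral_mul_testMol hρ r ((hv.apply j).mul (hv.apply l)) _
  have hsmall : ∀ r : ℕ → ℝ, Tendsto r atTop (𝓝 0) →
      Tendsto (fun N => p (testMol ρ hρ (-r N) φ)) atTop (𝓝 (p φ)) := by
    intro r hr
    simp only [hmol]
    rw [apply_eq_of_mean_decomposition hE hν hp hg]
    refine (tendsto_finsetSum _ fun l _ => Tendsto.add ?_ (tendsto_finsetSum _ fun j _ => ?_)).neg
    · exact tendsto_integral_mol_small hα hρ hρ1 (hv.apply l) hr _
    · exact tendsto_integral_mol_small hα hρ hρ1 ((hv.apply j).mul (hv.apply l)) hr _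
  have hlarge : ∀ r : ℕ → ℝ, Tendsto r atTop atTop →
      Tendsto (fun N => p (testMol ρ hρ (-r N) φ)) atTop (𝓝 0) := by
    intro r hr
    simp only [hmol]
    choose η hη using fun l => exists_test_mean hν (g l)
    have hη' : ∀ (l : Fin n) (e : ℝ × Space n), transMean ν (fun _ => 1) id (⇑(∂_{e} (g l) : 𝓓(slab n I, ℝ))) = ⇑(∂_{e} (η l) : 𝓓(slab n I, ℝ)) := by
      intro l e
      ext z
      rw [testDeriv_apply, hη l, fderiv_transMean hν.isCompact hν.compl contDiff_const
        contDiff_id (g l).contDiff]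
      simp only [← testDeriv_apply]
    -- The limit at large scales is the momentum equation tested with the mean `ηₗ` of `gₗ`. Its
    -- pressure term vanishes because `∂ₗηₗ` is itself the mean of `∂ₗgₗ`.
    have h0 : (0 : ℝ) = - ∑ l : Fin n,
        ((∫ z : ℝ × Space n, v z.1 z.2 l * transMean ν (fun _ => 1) id (⇑(∂_{eTime n} (g l) : 𝓓(slab n I, ℝ))) z)
        + ∑ j : Fin n, (∫ z : ℝ × Space n, (v z.1 z.2 j * v z.1 z.2 l) *
          transMean ν (fun _ => 1) id (⇑(∂_{eSpace j} (g l) : 𝓓(slab n I, ℝ))) z)) := by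
      rw [zero_eq_neg]
      refine Finset.sum_eq_zero fun l _ => ?_
      simp only [hη']
      have h1 := hE.momentum (η l) l
      rwa [apply_mean_eq_zero hν hp (φ := ∂_{eSpace l} (g l)) (hη' l _).symm, add_zero] at h1
    rw [h0]
    refine (tendsto_finsetSum _ fun l _ => Tendsto.add ?_ (tendsto_finsetSum _ fun j _ => ?_)).neg
    · exact tendsto_integral_mol_large hα hν hρ hρ1 (hv.apply l) hr _
    · exact tendsto_integral_mol_large hα hν hρ hρ1 ((hv.apply j).mul (hv.apply l)) hr _
  simp only [integral_pressureSum hE hv hρ hψ h]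
  rw [← sub_zero (p φ)]
  refine (hsmall _ ?_).sub (hlarge _ ?_)
  · have : ∀ N : ℕ, (2 : ℝ) ^ (-((N : ℤ) + 1)) = (1 / 2 : ℝ) ^ (N + 1) := by
      intro N
      rw [zpow_neg, one_div, inv_pow]
      norm_cast
    simp only [this]
    exact (tendsto_pow_atTop_nhds_zero_of_lt_one (by norm_num) (by norm_num)).comp
      (tendsto_add_atTop_nat 1)
  · simp only [zpow_natCast]
    exact tendsto_pow_atTop_atTop_of_one_lt one_lt_two

end PressureFormula

/-! ### Lipschitz bounds from bounded weak derivatives -/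

section TimeRegularity

/-- A bounded function whose weak derivative on an open interval is bounded by `L` is almost
everywhere `L`-Lipschitz there. -/
lemma ae_lipschitz_of_weak_derivative {I : Opens ℝ} (hI : (I : Set ℝ).OrdConnected) {u : ℝ → ℝ}
    {B L : ℝ} (hu : AEStronglyMeasurable u volume) (hB : ∀ t, |u t| ≤ B)
    (h : ∀ η : ℝ → ℝ, ContDiff ℝ ∞ η → HasCompactSupport η → tsupport η ⊆ I →
      |∫ t, deriv η t * u t| ≤ L * ∫ t, |η t|) :
    ∃ S : Set ℝ, (∀ᵐ t, t ∈ S) ∧ ∀ s ∈ I, ∀ t ∈ I, s ∈ S → t ∈ S → |u s - u t| ≤ L * |s - t| := by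
  -- The outer radius is twice the inner one: the almost everywhere convergence of the
  -- mollifications needs a bounded ratio, here `K = 2`.
  let φ : ℕ → ContDiffBump (0 : ℝ) := fun k =>
    ⟨1 / (k + 1 : ℝ), 2 * (1 / (k + 1 : ℝ)), by positivity, by
      have : (0 : ℝ) < 1 / (k + 1 : ℝ) := by positivity
      linarith⟩
  have hφ : Tendsto (fun k => (φ k).rOut) atTop (𝓝 0) := by
    have h0 := (tendsto_one_div_add_atTop_nhds_zero_nat (𝕜 := ℝ)).const_mul (2 : ℝ)
    rw [mul_zero] at h0
    exact h0
  have hloc : LocallyIntegrable u volume := by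
    have h1 : LocallyIntegrable (fun _ : ℝ => B) volume := locallyIntegrable_const B
    exact h1.mono hu (Eventually.of_forall fun t => by
      rw [Real.norm_eq_abs, Real.norm_eq_abs]; exact (hB t).trans (le_abs_self B))
  refine ⟨{t | Tendsto (fun k => convolution ((φ k).normed volume) u
    (ContinuousLinearMap.lsmul ℝ ℝ) volume t) atTop (𝓝 (u t))}, ContDiffBump.ae_convolution_tendsto_right_of_locallyIntegrable (K := 2) hφ
    (Eventually.of_forall fun k => le_rfl) hloc, ?_⟩
  have key : ∀ s ∈ I, ∀ t ∈ I, s ≤ t → ∀ᶠ k in atTop,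
      |convolution ((φ k).normed volume) u (ContinuousLinearMap.lsmul ℝ ℝ) volume s -
        convolution ((φ k).normed volume) u (ContinuousLinearMap.lsmul ℝ ℝ) volume t| ≤
        L * |s - t| := by
    intro s hs t ht hst
    -- A closed neighbourhood of `[s, t]` inside `I`: bumps of radius at most `δ` centred on the
    -- segment are admissible test functions.
    obtain ⟨δ, hδ, hsub⟩ := (isCompact_Icc (a := s) (b := t)).exists_cthickening_subset_open
      I.isOpen (hI.out hs ht)
    filter_upwards [hφ.eventually (ge_mem_nhds hδ)] with k hk
    have hcs : HasCompactSupport ((φ k).normed volume) := (φ k).hasCompactSupport_normed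
    have hsm : ContDiff ℝ ∞ ((φ k).normed volume) := (φ k).contDiff_normed
    have hder := fun x => hcs.hasDerivAt_convolution_left (ContinuousLinearMap.lsmul ℝ ℝ)
      (μ := volume) (hsm.of_le (by simp)) hloc x
    have hb : ∀ x ∈ Set.Icc s t, ‖convolution (deriv ((φ k).normed volume)) u
        (ContinuousLinearMap.lsmul ℝ ℝ) volume x‖ ≤ L := by
      intro x hx
      -- The derivative of the mollification at `x` is the weak pairing with `η`, up to sign. As `η`
      -- has integral one, the hypothesis bounds it by `L`.
      set η : ℝ → ℝ := fun y => (φ k).normed volume (x - y) with hη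
      have hη1 : ContDiff ℝ ∞ η := hsm.comp (contDiff_const.sub contDiff_id)
      have hsupp : tsupport η ⊆ Metric.closedBall x (φ k).rOut := by
        refine closure_minimal (fun y hy => ?_) Metric.isClosed_closedBall
        have h1 : x - y ∈ Function.support ((φ k).normed volume) := hy
        rw [(φ k).support_normed_eq, mem_ball_zero_iff] at h1
        rw [Metric.mem_closedBall, dist_comm, Real.dist_eq]
        exact h1.le
      have hη2 : HasCompactSupport η :=
        HasCompactSupport.of_support_subset_isCompact (isCompact_closedBall x (φ k).rOut)
          ((subset_tsupport η).trans hsupp)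
      have hη3 : tsupport η ⊆ I := by
        refine (hsupp.trans ?_).trans hsub
        refine (Metric.closedBall_subset_closedBall hk).trans ?_
        exact Metric.closedBall_subset_cthickening hx δ
      have h4 := h η hη1 hη2 hη3
      have h5 : ∫ y, |η y| = 1 := by
        have : ∀ y, |η y| = η y := fun y => abs_of_nonneg ((φ k).nonneg_normed _)
        rw [integral_congr_ae (Eventually.of_forall this)]
        exact (integral_sub_left_eq_self (fun y => (φ k).normed volume y) volume x).trans
          (φ k).integral_normed
      have h6 : ∀ y, deriv η y = - deriv ((φ k).normed volume) (x - y) := fun y =>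
        deriv_comp_const_sub _ x y
      have h7 : convolution (deriv ((φ k).normed volume)) u
          (ContinuousLinearMap.lsmul ℝ ℝ) volume x = - ∫ y, deriv η y * u y := by
        rw [convolution, ← integral_neg,
          ← integral_sub_left_eq_self (fun y => -(deriv η y * u y)) volume x]
        congr 1; ext y
        simp [h6]
      rw [h7, norm_neg, Real.norm_eq_abs]
      rwa [h5, mul_one] at h4
    have := (convex_Icc s t).norm_image_sub_le_of_norm_hasDerivWithin_le
      (fun x hx => (hder x).hasDerivWithinAt) hb (Set.right_mem_Icc.2 hst) (Set.left_mem_Icc.2 hst)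
    simpa [Real.norm_eq_abs] using this
  intro s hs t ht hsS htS
  have hsS' : Tendsto _ _ _ := hsS
  have htS' : Tendsto _ _ _ := htS
  have hlim : Tendsto (fun k =>
      |convolution ((φ k).normed volume) u (ContinuousLinearMap.lsmul ℝ ℝ) volume s -
        convolution ((φ k).normed volume) u (ContinuousLinearMap.lsmul ℝ ℝ) volume t|) atTop
      (𝓝 |u s - u t|) := (hsS'.sub htS').abs
  refine le_of_tendsto hlim ?_
  rcases le_total s t with hst | hst
  · exact key s hs t ht hst
  · filter_upwards [key t ht s hs hst] with k hk
    rwa [abs_sub_comm, abs_sub_comm s t]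

end TimeRegularity

/-! ### Sums over dyadic scales -/

section DyadicSums

lemma zpow_two_rpow (k : ℤ) (a : ℝ) : ((2 : ℝ) ^ (-k)) ^ a = (2 : ℝ) ^ (-(k : ℝ) * a) := by
  rw [← Real.rpow_intCast, ← Real.rpow_mul (by norm_num)]
  push_cast; rfl

lemma summable_dyadic_min {a b : ℝ} (ha : 0 < a) (hb : 0 < b) :
    Summable (fun k : ℤ => min (((2 : ℝ) ^ (-k)) ^ a) (((2 : ℝ) ^ (-k)) ^ (-b))) := by
  have hnn : ∀ k : ℤ, 0 ≤ min (((2 : ℝ) ^ (-k)) ^ a) (((2 : ℝ) ^ (-k)) ^ (-b)) :=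
    fun k => le_min (by positivity) (by positivity)
  have hgeom : ∀ c : ℝ, 0 < c → Summable (fun m : ℕ => ((2 : ℝ) ^ (-c)) ^ m) := fun c hc =>
    summable_geometric_of_lt_one (by positivity)
      (Real.rpow_lt_one_of_one_lt_of_neg one_lt_two (by linarith))
  refine Summable.of_nat_of_neg ?_ ?_
  · refine Summable.of_nonneg_of_le (fun m => hnn m) (fun m => (min_le_left _ _).trans ?_)
      (hgeom a ha)
    rw [zpow_two_rpow, ← Real.rpow_natCast, ← Real.rpow_mul (by norm_num)]
    push_cast
    exact le_of_eq (by congr 1; ring)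
  · refine Summable.of_nonneg_of_le (fun m => hnn (-m)) (fun m => (min_le_right _ _).trans ?_)
      (hgeom b hb)
    rw [zpow_two_rpow, ← Real.rpow_natCast, ← Real.rpow_mul (by norm_num)]
    push_cast
    exact le_of_eq (by congr 1; ring)

/-- The value of `∑ₖ min(2^{-ka}, 2^{kb})`. -/
noncomputable def dyadicConst (a b : ℝ) : ℝ :=
  ∑' k : ℤ, min (((2 : ℝ) ^ (-k)) ^ a) (((2 : ℝ) ^ (-k)) ^ (-b))

lemma dyadicConst_nonneg (a b : ℝ) : 0 ≤ dyadicConst a b :=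
  tsum_nonneg fun _ => le_min (by positivity) (by positivity)

/-- The two entries of the minimum cross at `2⁻ᵏ = d`. Shifting `k` by `m + 1`, where `2^m < d ≤
2^(m+1)`, reduces to `d` of order one; the factor two is a bound for `2^α`. -/
lemma sum_dyadic_min_le {α d : ℝ} (hα : 0 < α) (hα1 : α < 1) (hd : 0 ≤ d) (s : Finset ℤ) :
    ∑ k ∈ s, min (((2 : ℝ) ^ (-k)) ^ α) (((2 : ℝ) ^ (-k)) ^ (α - 1) * d) ≤
      2 * dyadicConst α (1 - α) * d ^ α := by
  have hC := dyadicConst_nonneg α (1 - α)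
  rcases hd.eq_or_lt with rfl | hd
  · rw [Real.zero_rpow hα.ne', mul_zero]
    refine Finset.sum_nonpos fun k _ => (min_le_right _ _).trans (by simp)
  obtain ⟨m, hm1, hm2⟩ := exists_mem_Ioc_zpow hd (one_lt_two (α := ℝ))
  have hpos : ∀ k : ℤ, (0 : ℝ) < 2 ^ (-k) := fun k => by positivity
  have h1 : ∀ k, min (((2 : ℝ) ^ (-k)) ^ α) (((2 : ℝ) ^ (-k)) ^ (α - 1) * d) ≤
      ((2 : ℝ) ^ (m + 1)) ^ α * min (((2 : ℝ) ^ (-(k + (m + 1)))) ^ α)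
        (((2 : ℝ) ^ (-(k + (m + 1)))) ^ (-(1 - α))) := by
    intro k
    have e : (2 : ℝ) ^ (-k) = 2 ^ (m + 1) * 2 ^ (-(k + (m + 1))) := by
      rw [← zpow_add₀ two_ne_zero]; congr 1; ring
    rw [mul_min_of_nonneg _ _ (by positivity), e]
    refine min_le_min ?_ ?_
    · rw [Real.mul_rpow (by positivity) (by positivity)]
    · rw [Real.mul_rpow (by positivity) (by positivity), neg_sub]
      have h2 : ((2 : ℝ) ^ (m + 1)) ^ α = ((2 : ℝ) ^ (m + 1)) ^ (α - 1) * 2 ^ (m + 1) := by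
        rw [Real.rpow_sub_one (by positivity)]; field_simp
      rw [h2]
      have h3 : (0 : ℝ) ≤ ((2 : ℝ) ^ (m + 1)) ^ (α - 1) * ((2 : ℝ) ^ (-(k + (m + 1)))) ^ (α - 1) := by
        positivity
      nlinarith
  refine (Finset.sum_le_sum fun k _ => h1 k).trans ?_
  rw [← Finset.mul_sum]
  have hs := summable_dyadic_min hα (sub_pos.2 hα1)
  have h4 : ∑ k ∈ s, min (((2 : ℝ) ^ (-(k + (m + 1)))) ^ α)
        (((2 : ℝ) ^ (-(k + (m + 1)))) ^ (-(1 - α))) ≤ dyadicConst α (1 - α) := by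
    have := Summable.sum_le_tsum (s.map (Equiv.addRight (m + 1)).toEmbedding)
      (fun k _ => le_min (by positivity) (by positivity)) hs
    rwa [Finset.sum_map] at this
  have h5 : ((2 : ℝ) ^ (m + 1)) ^ α ≤ 2 * d ^ α := by
    have e : (2 : ℝ) ^ (m + 1) = 2 * 2 ^ m := by rw [zpow_add_one₀ two_ne_zero]; ring
    rw [e, Real.mul_rpow (by norm_num) (by positivity)]
    have h6 : (2 : ℝ) ^ α ≤ 2 := by
      simpa using Real.rpow_le_rpow_of_exponent_le (x := (2 : ℝ)) (by norm_num) hα1.le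
    have h7 : ((2 : ℝ) ^ m) ^ α ≤ d ^ α := Real.rpow_le_rpow (by positivity) hm1.le hα.le
    gcongr
  calc ((2 : ℝ) ^ (m + 1)) ^ α * _ ≤ (2 * d ^ α) * dyadicConst α (1 - α) := by gcongr
    _ = _ := by ring

end DyadicSums

/-! ### Dyadic singular integrals on periodic Hölder functions -/

section SingularIntegral

variable {n : ℕ} {Γ : Submodule ℤ (Space n)} {ν : Measure (Space n)} {K : Set (Space n)}
  {s s' A B : ℝ} {f g κ : Space n → ℝ}

/-- Periodic functions bounded by `A` with `s`-Hölder constant `A`. -/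
structure IsPeriodicHolder (Γ : Submodule ℤ (Space n)) (s A : ℝ) (f : Space n → ℝ) : Prop where
  bound : ∀ x, |f x| ≤ A
  holder : ∀ x y, |f x - f y| ≤ A * ‖x - y‖ ^ s
  periodic : ∀ γ ∈ Γ, ∀ x, f (x + γ) = f x

namespace IsPeriodicHolder

lemma nonneg (h : IsPeriodicHolder Γ s A f) : 0 ≤ A := (abs_nonneg _).trans (h.bound 0)

lemma continuous (h : IsPeriodicHolder Γ s A f) (hs : 0 < s) : Continuous f := by
  rw [continuous_iff_continuousAt]
  intro x
  rw [ContinuousAt, tendsto_iff_norm_sub_tendsto_zero]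
  have h1 : Tendsto (fun y : Space n => A * ‖y - x‖ ^ s) (𝓝 x) (𝓝 (A * ‖x - x‖ ^ s)) := by
    refine Continuous.tendsto ?_ x
    exact continuous_const.mul ((continuous_id.sub continuous_const).norm.rpow_const
      fun _ => Or.inr hs.le)
  rw [sub_self, norm_zero, Real.zero_rpow hs.ne', mul_zero] at h1
  exact squeeze_zero (fun _ => norm_nonneg _) (fun y => h.holder y x) h1

lemma mono (h : IsPeriodicHolder Γ s A f) (hAB : A ≤ B) : IsPeriodicHolder Γ s B f :=
  ⟨fun x => (h.bound x).trans hAB, fun x y => (h.holder x y).trans (by gcongr), h.periodic⟩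

lemma sub (h : IsPeriodicHolder Γ s A f) (h' : IsPeriodicHolder Γ s B g) :
    IsPeriodicHolder Γ s (A + B) (fun x => f x - g x) where
  bound x := (abs_sub _ _).trans (add_le_add (h.bound x) (h'.bound x))
  holder x y := by
    rw [sub_sub_sub_comm, add_mul]
    exact (abs_sub _ _).trans (add_le_add (h.holder x y) (h'.holder x y))
  periodic γ hγ x := by rw [h.periodic γ hγ x, h'.periodic γ hγ x]

lemma comp_add (h : IsPeriodicHolder Γ s A f) (y : Space n) :
    IsPeriodicHolder Γ s A (fun x => f (x + y)) where
  bound x := h.bound _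
  holder x z := by simpa using h.holder (x + y) (z + y)
  periodic γ hγ x := by rw [add_right_comm, h.periodic γ hγ]

end IsPeriodicHolder

lemma IsUniformlyHolder.isPeriodicHolder {F : ℝ → Space n → ℝ} (h : IsUniformlyHolder Γ s A F)
    (t : ℝ) : IsPeriodicHolder Γ s A (F t) := ⟨h.bound t, h.holder t, h.periodic t⟩

/-- Hölder continuity gives the first entry of the minimum and periodicity the second; together they
make the sum over all integer scales converge at both ends. -/
lemma abs_mol_dyadic_le (hν : IsPeriodicMean Γ ν K) (hκ : IsKernel κ) (h0 : ∫ y, κ y = 0)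
    (hs : 0 < s) (hf : IsPeriodicHolder Γ s A f) (k : ℤ) (x : Space n) :
    |mol κ ((2 : ℝ) ^ (-k)) f x| ≤ (absMoment s κ + decayConst ν κ) * A *
      min (((2 : ℝ) ^ (-k)) ^ s) (((2 : ℝ) ^ (-k)) ^ (-(1 : ℝ))) := by
  have hp : (0 : ℝ) < 2 ^ (-k) := by positivity
  have hA := hf.nonneg
  have h1 := absMoment_nonneg s κ
  have h2 := decayConst_nonneg ν κ
  have e1 := norm_mol_le_of_holder (r := (2 : ℝ) ^ (-k)) hκ h0 hs.le (hf.continuous hs) hf.holder x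
  have e2 := norm_mol_le_of_periodic hν hκ h0 hp.ne' (hf.continuous hs) hf.periodic hf.bound x
  rw [abs_of_pos hp] at e1 e2
  rw [Real.norm_eq_abs] at e1 e2
  have q1 : 0 ≤ ((2 : ℝ) ^ (-k)) ^ s := by positivity
  have q2 : 0 ≤ ((2 : ℝ) ^ (-k))⁻¹ := by positivity
  rw [mul_min_of_nonneg _ _ (by positivity), Real.rpow_neg_one]
  refine le_min (e1.trans ?_) (e2.trans ?_)
  · nlinarith [mul_nonneg (mul_nonneg h2 hA) q1]
  · nlinarith [mul_nonneg (mul_nonneg h1 hA) q2]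

/-- The sum over all dyadic scales of the averages of `f` with weight `κ`. -/
noncomputable def czSum (κ f : Space n → ℝ) (x : Space n) : ℝ :=
  ∑' k : ℤ, mol κ ((2 : ℝ) ^ (-k)) f x

/-- A bound for the norm of `czSum κ` from `C^s` to the bounded functions. -/
noncomputable def czConst (ν : Measure (Space n)) (s : ℝ) (κ : Space n → ℝ) : ℝ :=
  (absMoment s κ + decayConst ν κ) * dyadicConst s 1

lemma czConst_nonneg (ν : Measure (Space n)) (s : ℝ) (κ : Space n → ℝ) : 0 ≤ czConst ν s κ :=
  mul_nonneg (add_nonneg (absMoment_nonneg s κ) (decayConst_nonneg ν κ)) (dyadicConst_nonneg s 1)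

lemma summable_mol_dyadic (hν : IsPeriodicMean Γ ν K) (hκ : IsKernel κ) (h0 : ∫ y, κ y = 0)
    (hs : 0 < s) (hf : IsPeriodicHolder Γ s A f) (x : Space n) :
    Summable (fun k : ℤ => mol κ ((2 : ℝ) ^ (-k)) f x) :=
  Summable.of_norm_bounded ((summable_dyadic_min hs one_pos).mul_left _)
    fun k => abs_mol_dyadic_le hν hκ h0 hs hf k x

lemma abs_czSum_le (hν : IsPeriodicMean Γ ν K) (hκ : IsKernel κ) (h0 : ∫ y, κ y = 0)
    (hs : 0 < s) (hf : IsPeriodicHolder Γ s A f) (x : Space n) :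
    |czSum κ f x| ≤ czConst ν s κ * A := by
  have := tsum_of_norm_bounded (f := fun k : ℤ => mol κ ((2 : ℝ) ^ (-k)) f x)
    ((summable_dyadic_min hs one_pos).mul_left ((absMoment s κ + decayConst ν κ) * A)).hasSum
    fun k => abs_mol_dyadic_le hν hκ h0 hs hf k x
  rw [tsum_mul_left] at this
  refine this.trans (le_of_eq ?_)
  rw [czConst, dyadicConst]; ring

lemma czSum_sub (hν : IsPeriodicMean Γ ν K) (hκ : IsKernel κ) (h0 : ∫ y, κ y = 0)
    (hs : 0 < s) (hf : IsPeriodicHolder Γ s A f) (hg : IsPeriodicHolder Γ s B g) (x : Space n) :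
    czSum κ (fun y => f y - g y) x = czSum κ f x - czSum κ g x := by
  simp only [czSum, mol_sub hκ (hf.continuous hs) (hg.continuous hs)]
  exact (summable_mol_dyadic hν hκ h0 hs hf x).tsum_sub (summable_mol_dyadic hν hκ h0 hs hg x)

lemma czSum_translate (x h : Space n) : czSum κ (fun y => f (y + h)) x = czSum κ f (x + h) := by
  simp only [czSum, mol_translate]

lemma czSum_periodic (hf : ∀ γ ∈ Γ, ∀ x, f (x + γ) = f x) : ∀ γ ∈ Γ, ∀ x,
    czSum κ f (x + γ) = czSum κ f x := by
  intro γ hγ x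
  rw [← czSum_translate]
  congr 1
  ext y
  exact hf γ hγ y

/-- A constant for the Schauder estimate of `czSum κ`. -/
noncomputable def schauderConst (s : ℝ) (κ : Space n → ℝ) : ℝ :=
  (2 * absMoment s κ + ∑ j, absMoment s (pd j κ)) * (2 * dyadicConst s (1 - s))

lemma schauderConst_nonneg (s : ℝ) (κ : Space n → ℝ) : 0 ≤ schauderConst s κ := by
  have h1 := absMoment_nonneg s κ
  have h2 := dyadicConst_nonneg s (1 - s)
  have h3 : 0 ≤ ∑ j, absMoment s (pd j κ) := Finset.sum_nonneg fun j _ => absMoment_nonneg s _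
  unfold schauderConst
  positivity

/-- Schauder estimate for `czSum κ`. -/
lemma abs_czSum_sub_le (hν : IsPeriodicMean Γ ν K) (hκ : IsKernel κ) (h0 : ∫ y, κ y = 0)
    (hs : 0 < s) (hs1 : s < 1) (hf : IsPeriodicHolder Γ s A f) (x y : Space n) :
    |czSum κ f x - czSum κ f y| ≤ schauderConst s κ * A * ‖x - y‖ ^ s := by
  have hA := hf.nonneg
  have hfc := hf.continuous hs
  have h1 := absMoment_nonneg s κ
  have h3 : 0 ≤ ∑ j, absMoment s (pd j κ) := Finset.sum_nonneg fun j _ => absMoment_nonneg s _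
  -- A piece at scale `r` has size `rˢ` and gradient `r^(s-1)`, the weights `∂ⱼκ` also having mean
  -- zero. Scales below `‖x - y‖` are summed by size and those above by gradient.
  have hk : ∀ k : ℤ, |mol κ ((2 : ℝ) ^ (-k)) f x - mol κ ((2 : ℝ) ^ (-k)) f y| ≤
      (2 * absMoment s κ + ∑ j, absMoment s (pd j κ)) * A *
        min (((2 : ℝ) ^ (-k)) ^ s) (((2 : ℝ) ^ (-k)) ^ (s - 1) * ‖x - y‖) := by
    intro k
    have hp : (0 : ℝ) < 2 ^ (-k) := by positivity
    have e1 := fun x => norm_mol_le_of_holder (r := (2 : ℝ) ^ (-k)) hκ h0 hs.le hfc hf.holder x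
    have e2 := abs_mol_sub_mol_le (r := (2 : ℝ) ^ (-k)) hκ hp.ne' hfc
      (fun j x => norm_mol_le_of_holder (hκ.pd j) (hκ.integral_pd j) hs.le hfc hf.holder x) x y
    rw [abs_of_pos hp] at e2
    simp only [abs_of_pos hp, Real.norm_eq_abs] at e1
    have q : 0 ≤ ((2 : ℝ) ^ (-k)) ^ s := by positivity
    rw [mul_min_of_nonneg _ _ (by positivity)]
    refine le_min ?_ (e2.trans ?_)
    · refine (abs_sub _ _).trans ?_
      nlinarith [e1 x, e1 y, mul_nonneg (mul_nonneg h3 hA) q]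
    · rw [← Finset.sum_mul, Real.rpow_sub_one hp.ne']
      have q2 : 0 ≤ ((2 : ℝ) ^ (-k)) ^ s / 2 ^ (-k) * ‖x - y‖ := by positivity
      have : (((2 : ℝ) ^ (-k))⁻¹ * ((∑ j, absMoment s (pd j κ)) * (A * ((2 : ℝ) ^ (-k)) ^ s)) *
          ‖x - y‖) = (∑ j, absMoment s (pd j κ)) * A * (((2 : ℝ) ^ (-k)) ^ s / 2 ^ (-k) * ‖x - y‖) := by
        field_simp
      rw [this]
      gcongr
      linarith
  have hsum := (summable_mol_dyadic hν hκ h0 hs hf x).hasSum.sub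
    (summable_mol_dyadic hν hκ h0 hs hf y).hasSum
  have hT : Tendsto (fun S : Finset ℤ => |∑ k ∈ S, (mol κ ((2 : ℝ) ^ (-k)) f x -
      mol κ ((2 : ℝ) ^ (-k)) f y)|) atTop (𝓝 |czSum κ f x - czSum κ f y|) :=
    (continuous_abs.tendsto _).comp hsum
  refine le_of_tendsto' hT fun S => ?_
  refine (Finset.abs_sum_le_sum_abs _ _).trans ((Finset.sum_le_sum fun k _ => hk k).trans ?_)
  rw [← Finset.mul_sum]
  have := sum_dyadic_min_le hs hs1 (norm_nonneg (x - y)) S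
  calc _ ≤ (2 * absMoment s κ + ∑ j, absMoment s (pd j κ)) * A *
        (2 * dyadicConst s (1 - s) * ‖x - y‖ ^ s) := by gcongr
    _ = _ := by rw [schauderConst]; ring

lemma IsPeriodicHolder.czSum (hν : IsPeriodicMean Γ ν K) (hκ : IsKernel κ) (h0 : ∫ y, κ y = 0)
    (hs : 0 < s) (hs1 : s < 1) (hf : IsPeriodicHolder Γ s A f) :
    IsPeriodicHolder Γ s ((czConst ν s κ + schauderConst s κ) * A) (czSum κ f) where
  bound x := (abs_czSum_le hν hκ h0 hs hf x).trans (by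
    have := mul_nonneg (schauderConst_nonneg s κ) hf.nonneg
    linarith)
  holder x y := (abs_czSum_sub_le hν hκ h0 hs hs1 hf x y).trans (by
    have := mul_nonneg (czConst_nonneg ν s κ) hf.nonneg
    refine mul_le_mul_of_nonneg_right ?_ (by positivity)
    linarith)
  periodic := czSum_periodic hf.periodic

/-- The partial sums of `czSum` over symmetric ranges of scales. -/
lemma tendsto_sum_Icc_mol (hν : IsPeriodicMean Γ ν K) (hκ : IsKernel κ) (h0 : ∫ y, κ y = 0)
    (hs : 0 < s) (hf : IsPeriodicHolder Γ s A f) (x : Space n) :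
    Tendsto (fun N : ℕ => ∑ k ∈ Finset.Icc (-(N : ℤ)) N, mol κ ((2 : ℝ) ^ (-k)) f x) atTop
      (𝓝 (czSum κ f x)) :=
  (summable_mol_dyadic hν hκ h0 hs hf x).hasSum.comp
    (tendsto_atTop_finset_of_monotone (fun M N hMN => Finset.Icc_subset_Icc (by omega) (by omega))
      fun k => ⟨k.natAbs, by simp only [Finset.mem_Icc]; omega⟩)

end SingularIntegral

/-! ### The pressure as a function -/

section Pressure

variable {n : ℕ} {I : Opens ℝ} {Γ : Submodule ℤ (Space n)} {ν : Measure (Space n)}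
  {K : Set (Space n)} {α C : ℝ} {v : ℝ → Space n → Space n} {p : 𝓓'(slab n I, ℝ)}
  {ρ ψ κ : Space n → ℝ}

lemma aestronglyMeasurable_mol (hκ : IsKernel κ) (r : ℝ) {F : ℝ → Space n → ℝ}
    (hF : AEStronglyMeasurable (fun z : ℝ × Space n => F z.1 z.2) volume) :
    AEStronglyMeasurable (fun z : ℝ × Space n => mol κ r (F z.1) z.2) volume := by
  have := hκ.isFiniteMeasure
  have e1 : ∀ z : ℝ × Space n, mol κ r (F z.1) z.2 = transMean (volume.restrict (tsupport κ)) κ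
      (fun y => -(r • y)) (fun z : ℝ × Space n => F z.1 z.2) z := fun z =>
    mol_eq_transMean κ r (fun z : ℝ × Space n => F z.1 z.2) z
  simp only [e1, transMean]
  have hmp := measurePreserving_translate (μ := (volume : Measure (Space n)).restrict (tsupport κ))
    (c := fun y => -(r • y)) (by fun_prop)
  have h1 : AEStronglyMeasurable (fun q : Space n × (ℝ × Space n) => F q.2.1 q.2.2)
      ((volume.restrict (tsupport κ)).prod volume) :=
    hF.comp_quasiMeasurePreserving Measure.quasiMeasurePreserving_snd
  have h2 := (hκ.continuous.comp continuous_fst).aestronglyMeasurable.mul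
    (h1.comp_measurePreserving hmp)
  exact h2.prod_swap.integral_prod_right'

/-- The pressure of a velocity field on the torus, as the sum of the dyadic pieces of
`-∑ᵢⱼ ∂ᵢ∂ⱼ Δ⁻¹ (vⁱ vʲ)`. -/
noncomputable def pressure (ψ : Space n → ℝ) (v : ℝ → Space n → Space n) (t : ℝ) (x : Space n) :
    ℝ :=
  - ∑ i, ∑ j, czSum (pd i (pd j ψ)) (fun x => v t x i * v t x j) x

lemma tendsto_pressureSum (hα : 0 < α) (hv : IsUniformlyHolder Γ α C v)
    (hν : IsPeriodicMean Γ ν K) (hψ : IsKernel ψ) (t : ℝ) (x : Space n) :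
    Tendsto (fun N => pressureSum ψ v N t x) atTop (𝓝 (pressure ψ v t x)) := by
  unfold pressure pressureSum
  have h : ∀ N : ℕ, ∑ k ∈ Finset.Icc (-(N : ℤ)) N, ∑ i, ∑ j,
      mol (pd i (pd j ψ)) ((2 : ℝ) ^ (-k)) (fun x => v t x i * v t x j) x =
      ∑ i, ∑ j, ∑ k ∈ Finset.Icc (-(N : ℤ)) N,
        mol (pd i (pd j ψ)) ((2 : ℝ) ^ (-k)) (fun x => v t x i * v t x j) x := by
    intro N
    rw [Finset.sum_comm]
    exact Finset.sum_congr rfl fun i _ => Finset.sum_comm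
  simp only [h]
  exact (tendsto_finsetSum _ fun i _ => tendsto_finsetSum _ fun j _ =>
    tendsto_sum_Icc_mol hν ((hψ.pd j).pd i) ((hψ.pd j).integral_pd i) hα
      (((hv.apply i).mul (hv.apply j)).isPeriodicHolder t) x).neg

/-- The pressure is as regular in space as the velocity. -/
lemma exists_isUniformlyHolder_pressure (hα : 0 < α) (hα1 : α < 1) (hν : IsPeriodicMean Γ ν K)
    (hψ : IsKernel ψ) (C : ℝ) : ∃ C', ∀ v : ℝ → Space n → Space n, IsUniformlyHolder Γ α C v →
      IsUniformlyHolder Γ α C' (pressure ψ v) := by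
  refine ⟨∑ i : Fin n, ∑ j : Fin n, (czConst ν α (pd i (pd j ψ)) + schauderConst α (pd i (pd j ψ))) *
    (2 * C ^ 2), fun v hv => ?_⟩
  have hcz : ∀ (t : ℝ) (i j : Fin n), IsPeriodicHolder Γ α
      ((czConst ν α (pd i (pd j ψ)) + schauderConst α (pd i (pd j ψ))) * (2 * C ^ 2))
      (czSum (pd i (pd j ψ)) (fun x => v t x i * v t x j)) := fun t i j =>
    (((hv.apply i).mul (hv.apply j)).isPeriodicHolder t).czSum hν ((hψ.pd j).pd i)
      ((hψ.pd j).integral_pd i) hα hα1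
  constructor
  · refine aestronglyMeasurable_of_tendsto_ae atTop
      (f := fun (N : ℕ) (z : ℝ × Space n) => pressureSum ψ v N z.1 z.2) (fun N => ?_)
      (Eventually.of_forall fun z => tendsto_pressureSum hα hv hν hψ z.1 z.2)
    refine (Finset.aestronglyMeasurable_fun_sum _ fun k _ =>
      Finset.aestronglyMeasurable_fun_sum _ fun i _ =>
      Finset.aestronglyMeasurable_fun_sum _ fun j _ => ?_).neg
    exact aestronglyMeasurable_mol (F := fun t x => v t x i * v t x j) ((hψ.pd j).pd i) _
      ((hv.apply i).mul (hv.apply j)).aestronglyMeasurable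
  · intro t x
    rw [pressure, norm_neg]
    exact norm_sum_le_of_le _ fun i _ => norm_sum_le_of_le _ fun j _ => (hcz t i j).bound x
  · intro t x y
    rw [pressure, pressure, neg_sub_neg, ← norm_neg, neg_sub, ← Finset.sum_sub_distrib,
      Finset.sum_mul]
    simp only [← Finset.sum_sub_distrib, Finset.sum_mul]
    exact norm_sum_le_of_le _ fun i _ => norm_sum_le_of_le _ fun j _ => (hcz t i j).holder x y
  · intro t γ hγ x
    rw [pressure, pressure]
    congr 1
    exact Finset.sum_congr rfl fun i _ => Finset.sum_congr rfl fun j _ =>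
      (hcz t i j).periodic γ hγ x

/-- The pressure distribution is the pressure function of the velocity field. -/
theorem apply_eq_integral_pressure (hα : 0 < α) (hE : IsPairedEulerSolution v p)
    (hv : IsUniformlyHolder Γ α C v) (hν : IsPeriodicMean Γ ν K) (hp : HasMeanZero Γ p)
    (hρ : IsKernel ρ) (hψ : IsKernel ψ) (hρ1 : ∫ y, ρ y = 1)
    (h : ∀ y, ∑ j, pd j (pd j ψ) y = 2 ^ n * ρ ((2 : ℝ) • y) - ρ y) (φ : 𝓓(slab n I, ℝ)) :
    p φ = ∫ z : ℝ × Space n, pressure ψ v z.1 z.2 * φ z := by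
  refine tendsto_nhds_unique (tendsto_integral_pressureSum hα hE hv hν hp hρ hψ hρ1 h φ) ?_
  -- A bound for all partial sums, uniform in `N`, from the convergent dyadic majorant. It allows
  -- dominated convergence against `φ`.
  set M : ℝ := ∑ i : Fin n, ∑ j : Fin n, ((absMoment α (pd i (pd j ψ)) +
    decayConst ν (pd i (pd j ψ))) * (2 * C ^ 2)) * dyadicConst α 1 with hM
  have hφ : Integrable (fun z : ℝ × Space n => |φ z|) :=
    (φ.continuous.integrable_of_hasCompactSupport φ.hasCompactSupport).abs
  refine tendsto_integral_of_dominated_convergence (fun z => M * |φ z|) (fun N => ?_)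
    (hφ.const_mul M) (fun N => Eventually.of_forall fun z => ?_)
    (Eventually.of_forall fun z => (tendsto_pressureSum hα hv hν hψ z.1 z.2).mul_const _)
  · refine AEStronglyMeasurable.mul ?_ φ.continuous.aestronglyMeasurable
    refine (Finset.aestronglyMeasurable_fun_sum _ fun k _ =>
      Finset.aestronglyMeasurable_fun_sum _ fun i _ =>
      Finset.aestronglyMeasurable_fun_sum _ fun j _ => ?_).neg
    exact aestronglyMeasurable_mol (F := fun t x => v t x i * v t x j) ((hψ.pd j).pd i) _
      ((hv.apply i).mul (hv.apply j)).aestronglyMeasurable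
  · rw [norm_mul, Real.norm_eq_abs (φ z)]
    refine mul_le_mul_of_nonneg_right ?_ (abs_nonneg _)
    rw [pressureSum, norm_neg]
    have hswap : ∑ k ∈ Finset.Icc (-(N : ℤ)) N, ∑ i, ∑ j,
        mol (pd i (pd j ψ)) ((2 : ℝ) ^ (-k)) (fun x => v z.1 x i * v z.1 x j) z.2 =
        ∑ i, ∑ j, ∑ k ∈ Finset.Icc (-(N : ℤ)) N,
        mol (pd i (pd j ψ)) ((2 : ℝ) ^ (-k)) (fun x => v z.1 x i * v z.1 x j) z.2 := by
      rw [Finset.sum_comm]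
      exact Finset.sum_congr rfl fun i _ => Finset.sum_comm
    rw [hswap]
    refine norm_sum_le_of_le _ fun i _ => norm_sum_le_of_le _ fun j _ => ?_
    refine (norm_sum_le_of_le _ fun k _ => abs_mol_dyadic_le hν ((hψ.pd j).pd i)
      ((hψ.pd j).integral_pd i) hα (((hv.apply i).mul (hv.apply j)).isPeriodicHolder z.1) k
        z.2).trans ?_
    rw [← Finset.mul_sum]
    have h1 := absMoment_nonneg α (pd i (pd j ψ))
    have h2 := decayConst_nonneg ν (pd i (pd j ψ))
    refine mul_le_mul_of_nonneg_left ?_ (by positivity)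
    exact (summable_dyadic_min hα one_pos).sum_le_tsum _
      fun k _ => le_min (by positivity) (by positivity)

end Pressure

/-! ### The Euler equations tested with averaging weights -/

section WeakTimeDerivative

variable {n : ℕ} {I : Opens ℝ} {Γ : Submodule ℤ (Space n)} {α C : ℝ}
  {v : ℝ → Space n → Space n} {p : 𝓓'(slab n I, ℝ)} {κ : Space n → ℝ} {r : ℝ}

/-- The weight of the average `mol κ r` centred at `x`. -/
noncomputable def weight (κ : Space n → ℝ) (r : ℝ) (x y : Space n) : ℝ :=
  |(r ^ n)⁻¹| * κ (r⁻¹ • (x - y))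

lemma mol_eq_integral_weight (hr : r ≠ 0) (f : Space n → ℝ) (x : Space n) :
    mol κ r f x = ∫ y, weight κ r x y * f y := by
  have h1 := Measure.integral_comp_smul (volume : Measure (Space n))
    (fun y => κ (r⁻¹ • y) * f (x - y)) r
  simp only [inv_smul_smul₀ hr, finrank_euclideanSpace, Fintype.card_fin] at h1
  rw [mol]
  simp only [smul_eq_mul]
  rw [h1, ← integral_sub_left_eq_self (fun y => weight κ r x y * f y) volume x, smul_eq_mul,
    ← integral_const_mul]
  simp only [weight, sub_sub_cancel, mul_assoc]

lemma isKernel_weight (hκ : IsKernel κ) (hr : r ≠ 0) (x : Space n) :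
    IsKernel (weight κ r x) where
  smooth := contDiff_const.mul (hκ.smooth.comp ((contDiff_const.sub contDiff_id).const_smul _))
  compact := by
    refine HasCompactSupport.mul_left ?_
    have h1 : HasCompactSupport (fun y => κ (r⁻¹ • y)) := hκ.compact.comp_smul (inv_ne_zero hr)
    exact h1.comp_homeomorph (Homeomorph.subLeft x)

/-- The sign comes from `x - y` and the factor `r⁻¹` from the dilation. -/
lemma pd_weight (hκ : IsKernel κ) (j : Fin n) (x y : Space n) :
    pd j (weight κ r x) y = -r⁻¹ * weight (pd j κ) r x y := by
  have h1 : HasFDerivAt (fun y : Space n => r⁻¹ • (x - y))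
      (r⁻¹ • (-ContinuousLinearMap.id ℝ (Space n))) y :=
    HasFDerivAt.fun_const_smul ((hasFDerivAt_id y).const_sub x) _
  have h2 := ((hκ.differentiable (r⁻¹ • (x - y))).hasFDerivAt.comp y h1).const_mul |(r ^ n)⁻¹|
  have h3 : fderiv ℝ (weight κ r x) y = _ := h2.fderiv
  rw [pd, h3, weight, pd]
  simp
  ring

/-- The test function `(t, y) ↦ η(t) θ(y)`. -/
lemma exists_tensor_test {η : ℝ → ℝ} (hη : ContDiff ℝ ∞ η) (hηc : HasCompactSupport η)
    (hηI : tsupport η ⊆ I) {θ : Space n → ℝ} (hθ : IsKernel θ) :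
    ∃ φ : 𝓓(slab n I, ℝ), (∀ z, φ z = η z.1 * θ z.2) ∧
      (∀ z, (∂_{eTime n} φ) z = deriv η z.1 * θ z.2) ∧
      ∀ j z, (∂_{eSpace j} φ) z = η z.1 * pd j θ z.2 := by
  have hsupp : ∀ z : ℝ × Space n, z ∉ tsupport η ×ˢ tsupport θ → η z.1 * θ z.2 = 0 := by
    intro z hz
    rw [Set.mem_prod, not_and_or] at hz
    rcases hz with hz | hz <;> simp [image_eq_zero_of_notMem_tsupport hz]
  have hcomp : IsCompact (tsupport η ×ˢ tsupport θ) := hηc.isCompact.prod hθ.compact.isCompact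
  have hsm : ContDiff ℝ ∞ (fun z : ℝ × Space n => η z.1 * θ z.2) :=
    (hη.comp contDiff_fst).mul (hθ.smooth.comp contDiff_snd)
  have hd : ∀ z e : ℝ × Space n, fderiv ℝ (fun z : ℝ × Space n => η z.1 * θ z.2) z e =
      η z.1 * fderiv ℝ θ z.2 e.2 + deriv η z.1 * e.1 * θ z.2 := by
    intro z e
    have h1 : HasFDerivAt (fun z : ℝ × Space n => η z.1) _ z :=
      ((hη.differentiable (by simp)) z.1).hasFDerivAt.comp z hasFDerivAt_fst
    have h2 : HasFDerivAt (fun z : ℝ × Space n => θ z.2) _ z :=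
      (hθ.differentiable z.2).hasFDerivAt.comp z hasFDerivAt_snd
    rw [(h1.fun_mul h2).fderiv]
    have h3 : fderiv ℝ η z.1 e.1 = deriv η z.1 * e.1 := by
      rw [← mul_one e.1, ← smul_eq_mul e.1, map_smul, smul_eq_mul, mul_comm]
      simp
    simp [h3]
    ring
  refine ⟨⟨fun z => η z.1 * θ z.2, hsm, HasCompactSupport.intro hcomp hsupp, ?_⟩,
    fun z => rfl, fun z => ?_, fun j z => ?_⟩
  · refine Set.Subset.trans (closure_minimal (t := tsupport η ×ˢ tsupport θ) (fun z hz => ?_)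
      hcomp.isClosed) ?_
    · by_contra h
      exact hz (hsupp z h)
    · rintro z ⟨hz, -⟩
      exact ⟨hηI hz, Set.mem_univ _⟩
  · rw [testDeriv_apply]
    exact (hd z (eTime n)).trans (by simp [eTime])
  · rw [testDeriv_apply]
    exact (hd z (eSpace j)).trans (by simp [eSpace, pd])

lemma integral_mul_tensor (hκ : IsKernel κ) (hr : r ≠ 0) {F : ℝ → Space n → ℝ}
    (hF : AEStronglyMeasurable (fun z : ℝ × Space n => F z.1 z.2) volume)
    (hFC : ∀ t x, |F t x| ≤ C) {η : ℝ → ℝ} (hη : Integrable η) (x : Space n) :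
    Integrable (fun s => η s * mol κ r (F s) x) ∧
    ∫ z : ℝ × Space n, F z.1 z.2 * (η z.1 * weight κ r x z.2) =
      ∫ s, η s * mol κ r (F s) x := by
  have h1 : Integrable (fun z : ℝ × Space n => η z.1 * weight κ r x z.2) :=
    hη.mul_prod (isKernel_weight hκ hr x).integrable
  have h2 : Integrable (fun z : ℝ × Space n => F z.1 z.2 * (η z.1 * weight κ r x z.2)) :=
    h1.bdd_mul hF (Eventually.of_forall fun z => hFC z.1 z.2)
  have h3 : ∀ s, ∫ y, F s y * (η s * weight κ r x y) = η s * mol κ r (F s) x := by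
    intro s
    rw [mol_eq_integral_weight hr, ← integral_const_mul]
    congr 1; ext y; ring
  have h4 := h2.integral_prod_left
  simp only [h3] at h4
  refine ⟨h4, ?_⟩
  rw [Measure.volume_eq_prod, integral_prod _ h2]
  simp only [h3]

lemma aestronglyMeasurable_mol_time (hκ : IsKernel κ) (hr : r ≠ 0) {F : ℝ → Space n → ℝ}
    (hF : AEStronglyMeasurable (fun z : ℝ × Space n => F z.1 z.2) volume) (x : Space n) :
    AEStronglyMeasurable (fun s => mol κ r (F s) x) volume := by
  simp only [mol_eq_integral_weight hr]
  have h1 : AEStronglyMeasurable (fun z : ℝ × Space n => weight κ r x z.2 * F z.1 z.2)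
      (volume.prod volume) :=
    ((isKernel_weight hκ hr x).continuous.comp continuous_snd).aestronglyMeasurable.mul hF
  exact h1.integral_prod_right'

/-- The momentum equation, tested with the weight of an average in space. -/
lemma integral_deriv_mul_mol (hE : IsPairedEulerSolution v p) (hv : IsUniformlyHolder Γ α C v)
    {P : ℝ → Space n → ℝ} {C' : ℝ} (hP : IsUniformlyHolder Γ α C' P)
    (hp : ∀ φ : 𝓓(slab n I, ℝ), p φ = ∫ z : ℝ × Space n, P z.1 z.2 * φ z)
    (hκ : IsKernel κ) (hr : r ≠ 0) {η : ℝ → ℝ} (hη : ContDiff ℝ ∞ η) (hηc : HasCompactSupport η)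
    (hηI : tsupport η ⊆ I) (l : Fin n) (x : Space n) :
    ∫ s, deriv η s * mol κ r (fun y => v s y l) x = ∫ s, η s * (r⁻¹ *
      (∑ j, mol (pd j κ) r (fun y => v s y j * v s y l) x + mol (pd l κ) r (P s) x)) := by
  -- With the test function `η(t)` times the weight centred at `x`, integration in space replaces
  -- every field by its average at `x` and leaves an identity in time alone.
  obtain ⟨φ, -, hφt, hφx⟩ := exists_tensor_test hη hηc hηI (isKernel_weight hκ hr x)
  have hm := hE.momentum φ l
  rw [hp] at hm
  simp only [hφt, hφx, pd_weight hκ] at hm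
  have hηi : Integrable η := hη.continuous.integrable_of_hasCompactSupport hηc
  have hη'i : Integrable (deriv η) :=
    (hη.continuous_deriv (by simp)).integrable_of_hasCompactSupport hηc.deriv
  have e : ∀ (F : ℝ → Space n → ℝ) (j : Fin n),
      ∫ z : ℝ × Space n, F z.1 z.2 * (η z.1 * (-r⁻¹ * weight (pd j κ) r x z.2)) =
        -r⁻¹ * ∫ z : ℝ × Space n, F z.1 z.2 * (η z.1 * weight (pd j κ) r x z.2) := by
    intro F j
    rw [← integral_const_mul]
    congr 1; ext z; ring
  have i1 := fun j => integral_mul_tensor (hκ.pd j) hr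
    ((hv.apply j).mul (hv.apply l)).aestronglyMeasurable ((hv.apply j).mul (hv.apply l)).bound hηi x
  have i2 := integral_mul_tensor (hκ.pd l) hr hP.aestronglyMeasurable hP.bound hηi x
  have i3 := integral_mul_tensor hκ hr (hv.apply l).aestronglyMeasurable (hv.apply l).bound hη'i x
  rw [e P l, i2.2] at hm
  simp only [fun j => e (fun t x => v t x j * v t x l) j, fun j => (i1 j).2] at hm
  rw [i3.2] at hm
  have hR : ∫ s, η s * (r⁻¹ *
      (∑ j, mol (pd j κ) r (fun y => v s y j * v s y l) x + mol (pd l κ) r (P s) x)) =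
      r⁻¹ * ((∑ j, ∫ s, η s * mol (pd j κ) r (fun y => v s y j * v s y l) x) +
        ∫ s, η s * mol (pd l κ) r (P s) x) := by
    rw [← integral_finsetSum _ fun j _ => (i1 j).1,
      ← integral_add (integrable_finsetSum _ fun j _ => (i1 j).1) i2.1, ← integral_const_mul]
    congr 1; ext s
    rw [← Finset.mul_sum]; ring
  rw [hR]
  rw [← Finset.mul_sum] at hm
  linarith

/-- The divergence-free condition, tested with the weight of an average in space. -/
lemma integral_mul_sum_mol (hE : IsPairedEulerSolution v p) (hv : IsUniformlyHolder Γ α C v)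
    (hκ : IsKernel κ) (hr : r ≠ 0) {η : ℝ → ℝ} (hη : ContDiff ℝ ∞ η) (hηc : HasCompactSupport η)
    (hηI : tsupport η ⊆ I) (x : Space n) :
    ∫ s, η s * ∑ j, mol (pd j κ) r (fun y => v s y j) x = 0 := by
  obtain ⟨φ, -, -, hφx⟩ := exists_tensor_test hη hηc hηI (isKernel_weight hκ hr x)
  have hm := hE.divergence_free φ
  simp only [hφx, pd_weight hκ] at hm
  have hηi : Integrable η := hη.continuous.integrable_of_hasCompactSupport hηc
  have e : ∀ (F : ℝ → Space n → ℝ) (j : Fin n),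
      ∫ z : ℝ × Space n, F z.1 z.2 * (η z.1 * (-r⁻¹ * weight (pd j κ) r x z.2)) =
        -r⁻¹ * ∫ z : ℝ × Space n, F z.1 z.2 * (η z.1 * weight (pd j κ) r x z.2) := by
    intro F j
    rw [← integral_const_mul]
    congr 1; ext z; ring
  have i1 := fun j => integral_mul_tensor (hκ.pd j) hr (hv.apply j).aestronglyMeasurable
    (hv.apply j).bound hηi x
  simp only [fun j => e (fun t x => v t x j) j, fun j => (i1 j).2, ← Finset.mul_sum] at hm
  simp only [Finset.mul_sum]
  rw [integral_finsetSum _ fun j _ => (i1 j).1]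
  have : -r⁻¹ ≠ 0 := neg_ne_zero.2 (inv_ne_zero hr)
  exact (mul_eq_zero.1 hm).resolve_left this

end WeakTimeDerivative

/-! ### Hölder continuity in time off a null set -/

section Versions

variable {n : ℕ} {I : Opens ℝ} {Γ : Submodule ℤ (Space n)} {ν : Measure (Space n)}
  {K : Set (Space n)} {α C : ℝ} {v w : ℝ → Space n → Space n} {p : 𝓓'(slab n I, ℝ)}
  {ρ ψ κ : Space n → ℝ}

lemma norm_le_sum_abs (x : Space n) : ‖x‖ ≤ ∑ l, |x l| := by
  have h1 : x = ∑ j, x j • EuclideanSpace.single j (1 : ℝ) := by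
    simpa using ((EuclideanSpace.basisFun (Fin n) ℝ).sum_repr x).symm
  conv_lhs => rw [h1]
  refine norm_sum_le_of_le _ fun j _ => ?_
  rw [norm_smul]; simp

lemma norm_le_of_forall_abs_le {x : Space n} {B : ℝ} (h : ∀ l, |x l| ≤ B) : ‖x‖ ≤ n * B := by
  refine (norm_le_sum_abs x).trans ((Finset.sum_le_sum fun l _ => h l).trans ?_)
  simp

lemma ae_slab_of_ae {q : ℝ → Prop} (h : ∀ᵐ t ∂(volume.restrict (I : Set ℝ)), q t) :
    ∀ᵐ z : ℝ × Space n, z ∈ (slab n I : Set (ℝ × Space n)) → q z.1 := by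
  have h1 := (ae_restrict_iff' I.isOpen.measurableSet).1 h
  have h2 : ∀ᵐ z : ℝ × Space n, z.1 ∈ I → q z.1 := by
    rw [Measure.volume_eq_prod]
    exact Measure.quasiMeasurePreserving_fst.ae h1
  filter_upwards [h2] with z hz hz'
  exact hz hz'.1

lemma IsWeakEulerSolution.congr (h : IsWeakEulerSolution I v p)
    (hvw : ∀ᵐ t ∂(volume.restrict (I : Set ℝ)), ∀ x, v t x = w t x) :
    IsWeakEulerSolution I w p where
  momentum φ l := by
    rw [← h.momentum φ l]
    congr 1
    refine setIntegral_congr_ae (slab n I).isOpen.measurableSet ?_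
    filter_upwards [ae_slab_of_ae hvw] with z hz hz'
    simp only [hz hz' z.2]
  divergence_free φ := by
    rw [← h.divergence_free φ]
    refine setIntegral_congr_ae (slab n I).isOpen.measurableSet ?_
    filter_upwards [ae_slab_of_ae hvw] with z hz hz'
    simp only [hz hz' z.2]

/-- Replacing the field by zero at bad times and outside `I` makes the bounds hold at every time. -/
lemma exists_isUniformlyHolder (hv : MemLinftyHolder α I v) (hper : IsPeriodic Γ I v) :
    ∃ w C, IsUniformlyHolder Γ α C w ∧
      ∀ᵐ t ∂(volume.restrict (I : Set ℝ)), ∀ x, v t x = w t x := by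
  classical
  obtain ⟨C, hC⟩ := hv.bounded
  have hC' := (ae_restrict_iff' I.isOpen.measurableSet).1 hC
  -- The set of bad times need not be measurable, so it is enlarged to a measurable null set.
  set N := toMeasurable volume {t | ¬ (t ∈ (I : Set ℝ) → (∀ x, ‖v t x‖ ≤ C) ∧
    ∀ x y, ‖v t x - v t y‖ ≤ C * ‖x - y‖ ^ α)} with hN
  have hN0 : volume N = 0 := by rw [hN, measure_toMeasurable]; exact ae_iff.1 hC'
  have hNm : MeasurableSet N := measurableSet_toMeasurable _ _
  have hgood : ∀ t ∈ (I : Set ℝ) \ N, (∀ x, ‖v t x‖ ≤ C) ∧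
      ∀ x y, ‖v t x - v t y‖ ≤ C * ‖x - y‖ ^ α := by
    rintro t ⟨ht, htN⟩
    by_contra h
    exact htN (subset_toMeasurable _ _ fun h' => h (h' ht))
  have hC0 : 0 ≤ |C| := abs_nonneg C
  refine ⟨fun t x => if t ∈ (I : Set ℝ) \ N then v t x else 0, |C|, ⟨?_, ?_, ?_, ?_⟩, ?_⟩
  · have hs : MeasurableSet (((I : Set ℝ) \ N) ×ˢ (Set.univ : Set (Space n))) :=
      (I.isOpen.measurableSet.diff hNm).prod MeasurableSet.univ
    have h1 : (fun z : ℝ × Space n => if z.1 ∈ (I : Set ℝ) \ N then v z.1 z.2 else 0) =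
        Set.indicator (((I : Set ℝ) \ N) ×ˢ (Set.univ : Set (Space n)))
          (fun z : ℝ × Space n => v z.1 z.2) := by
      ext1 z
      simp [Set.indicator]
    rw [h1, aestronglyMeasurable_indicator_iff hs]
    exact hv.measurable.mono_measure (Measure.restrict_mono
      (Set.prod_mono_left Set.sdiff_subset) le_rfl)
  · intro t x
    split_ifs with h
    · exact ((hgood t h).1 x).trans (le_abs_self C)
    · simp
  · intro t x y
    split_ifs with h
    · refine ((hgood t h).2 x y).trans ?_
      gcongr
      exact le_abs_self C
    · rw [sub_zero, norm_zero]; positivity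
  · intro t γ hγ x
    split_ifs with h
    · exact hper t h.1 γ hγ x
    · rfl
  · have h1 : ∀ᵐ t, t ∉ N := measure_eq_zero_iff_ae_notMem.1 hN0
    filter_upwards [ae_restrict_of_ae h1, ae_restrict_mem I.isOpen.measurableSet] with t h2 h3 x
    rw [if_pos ⟨h3, h2⟩]

/-- The averages at scale `r` of a weak solution are Lipschitz in time. -/
lemma exists_ae_lipschitz_mol (hα : 0 < α) (hI : (I : Set ℝ).OrdConnected)
    (hE : IsPairedEulerSolution v p) (hv : IsUniformlyHolder Γ α C v)
    {P : ℝ → Space n → ℝ} {C' : ℝ} (hP : IsUniformlyHolder Γ α C' P)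
    (hp : ∀ φ : 𝓓(slab n I, ℝ), p φ = ∫ z : ℝ × Space n, P z.1 z.2 * φ z) (hκ : IsKernel κ) :
    ∃ M, 0 ≤ M ∧ ∀ r : ℝ, 0 < r → ∃ S : Set ℝ, (∀ᵐ t, t ∈ S) ∧ ∀ s ∈ I, ∀ t ∈ I, s ∈ S → t ∈ S →
      ∀ l x, |mol κ r (fun y => v s y l) x - mol κ r (fun y => v t y l) x| ≤
        M * r ^ (α - 1) * |s - t| := by
  have hC' := hP.nonneg
  have hm : ∀ l, 0 ≤ ∑ j, absMoment α (pd j κ) * (2 * C ^ 2) + absMoment α (pd l κ) * C' :=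
    fun l => add_nonneg (Finset.sum_nonneg fun j _ => mul_nonneg (absMoment_nonneg _ _)
      (by positivity)) (mul_nonneg (absMoment_nonneg _ _) hC')
  refine ⟨∑ l, (∑ j, absMoment α (pd j κ) * (2 * C ^ 2) + absMoment α (pd l κ) * C'),
    Finset.sum_nonneg fun l _ => hm l, fun r hr => ?_⟩
  set M := ∑ l, (∑ j, absMoment α (pd j κ) * (2 * C ^ 2) + absMoment α (pd l κ) * C') with hM
  have hS : ∀ (l : Fin n) (x : Space n), ∃ S : Set ℝ, (∀ᵐ t, t ∈ S) ∧ ∀ s ∈ I, ∀ t ∈ I, s ∈ S →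
      t ∈ S → |mol κ r (fun y => v s y l) x - mol κ r (fun y => v t y l) x| ≤
        M * r ^ (α - 1) * |s - t| := by
    intro l x
    refine ae_lipschitz_of_weak_derivative hI
      (aestronglyMeasurable_mol_time (F := fun s y => v s y l) hκ hr.ne'
        (hv.apply l).aestronglyMeasurable x)
      (fun t => norm_mol_le hκ.integrable ((hv.apply l).bound t) x) fun η hη hηc hηI => ?_
    -- The weak time derivative is `r⁻¹` times averages with weights `∂ⱼκ` of mean zero, each
    -- `O(r^α)`; hence the Lipschitz constant `M r^(α-1)`.
    rw [integral_deriv_mul_mol hE hv hP hp hκ hr.ne' hη hηc hηI, ← integral_const_mul,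
      ← Real.norm_eq_abs]
    have hηi : Integrable η := hη.continuous.integrable_of_hasCompactSupport hηc
    refine norm_integral_le_of_norm_le (hηi.abs.const_mul _) (Eventually.of_forall fun s => ?_)
    rw [norm_mul, mul_comm, Real.norm_eq_abs (η s)]
    refine mul_le_mul_of_nonneg_right ?_ (abs_nonneg _)
    rw [norm_mul, norm_inv, Real.norm_eq_abs r, abs_of_pos hr, Real.rpow_sub_one hr.ne']
    have h1 : ‖∑ j, mol (pd j κ) r (fun y => v s y j * v s y l) x + mol (pd l κ) r (P s) x‖ ≤
        (∑ j, absMoment α (pd j κ) * (2 * C ^ 2) + absMoment α (pd l κ) * C') * r ^ α := by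
      rw [add_mul, Finset.sum_mul]
      refine (norm_add_le _ _).trans (add_le_add (norm_sum_le_of_le _ fun j _ => ?_) ?_)
      · have := norm_mol_le_of_holder (r := r) (hκ.pd j) (hκ.integral_pd j) hα.le
          (((hv.apply j).mul (hv.apply l)).continuous hα s)
          (((hv.apply j).mul (hv.apply l)).holder s) x
        rw [abs_of_pos hr] at this
        linarith
      · have := norm_mol_le_of_holder (r := r) (hκ.pd l) (hκ.integral_pd l) hα.le
          (hP.continuous hα s) (hP.holder s) x
        rw [abs_of_pos hr] at this
        linarith
    have h2 : (∑ j, absMoment α (pd j κ) * (2 * C ^ 2) + absMoment α (pd l κ) * C') ≤ M :=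
      Finset.single_le_sum (f := fun l => ∑ j, absMoment α (pd j κ) * (2 * C ^ 2) +
        absMoment α (pd l κ) * C') (fun l _ => hm l) (Finset.mem_univ l)
    calc r⁻¹ * _ ≤ r⁻¹ * (M * r ^ α) := by gcongr; exact h1.trans (by gcongr)
      _ = M * (r ^ α / r) := by ring
  choose S hS1 hS2 using hS
  -- The exceptional null set depends on `x`. Countably many points suffice, because the averages
  -- are continuous in `x`.
  obtain ⟨D, hDc, hDd⟩ := TopologicalSpace.exists_countable_dense (Space n)
  refine ⟨{t | ∀ l, ∀ x ∈ D, t ∈ S l x}, ?_, ?_⟩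
  · exact ae_all_iff.2 fun l => (ae_ball_iff hDc).2 fun x _ => hS1 l x
  · intro s hs t ht hsS htS l x
    have hcont : Continuous fun x =>
        |mol κ r (fun y => v s y l) x - mol κ r (fun y => v t y l) x| :=
      ((continuous_mol hκ ((hv.apply l).continuous hα s)).sub
        (continuous_mol hκ ((hv.apply l).continuous hα t))).abs
    have hcl : IsClosed {x | |mol κ r (fun y => v s y l) x - mol κ r (fun y => v t y l) x| ≤
        M * r ^ (α - 1) * |s - t|} := isClosed_le hcont continuous_const
    have := hcl.closure_subset_iff.2 (fun x hx => hS2 l x s hs t ht (hsS l x hx) (htS l x hx))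
    exact this (hDd x)

/-- A weak solution is Hölder continuous in time, up to a null set of times. -/
lemma exists_ae_holder_time (hα : 0 < α) (hα1 : α < 1) (hI : (I : Set ℝ).OrdConnected)
    (hE : IsPairedEulerSolution v p) (hv : IsUniformlyHolder Γ α C v)
    {P : ℝ → Space n → ℝ} {C' : ℝ} (hP : IsUniformlyHolder Γ α C' P)
    (hp : ∀ φ : 𝓓(slab n I, ℝ), p φ = ∫ z : ℝ × Space n, P z.1 z.2 * φ z) (hρ : IsKernel ρ)
    (hρ1 : ∫ y, ρ y = 1) :
    ∃ (B : ℝ) (S : Set ℝ), 0 ≤ B ∧ (∀ᵐ t, t ∈ S) ∧ ∀ s ∈ I, ∀ t ∈ I, s ∈ S → t ∈ S →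
      ∀ l x, |v s x l - v t x l| ≤ B * |s - t| ^ α := by
  obtain ⟨M, hM, h⟩ := exists_ae_lipschitz_mol hα hI hE hv hP hp hρ
  -- Only dyadic scales are used, so the exceptional sets are countable in number.
  choose S hS1 hS2 using fun m : ℕ => h ((1 / 2 : ℝ) ^ m) (by positivity)
  have hC := hv.nonneg
  have hmom := absMoment_nonneg α ρ
  refine ⟨2 * C + (4 * (absMoment α ρ * C) + M), {t | ∀ m, t ∈ S m}, by positivity,
    ae_all_iff.2 hS1, fun s hs t ht hsS htS l x => ?_⟩
  have hd0 : 0 ≤ |s - t| ^ α := by positivity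
  rcases le_or_gt 1 |s - t| with hd | hd
  · have h1 : 1 ≤ |s - t| ^ α := Real.one_le_rpow hd hα.le
    have h2 := (hv.apply l).bound s x
    have h3 := (hv.apply l).bound t x
    have h4 := abs_sub (v s x l) (v t x l)
    rw [Real.norm_eq_abs] at h2 h3
    have h5 : 0 ≤ (4 * (absMoment α ρ * C) + M) * |s - t| ^ α := by positivity
    nlinarith
  rcases (abs_nonneg (s - t)).eq_or_lt with hd' | hd'
  · have : s = t := by rwa [eq_comm, abs_eq_zero, sub_eq_zero] at hd'
    rw [this, sub_self, abs_zero]; positivity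
  -- The scale satisfies `r/2 < |s - t| ≤ r`. This balances the approximation error `r^α` against
  -- the Lipschitz bound `r^(α-1) |s - t|`.
  obtain ⟨m, hm1, hm2⟩ := exists_nat_pow_near_of_lt_one hd' hd.le
    (by norm_num : (0 : ℝ) < 1 / 2) (by norm_num)
  set r : ℝ := (1 / 2) ^ m with hr
  have hr0 : 0 < r := by positivity
  have h1 : ∀ u : ℝ, |mol ρ r (fun y => v u y l) x - v u x l| ≤
      absMoment α ρ * (C * r ^ α) := by
    intro u
    have := norm_mol_sub_le (r := r) hρ hα.le ((hv.apply l).continuous hα u)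
      ((hv.apply l).holder u) x
    rwa [hρ1, one_smul, abs_of_pos hr0] at this
  have h2 := hS2 m s hs t ht (hsS m) (htS m) l x
  have h3 : r ^ α ≤ 2 * |s - t| ^ α := by
    have e : r ≤ 2 * |s - t| := by rw [pow_succ] at hm1; linarith
    calc r ^ α ≤ (2 * |s - t|) ^ α := by gcongr
      _ = 2 ^ α * |s - t| ^ α := Real.mul_rpow (by norm_num) (abs_nonneg _)
      _ ≤ 2 * |s - t| ^ α := by
        gcongr
        simpa using Real.rpow_le_rpow_of_exponent_le (x := (2 : ℝ)) (by norm_num) hα1.le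
  have h4 : r ^ (α - 1) * |s - t| ≤ |s - t| ^ α := by
    have : r ^ (α - 1) ≤ |s - t| ^ (α - 1) :=
      Real.rpow_le_rpow_of_nonpos hd' hm2 (by linarith)
    calc r ^ (α - 1) * |s - t| ≤ |s - t| ^ (α - 1) * |s - t| := by gcongr
      _ = |s - t| ^ α := by rw [Real.rpow_sub_one hd'.ne']; field_simp
  have h5 : |v s x l - v t x l| ≤ 2 * (absMoment α ρ * (C * r ^ α)) +
      M * r ^ (α - 1) * |s - t| := by
    have e : v s x l - v t x l = -(mol ρ r (fun y => v s y l) x - v s x l) +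
      (mol ρ r (fun y => v s y l) x - mol ρ r (fun y => v t y l) x) +
      (mol ρ r (fun y => v t y l) x - v t x l) := by ring
    rw [e]
    refine (abs_add_three _ _ _).trans ?_
    rw [abs_neg]
    linarith [h1 s, h1 t]
  refine h5.trans ?_
  have h6 : absMoment α ρ * (C * r ^ α) ≤ absMoment α ρ * (C * (2 * |s - t| ^ α)) := by gcongr
  have h7 : M * r ^ (α - 1) * |s - t| ≤ M * |s - t| ^ α := by rw [mul_assoc]; gcongr
  have h8 : 0 ≤ C * |s - t| ^ α := by positivity
  nlinarith

end Versions

/-! ### The version that is Hölder continuous in space and time -/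

section HolderVersion

variable {n : ℕ} {I : Opens ℝ} {Γ : Submodule ℤ (Space n)} {ν : Measure (Space n)}
  {K : Set (Space n)} {α C : ℝ} {v w : ℝ → Space n → Space n} {p : 𝓓'(slab n I, ℝ)}
  {ρ ψ κ : Space n → ℝ}

/-- McShane extension in time of a function that is uniformly Hölder continuous in space. -/
lemma exists_holder_extension {T : Set ℝ} {f : ℝ → Space n → ℝ} {B : ℝ} (hα : 0 < α)
    (hα1 : α ≤ 1) (hB : 0 ≤ B) (hf : ∀ t x, |f t x| ≤ C)
    (hfx : ∀ t x y, |f t x - f t y| ≤ C * ‖x - y‖ ^ α)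
    (hft : ∀ s ∈ T, ∀ t ∈ T, ∀ x, |f s x - f t x| ≤ B * |s - t| ^ α) (hT : T.Nonempty) :
    ∃ g : ℝ → Space n → ℝ, (∀ t x, |g t x| ≤ C) ∧
      (∀ t t' x x', |g t x - g t' x'| ≤ C * ‖x - x'‖ ^ α + B * |t - t'| ^ α) ∧
      (∀ t ∈ T, ∀ x, g t x = f t x) ∧ ∀ x y, (∀ t, f t x = f t y) → ∀ t, g t x = g t y := by
  have : Nonempty T := hT.to_subtype
  -- The extension is the infimum of these over `s ∈ T`, capped at `C` to preserve the upper bound.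
  -- It depends on `x` only through `s ↦ f s x`, so periods of `f` are inherited.
  set a : ℝ → Space n → T → ℝ := fun t x s => f s x + B * |(s : ℝ) - t| ^ α with ha
  have hlow : ∀ t x s, -C ≤ a t x s := fun t x s => by
    have h1 : 0 ≤ B * |(s : ℝ) - t| ^ α := by positivity
    have := neg_le_of_abs_le (hf s x)
    simp only [ha]; linarith
  have hbdd : ∀ t x, BddBelow (Set.range (a t x)) := fun t x => ⟨-C, by
    rintro _ ⟨s, rfl⟩; exact hlow t x s⟩
  have hC : 0 ≤ C := (abs_nonneg _).trans (hf 0 0)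
  have hle : ∀ t t' x x', (⨅ s, a t x s) ≤ (⨅ s, a t' x' s) +
      (C * ‖x - x'‖ ^ α + B * |t - t'| ^ α) := by
    intro t t' x x'
    rw [← sub_le_iff_le_add]
    refine le_ciInf fun s => ?_
    have h1 := ciInf_le (hbdd t x) s
    have h2 := le_of_abs_le (hfx s x x')
    have h3 : |(s : ℝ) - t| ^ α ≤ |(s : ℝ) - t'| ^ α + |t - t'| ^ α := by
      refine le_trans ?_ (Real.rpow_add_le_add_rpow (abs_nonneg _) (abs_nonneg _) hα.le hα1)
      refine Real.rpow_le_rpow (abs_nonneg _) ?_ hα.le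
      have := abs_sub_le (s : ℝ) t' t
      rwa [abs_sub_comm t' t] at this
    have h4 := mul_le_mul_of_nonneg_left h3 hB
    simp only [ha] at h1 ⊢
    linarith
  refine ⟨fun t x => (⨅ s, a t x s) ⊓ C, fun t x => ?_, fun t t' x x' => ?_, fun t ht x => ?_,
    fun x y hxy t => ?_⟩
  · exact abs_le.2 ⟨le_inf (le_ciInf (hlow t x)) (by linarith), inf_le_right⟩
  · refine (abs_inf_sub_inf_le_abs _ _ _).trans (abs_sub_le_iff.2 ⟨?_, ?_⟩)
    · linarith [hle t t' x x']
    · have := hle t' t x' x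
      rw [norm_sub_rev, abs_sub_comm] at this
      linarith
  · have h1 : (⨅ s, a t x s) = f t x := by
      refine le_antisymm ?_ (le_ciInf fun s => ?_)
      · refine (ciInf_le (hbdd t x) ⟨t, ht⟩).trans ?_
        simp [ha, Real.zero_rpow hα.ne']
      · have := le_of_abs_le (hft t ht s s.2 x)
        rw [abs_sub_comm] at this
        simp only [ha]; linarith
    show (⨅ s, a t x s) ⊓ C = f t x
    rw [h1]
    exact inf_eq_left.2 (le_of_abs_le (hf t x))
  · simp only [ha, hxy]

lemma continuousOn_of_holder {F : Type*} [NormedAddCommGroup F] {f : ℝ → Space n → F}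
    (hα : 0 < α) (h : ∀ t ∈ I, ∀ t' ∈ I, ∀ x x',
      ‖f t x - f t' x'‖ ≤ C * (|t - t'| + ‖x - x'‖) ^ α) :
    ContinuousOn (fun z : ℝ × Space n => f z.1 z.2) (slab n I : Set (ℝ × Space n)) := by
  intro z hz
  rw [ContinuousWithinAt, tendsto_iff_norm_sub_tendsto_zero]
  have h1 : Tendsto (fun y : ℝ × Space n => C * (|y.1 - z.1| + ‖y.2 - z.2‖) ^ α) (𝓝 z)
      (𝓝 (C * (|z.1 - z.1| + ‖z.2 - z.2‖) ^ α)) := by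
    refine Continuous.tendsto (f := fun y : ℝ × Space n =>
      C * (|y.1 - z.1| + ‖y.2 - z.2‖) ^ α) ?_ z
    have : Continuous fun y : ℝ × Space n => |y.1 - z.1| + ‖y.2 - z.2‖ := by fun_prop
    exact continuous_const.mul (this.rpow_const fun _ => Or.inr hα.le)
  rw [sub_self, sub_self, norm_zero, abs_zero, add_zero, Real.zero_rpow hα.ne', mul_zero] at h1
  refine squeeze_zero' (Eventually.of_forall fun _ => norm_nonneg _) ?_
    (h1.mono_left nhdsWithin_le_nhds)
  filter_upwards [self_mem_nhdsWithin] with y hy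
  exact h y.1 hy.1 z.1 hz.1 y.2 z.2

lemma aestronglyMeasurable_of_continuousOn_slab {F : Type*} [NormedAddCommGroup F]
    [SecondCountableTopology F] {f : ℝ → Space n → F}
    (hf : ContinuousOn (fun z : ℝ × Space n => f z.1 z.2) (slab n I : Set (ℝ × Space n)))
    (h0 : ∀ t ∉ I, ∀ x, f t x = 0) :
    AEStronglyMeasurable (fun z : ℝ × Space n => f z.1 z.2) volume := by
  have hm : MeasurableSet (slab n I : Set (ℝ × Space n)) := (slab n I).isOpen.measurableSet
  have h1 : (fun z : ℝ × Space n => f z.1 z.2) =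
      Set.indicator (slab n I : Set (ℝ × Space n)) (fun z : ℝ × Space n => f z.1 z.2) := by
    ext1 z
    rw [eq_comm, Set.indicator_apply_eq_self]
    intro hz
    exact h0 z.1 (fun h => hz ⟨h, Set.mem_univ _⟩) z.2
  rw [h1, aestronglyMeasurable_indicator_iff hm]
  exact hf.aestronglyMeasurable hm

lemma exists_mem_inter_of_ae (hne : (I : Set ℝ).Nonempty) {S : Set ℝ} (hS : ∀ᵐ t, t ∈ S) :
    ((I : Set ℝ) ∩ S).Nonempty := by
  by_contra h
  rw [Set.not_nonempty_iff_eq_empty] at h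
  have h1 : (I : Set ℝ) ⊆ Sᶜ := fun t ht hts => by
    have : t ∈ (I : Set ℝ) ∩ S := ⟨ht, hts⟩
    rw [h] at this; exact this
  exact (I.isOpen.measure_pos volume hne).ne' (measure_mono_null h1 (ae_iff.1 hS))

/-- A weak solution in `L^∞_t C^α_x` has a version in `C^α_{t,x}`. -/
lemma exists_holder_version (hα : 0 < α) (hα1 : α < 1) (hI : (I : Set ℝ).OrdConnected)
    (hE : IsPairedEulerSolution v p) (hv : IsUniformlyHolder Γ α C v)
    {P : ℝ → Space n → ℝ} {C' : ℝ} (hP : IsUniformlyHolder Γ α C' P)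
    (hp : ∀ φ : 𝓓(slab n I, ℝ), p φ = ∫ z : ℝ × Space n, P z.1 z.2 * φ z) (hρ : IsKernel ρ)
    (hρ1 : ∫ y, ρ y = 1) :
    ∃ (V : ℝ → Space n → Space n) (B : ℝ), IsUniformlyHolder Γ α B V ∧
      (∀ t ∈ I, ∀ t' ∈ I, ∀ x x', ‖V t x - V t' x'‖ ≤ B * (|t - t'| + ‖x - x'‖) ^ α) ∧
      ∀ᵐ t ∂(volume.restrict (I : Set ℝ)), ∀ x, v t x = V t x := by
  classical
  obtain ⟨B, S, hB, hS, hSB⟩ := exists_ae_holder_time hα hα1 hI hE hv hP hp hρ hρ1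
  -- The extension is an infimum over `I ∩ S`, which must be nonempty; the empty interval is
  -- trivial.
  rcases (I : Set ℝ).eq_empty_or_nonempty with hempty | hne
  · have hIe : ∀ t, t ∉ I := fun t ht => by
      have : t ∈ (I : Set ℝ) := ht
      rw [hempty] at this; exact this
    refine ⟨v, C, hv, fun t ht => absurd ht (hIe t), ?_⟩
    rw [hempty]; simp
  have hT := exists_mem_inter_of_ae hne hS
  choose g hg1 hg2 hg3 hg4 using fun l : Fin n => exists_holder_extension (T := (I : Set ℝ) ∩ S)
    (f := fun t x => v t x l) hα hα1.le hB (hv.apply l).bound (hv.apply l).holder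
    (fun s hs t ht x => hSB s hs.1 t ht.1 hs.2 ht.2 l x) hT
  have hC := hv.nonneg
  -- Setting `V` to zero outside `I` reduces measurability to continuity on the slab.
  set V : ℝ → Space n → Space n := fun t x =>
    if t ∈ I then WithLp.toLp 2 (fun l => g l t x) else 0 with hV
  have hVI : ∀ t ∈ I, ∀ x l, V t x l = g l t x := fun t ht x l => by simp [hV, ht]
  have hV0 : ∀ t ∉ I, ∀ x, V t x = 0 := fun t ht x => by simp [hV, ht]
  have hV1 : ∀ t ∈ I, ∀ t' ∈ I, ∀ x x',
      ‖V t x - V t' x'‖ ≤ n * (C * ‖x - x'‖ ^ α + B * |t - t'| ^ α) := by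
    intro t ht t' ht' x x'
    refine norm_le_of_forall_abs_le fun l => ?_
    rw [PiLp.sub_apply, hVI t ht, hVI t' ht']
    exact hg2 l t t' x x'
  have hV2 : ∀ t ∈ I, ∀ t' ∈ I, ∀ x x',
      ‖V t x - V t' x'‖ ≤ n * (C + B) * (|t - t'| + ‖x - x'‖) ^ α := by
    intro t ht t' ht' x x'
    refine (hV1 t ht t' ht' x x').trans ?_
    have h1 : ‖x - x'‖ ^ α ≤ (|t - t'| + ‖x - x'‖) ^ α :=
      Real.rpow_le_rpow (norm_nonneg _) (by linarith [abs_nonneg (t - t')]) hα.le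
    have h2 : |t - t'| ^ α ≤ (|t - t'| + ‖x - x'‖) ^ α :=
      Real.rpow_le_rpow (abs_nonneg _) (by linarith [norm_nonneg (x - x')]) hα.le
    rw [mul_assoc, add_mul]
    gcongr
  have hCB : 0 ≤ (n : ℝ) * (C + B) := by positivity
  refine ⟨V, n * (C + B), ⟨?_, ?_, ?_, ?_⟩, hV2, ?_⟩
  · exact aestronglyMeasurable_of_continuousOn_slab (continuousOn_of_holder hα hV2) hV0
  · intro t x
    by_cases ht : t ∈ I
    · refine norm_le_of_forall_abs_le fun l => ?_
      rw [hVI t ht]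
      exact (hg1 l t x).trans (by linarith)
    · rw [hV0 t ht, norm_zero]; exact hCB
  · intro t x y
    by_cases ht : t ∈ I
    · simpa using hV2 t ht t ht x y
    · rw [hV0 t ht, hV0 t ht, sub_zero, norm_zero]; positivity
  · intro t γ hγ x
    by_cases ht : t ∈ I
    · ext l
      rw [hVI t ht, hVI t ht]
      exact hg4 l _ _ (fun s => (hv.apply l).periodic s γ hγ x) t
    · rw [hV0 t ht, hV0 t ht]
  · filter_upwards [ae_restrict_of_ae hS, ae_restrict_mem I.isOpen.measurableSet] with t h2 h3 x
    ext l
    rw [hVI t h3]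
    exact (hg3 l t ⟨h3, h2⟩ x).symm

/-- A field that is continuous in time and agrees at almost every time with a continuous one agrees
with it at all times. -/
lemma eq_of_ae_eq_of_continuousOn (hV : ∀ x, ContinuousOn (fun t => w t x) (I : Set ℝ))
    (hv : ∀ x, ContinuousOn (fun t => v t x) (I : Set ℝ))
    (h : ∀ᵐ t ∂(volume.restrict (I : Set ℝ)), ∀ x, v t x = w t x) :
    ∀ t ∈ I, ∀ x, v t x = w t x := by
  intro t ht x
  have h1 : (fun t => v t x) =ᵐ[volume.restrict (I : Set ℝ)] fun t => w t x := by
    filter_upwards [h] with t ht using ht x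
  exact Measure.eqOn_open_of_ae_eq h1 I.isOpen (hv x) (hV x) ht

end HolderVersion

/-! ### Interpolation of Hölder seminorms -/

section Interpolation

variable {n : ℕ} {s s' X d : ℝ} {f : Space n → ℝ}

/-- Interpolation between the supremum and a Hölder seminorm. -/
lemma abs_sub_le_of_interpolation (hs' : 0 ≤ s') (hs : s' ≤ s) (hd : 0 ≤ d)
    (hb : ∀ x, |f x| ≤ X * d ^ s) (hf : ∀ x y, |f x - f y| ≤ 2 * X * ‖x - y‖ ^ s) (hX : 0 ≤ X)
    (x y : Space n) : |f x - f y| ≤ 2 * X * d ^ (s - s') * ‖x - y‖ ^ s' := by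
  have e : ∀ c : ℝ, 0 ≤ c → c ^ s = c ^ (s - s') * c ^ s' := fun c hc => by
    rw [← Real.rpow_add_of_nonneg hc (sub_nonneg.2 hs) hs', sub_add_cancel]
  rcases le_total ‖x - y‖ d with h | h
  · refine (hf x y).trans ?_
    rw [e _ (norm_nonneg _), ← mul_assoc]
    gcongr
  · have h1 : |f x - f y| ≤ 2 * X * d ^ s := by
      have := abs_sub (f x) (f y)
      linarith [hb x, hb y]
    refine h1.trans ?_
    rw [e _ hd, ← mul_assoc]
    gcongr

end Interpolation

/-! ### Functions varying at a given scale in space and time -/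

section Scaled

variable {n : ℕ} {I : Opens ℝ} {Γ : Submodule ℤ (Space n)} {ν : Measure (Space n)}
  {K : Set (Space n)} {θ A B lam ε : ℝ} {f g : ℝ → Space n → ℝ} {κ : Space n → ℝ}

/-- Periodic functions on `I × ℝⁿ` that are bounded by `A` and vary at the scale `lam`, in the sense
of the joint Hölder seminorm of exponent `θ`. -/
structure IsScaled (Γ : Submodule ℤ (Space n)) (I : Opens ℝ) (θ A lam : ℝ)
    (f : ℝ → Space n → ℝ) : Prop where
  nonneg : 0 ≤ A
  bound : ∀ t ∈ I, ∀ x, |f t x| ≤ A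
  holder : ∀ t ∈ I, ∀ t' ∈ I, ∀ x x',
    |f t x - f t' x'| ≤ A * lam ^ (-θ) * (|t - t'| + ‖x - x'‖) ^ θ
  periodic : ∀ t ∈ I, ∀ γ ∈ Γ, ∀ x, f t (x + γ) = f t x

namespace IsScaled

lemma mono (h : IsScaled Γ I θ A lam f) (hlam : 0 < lam) (hAB : A ≤ B) :
    IsScaled Γ I θ B lam f where
  nonneg := h.nonneg.trans hAB
  bound t ht x := (h.bound t ht x).trans hAB
  holder t ht t' ht' x x' := (h.holder t ht t' ht' x x').trans (by gcongr)
  periodic := h.periodic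

lemma add (hf : IsScaled Γ I θ A lam f) (hg : IsScaled Γ I θ B lam g) :
    IsScaled Γ I θ (A + B) lam (fun t x => f t x + g t x) where
  nonneg := add_nonneg hf.nonneg hg.nonneg
  bound t ht x := (abs_add_le _ _).trans (add_le_add (hf.bound t ht x) (hg.bound t ht x))
  holder t ht t' ht' x x' := by
    rw [add_sub_add_comm, add_mul, add_mul]
    exact (abs_add_le _ _).trans (add_le_add (hf.holder t ht t' ht' x x') (hg.holder t ht t' ht' x x'))
  periodic t ht γ hγ x := by rw [hf.periodic t ht γ hγ, hg.periodic t ht γ hγ]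

lemma const_mul (hf : IsScaled Γ I θ A lam f) (c : ℝ) :
    IsScaled Γ I θ (|c| * A) lam (fun t x => c * f t x) where
  nonneg := mul_nonneg (abs_nonneg c) hf.nonneg
  bound t ht x := by rw [abs_mul]; gcongr; exact hf.bound t ht x
  holder t ht t' ht' x x' := by
    rw [← mul_sub, abs_mul, mul_assoc, mul_assoc]
    gcongr
    rw [← mul_assoc]
    exact hf.holder t ht t' ht' x x'
  periodic t ht γ hγ x := by rw [hf.periodic t ht γ hγ]

lemma zero : IsScaled Γ I θ 0 lam (fun _ _ => 0) where
  nonneg := le_rfl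
  bound _ _ _ := by simp
  holder _ _ _ _ _ _ := by simp
  periodic _ _ _ _ _ := rfl

lemma sum {ι : Type*} (s : Finset ι) {f : ι → ℝ → Space n → ℝ} {A : ι → ℝ}
    (h : ∀ i, IsScaled Γ I θ (A i) lam (f i)) :
    IsScaled Γ I θ (∑ i ∈ s, A i) lam (fun t x => ∑ i ∈ s, f i t x) := by
  classical
  induction s using Finset.induction_on with
  | empty => simpa using zero
  | insert a s ha ih =>
    simp only [Finset.sum_insert ha]
    exact (h a).add ih

lemma mul (hf : IsScaled Γ I θ A lam f) (hg : IsScaled Γ I θ B lam g) (hlam : 0 < lam) :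
    IsScaled Γ I θ (2 * (A * B)) lam (fun t x => f t x * g t x) where
  nonneg := by have := hf.nonneg; have := hg.nonneg; positivity
  bound t ht x := by
    rw [abs_mul]
    have := mul_le_mul (hf.bound t ht x) (hg.bound t ht x) (abs_nonneg _) hf.nonneg
    have := mul_nonneg hf.nonneg hg.nonneg
    linarith
  holder t ht t' ht' x x' := by
    have e : f t x * g t x - f t' x' * g t' x' =
        (f t x - f t' x') * g t x + f t' x' * (g t x - g t' x') := by ring
    rw [e]
    refine (abs_add_le _ _).trans ?_
    rw [abs_mul, abs_mul]
    have hA := hf.nonneg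
    have h1 := mul_le_mul (hf.holder t ht t' ht' x x') (hg.bound t ht x) (abs_nonneg _)
      (by positivity)
    have h2 := mul_le_mul (hf.bound t' ht' x') (hg.holder t ht t' ht' x x') (abs_nonneg _) hA
    linarith
  periodic t ht γ hγ x := by rw [hf.periodic t ht γ hγ, hg.periodic t ht γ hγ]

lemma congr (hf : IsScaled Γ I θ A lam f) (h : ∀ t ∈ I, ∀ x, f t x = g t x) :
    IsScaled Γ I θ A lam g where
  nonneg := hf.nonneg
  bound t ht x := by rw [← h t ht]; exact hf.bound t ht x
  holder t ht t' ht' x x' := by rw [← h t ht, ← h t' ht']; exact hf.holder t ht t' ht' x x'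
  periodic t ht γ hγ x := by rw [← h t ht, ← h t ht]; exact hf.periodic t ht γ hγ x

/-- Functions that are Lipschitz at scale `lam` are Hölder at scale `lam` for all exponents. -/
lemma of_lipschitz (hθ : 0 ≤ θ) (hθ1 : θ ≤ 1) (hlam : 0 < lam) (hA : 0 ≤ A)
    (hb : ∀ t ∈ I, ∀ x, |f t x| ≤ A)
    (hL : ∀ t ∈ I, ∀ t' ∈ I, ∀ x x', |f t x - f t' x'| ≤ A / lam * (|t - t'| + ‖x - x'‖))
    (hper : ∀ t ∈ I, ∀ γ ∈ Γ, ∀ x, f t (x + γ) = f t x) : IsScaled Γ I θ (2 * A) lam f where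
  nonneg := by positivity
  bound t ht x := (hb t ht x).trans (by linarith)
  holder t ht t' ht' x x' := by
    set d := |t - t'| + ‖x - x'‖ with hd
    have hd0 : 0 ≤ d := by positivity
    have e : lam ^ (-θ) * d ^ θ = (d / lam) ^ θ := by
      rw [Real.div_rpow hd0 hlam.le, Real.rpow_neg hlam.le]; field_simp
    rw [mul_assoc, e]
    rcases le_total 1 (d / lam) with h | h
    · have h1 := Real.one_le_rpow h hθ
      have h2 := abs_sub (f t x) (f t' x')
      have h3 := hb t ht x
      have h4 := hb t' ht' x'
      nlinarith
    · have h1 : d / lam ≤ (d / lam) ^ θ := by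
        simpa using Real.rpow_le_rpow_of_exponent_ge' (by positivity) h hθ hθ1
      have h2 := hL t ht t' ht' x x'
      have h3 : A / lam * d = A * (d / lam) := by ring
      rw [h3] at h2
      have h4 : 0 ≤ (d / lam) ^ θ := by positivity
      nlinarith
  periodic := hper

lemma slice (hf : IsScaled Γ I θ A lam f) {t : ℝ} (ht : t ∈ I) (x y : Space n) :
    |f t x - f t y| ≤ A * lam ^ (-θ) * ‖x - y‖ ^ θ := by
  simpa using hf.holder t ht t ht x y

lemma continuous (hf : IsScaled Γ I θ A lam f) (hθ : 0 < θ) (hlam : 0 < lam) {t : ℝ}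
    (ht : t ∈ I) : Continuous (f t) := by
  have hA := hf.nonneg
  have h : IsPeriodicHolder Γ θ (A + A * lam ^ (-θ)) (f t) :=
    ⟨fun x => (hf.bound t ht x).trans (by
      have : 0 ≤ A * lam ^ (-θ) := by positivity
      linarith), fun x y => (hf.slice ht x y).trans (by
      refine mul_le_mul_of_nonneg_right ?_ (by positivity)
      linarith), hf.periodic t ht⟩
  exact h.continuous hθ

/-- The slices of a function that varies at the scale `lam`, for a smaller exponent. -/
lemma isPeriodicHolder (hf : IsScaled Γ I θ A lam f) (hε : 0 ≤ ε) (hεθ : ε ≤ θ)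
    (hlam : 0 < lam) (hlam1 : lam ≤ 1) {t : ℝ} (ht : t ∈ I) :
    IsPeriodicHolder Γ ε (2 * (A * lam ^ (-ε))) (f t) where
  bound x := by
    have h1 : 1 ≤ lam ^ (-ε) := Real.one_le_rpow_of_pos_of_le_one_of_nonpos hlam hlam1 (by linarith)
    have := hf.bound t ht x
    have := hf.nonneg
    nlinarith
  holder x y := by
    have hA := hf.nonneg
    have h := abs_sub_le_of_interpolation (f := f t) (X := A * lam ^ (-θ)) (d := lam) hε hεθ hlam.le
      (fun x => by
        rw [mul_assoc, ← Real.rpow_add hlam, neg_add_cancel, Real.rpow_zero, mul_one]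
        exact hf.bound t ht x)
      (fun x y => (hf.slice ht x y).trans (by
        have : 0 ≤ A * lam ^ (-θ) * ‖x - y‖ ^ θ := by positivity
        linarith)) (by positivity) x y
    have e : 2 * (A * lam ^ (-θ)) * lam ^ (θ - ε) = 2 * (A * lam ^ (-ε)) := by
      rw [mul_assoc, mul_assoc, ← Real.rpow_add hlam]; congr 3; ring
    rwa [e] at h
  periodic := hf.periodic t ht

/-- Differences of translated slices of a function that varies at the scale `lam`. -/
lemma isPeriodicHolder_sub (hf : IsScaled Γ I θ A lam f) (hε : 0 ≤ ε) (hεθ : ε ≤ θ)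
    (hlam : 0 < lam) (hlam1 : lam ≤ 1) {t t' : ℝ} (ht : t ∈ I) (ht' : t' ∈ I) (h : Space n) :
    IsPeriodicHolder Γ ε (2 * (A * lam ^ (-θ)) * (|t - t'| + ‖h‖) ^ (θ - ε))
      (fun y => f t y - f t' (y + h)) := by
  have hA := hf.nonneg
  set d := |t - t'| + ‖h‖ with hd
  have hd0 : 0 ≤ d := by positivity
  have h1 : 1 ≤ lam ^ (-θ) :=
    Real.one_le_rpow_of_pos_of_le_one_of_nonpos hlam hlam1 (by linarith)
  have hX : 0 ≤ A * lam ^ (-θ) := by positivity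
  -- The difference is small in supremum norm, and its `θ`-seminorm is at most `2 A lam^(-θ)`.
  -- Interpolation trades part of the exponent for smallness in `d`.
  have hb : ∀ y, |f t y - f t' (y + h)| ≤ A * lam ^ (-θ) * d ^ θ := by
    intro y
    have := hf.holder t ht t' ht' y (y + h)
    simpa [hd] using this
  refine ⟨fun y => ?_, fun x y => ?_, fun γ hγ y => ?_⟩
  -- For `d ≥ 1` the bound `2A` is enough, since `lam ≤ 1`; for `d ≤ 1` the power `d^θ` is at most
  -- `d^(θ-ε)`.
  · rcases le_total 1 d with hd1 | hd1
    · have h2 : 1 ≤ d ^ (θ - ε) := Real.one_le_rpow hd1 (by linarith)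
      have h3 := abs_sub (f t y) (f t' (y + h))
      have h4 := hf.bound t ht y
      have h5 := hf.bound t' ht' (y + h)
      have h6 : A ≤ A * lam ^ (-θ) := le_mul_of_one_le_right hA h1
      nlinarith
    · have h2 : d ^ θ ≤ d ^ (θ - ε) := by
        rcases hd0.eq_or_lt with h0 | h0
        · rw [← h0]
          rcases hεθ.eq_or_lt with h3 | h3
          · rw [h3, sub_self, Real.rpow_zero]
            exact Real.zero_rpow_le_one θ
          · rw [Real.zero_rpow (by linarith), Real.zero_rpow (by linarith)]
        · exact Real.rpow_le_rpow_of_exponent_ge h0 hd1 (by linarith)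
      have h3 := mul_le_mul_of_nonneg_left h2 hX
      have h4 : 0 ≤ A * lam ^ (-θ) * d ^ (θ - ε) := by positivity
      linarith [hb y]
  · refine abs_sub_le_of_interpolation (f := fun y => f t y - f t' (y + h)) hε hεθ hd0 hb
      (fun x y => ?_) hX x y
    rw [sub_sub_sub_comm]
    have h2 := hf.slice ht x y
    have h3 := hf.slice ht' (x + h) (y + h)
    rw [add_sub_add_right_eq_sub] at h3
    have := abs_sub (f t x - f t y) (f t' (x + h) - f t' (y + h))
    linarith
  · rw [add_right_comm, hf.periodic t ht γ hγ, hf.periodic t' ht' γ hγ]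

end IsScaled

/-- Here `A` is the Hölder exponent and `B` the size. An increment of the average is the average of
`f t - f t' (· + h)`, whose `(A - θ)`-Hölder constant is a multiple of `d^θ`. Cancellation in the
weight then gives `lam^(A-θ) d^θ`, that is, size `lam^A` and variation at scale `lam`. -/
lemma isScaled_mol (hκ : IsKernel κ) (h0 : ∫ y, κ y = 0) (hf : IsScaled Γ I A B 1 f) (hA : 0 < A)
    (hθ : 0 ≤ θ) (hθA : θ ≤ A) (hlam : 0 < lam) :
    IsScaled Γ I θ ((absMoment A κ + 2 * absMoment (A - θ) κ) * B * lam ^ A) lam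
      (fun t => mol κ lam (f t)) := by
  have hB := hf.nonneg
  have m1 := absMoment_nonneg A κ
  have m2 := absMoment_nonneg (A - θ) κ
  have hc : ∀ t ∈ I, Continuous (f t) := fun t ht => hf.continuous hA one_pos ht
  refine ⟨by positivity, fun t ht x => ?_, fun t ht t' ht' x x' => ?_, fun t ht γ hγ x => ?_⟩
  · have := norm_mol_le_of_holder (r := lam) hκ h0 hA.le (hc t ht)
      (fun x y => by simpa using hf.slice ht x y) x
    rw [abs_of_pos hlam, Real.norm_eq_abs] at this
    have h1 : 0 ≤ absMoment (A - θ) κ * (B * lam ^ A) := by positivity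
    nlinarith
  · have hD := hf.isPeriodicHolder_sub (ε := A - θ) (by linarith) (by linarith) one_pos le_rfl ht ht'
      (x' - x)
    have h1 : mol κ lam (f t) x - mol κ lam (f t') x' =
        mol κ lam (fun y => f t y - f t' (y + (x' - x))) x := by
      have hct : Continuous fun y => f t' (y + (x' - x)) := (hc t' ht').comp (by fun_prop)
      rw [mol_sub hκ (hc t ht) hct, mol_translate]
      congr 2; abel
    rw [h1]
    have hcD : Continuous fun y => f t y - f t' (y + (x' - x)) :=
      (hc t ht).sub ((hc t' ht').comp (by fun_prop))
    have := norm_mol_le_of_holder (r := lam) hκ h0 (by linarith : 0 ≤ A - θ) hcD hD.holder x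
    rw [abs_of_pos hlam, Real.norm_eq_abs, norm_sub_rev, Real.one_rpow, mul_one, sub_sub_cancel]
      at this
    refine this.trans ?_
    have e : lam ^ (A - θ) = lam ^ A * lam ^ (-θ) := by rw [← Real.rpow_add hlam]; rfl
    rw [e]
    have h2 : 0 ≤ absMoment A κ * (B * (|t - t'| + ‖x - x'‖) ^ θ * (lam ^ A * lam ^ (-θ))) := by
      positivity
    nlinarith
  · rw [← mol_translate]
    congr 1; ext y
    exact hf.periodic t ht γ hγ y

/-- `czSum` commutes with translations and is bounded from `C^ε` to bounded functions. Applying this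
to the slices and to their translated differences costs `ε` in the exponent and a factor `lam^(-ε)`.
-/
lemma isScaled_czSum (hν : IsPeriodicMean Γ ν K) (hκ : IsKernel κ) (h0 : ∫ y, κ y = 0)
    (hf : IsScaled Γ I θ A lam f) (hε : 0 < ε) (hεθ : ε ≤ θ) (hlam : 0 < lam) (hlam1 : lam ≤ 1) :
    IsScaled Γ I (θ - ε) (2 * czConst ν ε κ * (A * lam ^ (-ε))) lam (fun t => czSum κ (f t)) := by
  have hA := hf.nonneg
  have m := czConst_nonneg ν ε κ
  refine ⟨by positivity, fun t ht x => ?_, fun t ht t' ht' x x' => ?_, fun t ht =>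
    czSum_periodic (hf.periodic t ht)⟩
  · have := abs_czSum_le hν hκ h0 hε (hf.isPeriodicHolder hε.le hεθ hlam hlam1 ht) x
    linarith
  · have hD := hf.isPeriodicHolder_sub hε.le hεθ hlam hlam1 ht ht' (x' - x)
    have h1 : czSum κ (f t) x - czSum κ (f t') x' =
        czSum κ (fun y => f t y - f t' (y + (x' - x))) x := by
      rw [czSum_sub hν hκ h0 hε (hf.isPeriodicHolder hε.le hεθ hlam hlam1 ht)
        ((hf.isPeriodicHolder hε.le hεθ hlam hlam1 ht').comp_add (x' - x)), czSum_translate]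
      congr 2; abel
    rw [h1]
    have := abs_czSum_le hν hκ h0 hε hD x
    rw [norm_sub_rev] at this
    refine this.trans (le_of_eq ?_)
    have e : lam ^ (-θ) = lam ^ (-ε) * lam ^ (-(θ - ε)) := by
      rw [← Real.rpow_add hlam]; congr 1; ring
    rw [e]; ring

end Scaled

/-! ### Classical derivatives from continuous weak ones -/

section ClassicalDerivative

lemma integral_deriv_mul_id {η : ℝ → ℝ} (hη : ContDiff ℝ ∞ η) (hηc : HasCompactSupport η) :
    ∫ t, deriv η t * t = - ∫ t, η t := by
  have hd : Continuous (deriv η) := hη.continuous_deriv (by simp)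
  have h := integral_mul_deriv_eq_deriv_mul_of_integrable (u := fun t : ℝ => t) (v := η)
    (u' := fun _ => 1) (v' := deriv η) (fun t _ => hasDerivAt_id t)
    (fun t _ => ((hη.differentiable (by simp)) t).hasDerivAt) ?_ ?_ ?_
  · simp only [one_mul] at h
    rw [← h]
    congr 1; ext t; ring
  · exact (continuous_id.mul hd).integrable_of_hasCompactSupport hηc.deriv.mul_left
  · exact (hη.continuous.integrable_of_hasCompactSupport hηc).congr
      (Eventually.of_forall fun t => (one_mul _).symm)
  · exact (continuous_id.mul hη.continuous).integrable_of_hasCompactSupport hηc.mul_left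

/-- A continuous function with a continuous weak derivative is differentiable. -/
lemma hasDerivAt_of_weak_derivative {I : Opens ℝ} {u G : ℝ → ℝ} {B B' : ℝ}
    (hu : AEStronglyMeasurable u volume) (hB : ∀ t, |u t| ≤ B)
    (hG : AEStronglyMeasurable G volume) (hB' : ∀ t, |G t| ≤ B')
    (huc : ContinuousOn u (I : Set ℝ)) (hGc : ContinuousOn G (I : Set ℝ))
    (h : ∀ η : ℝ → ℝ, ContDiff ℝ ∞ η → HasCompactSupport η → tsupport η ⊆ I →
      ∫ t, deriv η t * u t = ∫ t, η t * G t) {t₀ : ℝ} (ht₀ : t₀ ∈ I) :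
    HasDerivAt u (-G t₀) t₀ := by
  rw [hasDerivAt_iff_isLittleO, Asymptotics.isLittleO_iff]
  intro ε hε
  have hGa : ContinuousAt G t₀ := hGc.continuousAt (I.isOpen.mem_nhds ht₀)
  -- Near `t₀` the function `u + G(t₀) t` has a weak derivative bounded by `ε`, hence is
  -- `ε`-Lipschitz there. This is differentiability with derivative `-G(t₀)`, the sign reflecting
  -- the integration by parts in the hypothesis.
  obtain ⟨δ, hδ, hball⟩ := Metric.eventually_nhds_iff_ball.1
    ((Metric.continuousAt_iff'.1 hGa ε hε).and (I.isOpen.mem_nhds ht₀))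
  let J : Opens ℝ := ⟨Metric.ball t₀ δ, Metric.isOpen_ball⟩
  have hJI : (J : Set ℝ) ⊆ I := fun t ht => (hball t ht).2
  -- The cut-off keeps the linear term bounded on the whole line.
  set w : ℝ → ℝ := Set.indicator (J : Set ℝ) (fun t => u t + G t₀ * t) with hw
  have hwJ : ∀ t ∈ J, w t = u t + G t₀ * t := fun t ht => Set.indicator_of_mem ht _
  have hJc : (J : Set ℝ).OrdConnected := by
    show (Metric.ball t₀ δ).OrdConnected
    rw [Real.ball_eq_Ioo]; exact Set.ordConnected_Ioo
  have hwm : AEStronglyMeasurable w volume :=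
    (hu.add (by fun_prop : Continuous fun t : ℝ => G t₀ * t).aestronglyMeasurable).indicator
      J.isOpen.measurableSet
  have hwB : ∀ t, |w t| ≤ B + |G t₀| * (|t₀| + δ) := by
    intro t
    have hB0 : 0 ≤ B := (abs_nonneg _).trans (hB 0)
    by_cases ht : t ∈ (J : Set ℝ)
    · rw [hwJ t ht]
      refine (abs_add_le _ _).trans (add_le_add (hB t) ?_)
      rw [abs_mul]
      have h1 : |t - t₀| < δ := by rw [← Real.dist_eq]; exact ht
      have h2 : |t| ≤ |t₀| + δ := by
        have := abs_add_le (t - t₀) t₀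
        rw [sub_add_cancel] at this
        linarith
      gcongr
    · rw [hw, Set.indicator_of_notMem ht, abs_zero]; positivity
  obtain ⟨S, hS, hSL⟩ := ae_lipschitz_of_weak_derivative (L := ε) hJc hwm hwB fun η hη hηc hηJ => by
    have hηi : Integrable η := hη.continuous.integrable_of_hasCompactSupport hηc
    have hη'i : Integrable (deriv η) :=
      (hη.continuous_deriv (by simp)).integrable_of_hasCompactSupport hηc.deriv
    have e1 : ∀ t, deriv η t * w t = deriv η t * u t + G t₀ * (deriv η t * t) := by
      intro t
      by_cases ht : t ∈ tsupport η
      · rw [hwJ t (hηJ ht)]; ring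
      · have : deriv η t = 0 := image_eq_zero_of_notMem_tsupport
          (fun h' => ht (tsupport_deriv_subset h'))
        rw [this]; ring
    have i1 : Integrable (fun t => deriv η t * u t) :=
      (hη'i.bdd_mul hu (Eventually.of_forall hB)).congr (Eventually.of_forall fun t => mul_comm _ _)
    have i2 : Integrable (fun t => deriv η t * t) :=
      ((hη.continuous_deriv (by simp)).mul continuous_id).integrable_of_hasCompactSupport
        hηc.deriv.mul_right
    have i3 : Integrable (fun t => η t * G t) :=
      (hηi.bdd_mul hG (Eventually.of_forall hB')).congr (Eventually.of_forall fun t => mul_comm _ _)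
    simp only [e1]
    rw [integral_add i1 (i2.const_mul _), integral_const_mul, integral_deriv_mul_id hη hηc,
      h η hη hηc (hηJ.trans hJI)]
    have e3 : (∫ t, η t * G t) + G t₀ * -(∫ t, η t) = ∫ t, η t * (G t - G t₀) := by
      simp only [mul_sub]
      rw [integral_sub i3 (hηi.mul_const _), integral_mul_const]; ring
    rw [e3, ← Real.norm_eq_abs, ← integral_const_mul]
    refine norm_integral_le_of_norm_le (hηi.abs.const_mul ε) (Eventually.of_forall fun t => ?_)
    rw [norm_mul, mul_comm, Real.norm_eq_abs (η t)]
    by_cases ht : t ∈ tsupport η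
    · have := (hball t (hηJ ht)).1
      rw [Real.dist_eq] at this
      exact mul_le_mul_of_nonneg_right this.le (abs_nonneg _)
    · rw [image_eq_zero_of_notMem_tsupport ht]; simp
  have hwc : ContinuousOn w (J : Set ℝ) :=
    ((huc.mono hJI).add (by fun_prop)).congr hwJ
  filter_upwards [Metric.ball_mem_nhds t₀ hδ] with t ht
  have ht₀J : t₀ ∈ J := Metric.mem_ball_self hδ
  -- The good times are dense in `J` and `w` is continuous there, so the almost everywhere bound
  -- extends to all of `J`.
  have key : ∀ s ∈ J, ∀ t ∈ J, |w s - w t| ≤ ε * |s - t| := by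
    have hdense : ∀ s ∈ J, s ∈ closure ((J : Set ℝ) ∩ S) := by
      intro s hs
      rw [Metric.mem_closure_iff]
      intro r hr
      let J' : Opens ℝ := ⟨Metric.ball s r ∩ J, Metric.isOpen_ball.inter J.isOpen⟩
      obtain ⟨y, ⟨hy1, hy2⟩, hy3⟩ := exists_mem_inter_of_ae (I := J')
        ⟨s, Metric.mem_ball_self hr, hs⟩ hS
      exact ⟨y, ⟨hy2, hy3⟩, by rw [dist_comm]; exact hy1⟩
    intro s hs t ht
    obtain ⟨a, ha, hat⟩ := mem_closure_iff_seq_limit.1 (hdense s hs)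
    obtain ⟨b, hb, hbt⟩ := mem_closure_iff_seq_limit.1 (hdense t ht)
    have c : ∀ (y : ℝ) (a : ℕ → ℝ), y ∈ J → (∀ k, a k ∈ (J : Set ℝ) ∩ S) →
        Tendsto a atTop (𝓝 y) → Tendsto (fun k => w (a k)) atTop (𝓝 (w y)) := fun y a hy ha hat =>
      (hwc y hy).tendsto.comp (tendsto_nhdsWithin_iff.2 ⟨hat, Eventually.of_forall fun k => (ha k).1⟩)
    refine le_of_tendsto_of_tendsto' ((c s a hs ha hat).sub (c t b ht hb hbt)).abs
      ((hat.sub hbt).abs.const_mul ε) fun k => ?_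
    exact hSL _ (ha k).1 _ (hb k).1 (ha k).2 (hb k).2
  have := key t ht t₀ ht₀J
  rw [hwJ t ht, hwJ t₀ ht₀J] at this
  rw [Real.norm_eq_abs, Real.norm_eq_abs]
  convert this using 2
  rw [smul_eq_mul]; ring

/-- A continuous function that is orthogonal to all test functions vanishes. -/
lemma eq_zero_of_integral_test_eq_zero {I : Opens ℝ} {D : ℝ → ℝ}
    (hD : ContinuousOn D (I : Set ℝ))
    (h : ∀ η : ℝ → ℝ, ContDiff ℝ ∞ η → HasCompactSupport η → tsupport η ⊆ I →
      ∫ t, η t * D t = 0) : ∀ t ∈ I, D t = 0 := by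
  have hloc : LocallyIntegrableOn D (I : Set ℝ) volume :=
    hD.locallyIntegrableOn I.isOpen.measurableSet
  have h1 := I.isOpen.ae_eq_zero_of_integral_contDiff_smul_eq_zero hloc
    fun η hη hηc hηI => by simpa using h η hη hηc hηI
  have h2 : D =ᵐ[volume.restrict (I : Set ℝ)] fun _ => (0 : ℝ) :=
    (ae_restrict_iff' I.isOpen.measurableSet).2 h1
  exact Measure.eqOn_open_of_ae_eq h2 I.isOpen hD continuousOn_const

end ClassicalDerivative

/-! ### The Euler equations for averages in the classical sense -/

section Smoothing

variable {n : ℕ} {I : Opens ℝ} {Γ : Submodule ℤ (Space n)} {ν : Measure (Space n)}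
  {K : Set (Space n)} {α C C' : ℝ} {v : ℝ → Space n → Space n} {p : 𝓓'(slab n I, ℝ)}
  {P : ℝ → Space n → ℝ} {κ : Space n → ℝ} {r : ℝ}

lemma continuousOn_mol_time (hκ : IsKernel κ) {θ A lam : ℝ} {F : ℝ → Space n → ℝ}
    (hF : IsScaled Γ I θ A lam F) (hθ : 0 < θ) (hlam : 0 < lam) (r : ℝ) (x : Space n) :
    ContinuousOn (fun t => mol κ r (F t) x) (I : Set ℝ) := by
  intro t ht
  rw [ContinuousWithinAt, tendsto_iff_norm_sub_tendsto_zero]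
  have h1 : Tendsto (fun s : ℝ => (∫ y, |κ y|) * (A * lam ^ (-θ) * |s - t| ^ θ)) (𝓝 t)
      (𝓝 ((∫ y, |κ y|) * (A * lam ^ (-θ) * |t - t| ^ θ))) := by
    refine Continuous.tendsto (f := fun s : ℝ => (∫ y, |κ y|) * (A * lam ^ (-θ) * |s - t| ^ θ)) ?_ t
    have : Continuous fun s : ℝ => |s - t| := by fun_prop
    exact continuous_const.mul (continuous_const.mul (this.rpow_const fun _ => Or.inr hθ.le))
  rw [sub_self, abs_zero, Real.zero_rpow hθ.ne', mul_zero, mul_zero] at h1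
  refine squeeze_zero' (Eventually.of_forall fun _ => norm_nonneg _) ?_
    (h1.mono_left nhdsWithin_le_nhds)
  filter_upwards [self_mem_nhdsWithin] with s hs
  rw [← mol_sub hκ (hF.continuous hθ hlam hs) (hF.continuous hθ hlam ht)]
  exact norm_mol_le hκ.integrable (fun y => by simpa using hF.holder s hs t ht y y) x

/-- The momentum equation for the averages in space of a continuous weak solution. -/
lemma hasDerivAt_mol_velocity (hE : IsPairedEulerSolution v p) (hv : IsUniformlyHolder Γ α C v)
    (hP : IsUniformlyHolder Γ α C' P)
    (hp : ∀ φ : 𝓓(slab n I, ℝ), p φ = ∫ z : ℝ × Space n, P z.1 z.2 * φ z)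
    {a A A' : ℝ} (ha : 0 < a) (hvs : ∀ l, IsScaled Γ I a A 1 (fun t x => v t x l))
    (hPs : IsScaled Γ I a A' 1 P) (hκ : IsKernel κ) (hr : r ≠ 0) (l : Fin n) {t : ℝ} (ht : t ∈ I)
    (x : Space n) : HasDerivAt (fun s => mol κ r (fun y => v s y l) x) (-(r⁻¹ *
      (∑ j, mol (pd j κ) r (fun y => v t y j * v t y l) x + mol (pd l κ) r (P t) x))) t := by
  refine hasDerivAt_of_weak_derivative (I := I)
    (G := fun t => r⁻¹ * (∑ j, mol (pd j κ) r (fun y => v t y j * v t y l) x +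
      mol (pd l κ) r (P t) x))
    (aestronglyMeasurable_mol_time (F := fun s y => v s y l) hκ hr
      (hv.apply l).aestronglyMeasurable x)
    (fun t => norm_mol_le hκ.integrable ((hv.apply l).bound t) x) ?_
    (B' := |r⁻¹| * (∑ j, (∫ y, |pd j κ y|) * (2 * C ^ 2) + (∫ y, |pd l κ y|) * C'))
    (fun t => ?_) (continuousOn_mol_time hκ (hvs l) ha one_pos r x) ?_
    (fun η hη hηc hηI => integral_deriv_mul_mol hE hv hP hp hκ hr hη hηc hηI l x) ht
  · refine AEStronglyMeasurable.const_mul (AEStronglyMeasurable.add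
      (Finset.aestronglyMeasurable_fun_sum _ fun j _ => ?_) ?_) _
    · exact aestronglyMeasurable_mol_time (F := fun t y => v t y j * v t y l) (hκ.pd j) hr
        ((hv.apply j).mul (hv.apply l)).aestronglyMeasurable x
    · exact aestronglyMeasurable_mol_time (hκ.pd l) hr hP.aestronglyMeasurable x
  · rw [abs_mul]
    refine mul_le_mul_of_nonneg_left ?_ (abs_nonneg _)
    refine (abs_add_le _ _).trans (add_le_add ?_ ?_)
    · exact norm_sum_le_of_le _ fun j _ => norm_mol_le (hκ.pd j).integrable
        (((hv.apply j).mul (hv.apply l)).bound t) x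
    · exact norm_mol_le (hκ.pd l).integrable (hP.bound t) x
  · refine continuousOn_const.mul ((continuousOn_finsetSum _ fun j _ => ?_).add ?_)
    · exact continuousOn_mol_time (hκ.pd j) ((hvs j).mul (hvs l) one_pos) ha one_pos r x
    · exact continuousOn_mol_time (hκ.pd l) hPs ha one_pos r x

/-- The averages in space of a continuous weak solution are divergence free. -/
lemma sum_mol_pd_eq_zero (hE : IsPairedEulerSolution v p) (hv : IsUniformlyHolder Γ α C v)
    {a A : ℝ} (ha : 0 < a) (hvs : ∀ l, IsScaled Γ I a A 1 (fun t x => v t x l))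
    (hκ : IsKernel κ) (hr : r ≠ 0) {t : ℝ} (ht : t ∈ I) (x : Space n) :
    ∑ j, mol (pd j κ) r (fun y => v t y j) x = 0 :=
  eq_zero_of_integral_test_eq_zero (I := I)
    (D := fun t => ∑ j, mol (pd j κ) r (fun y => v t y j) x)
    (continuousOn_finsetSum _ fun j _ => continuousOn_mol_time (hκ.pd j) (hvs j) ha one_pos r x)
    (fun _ hη hηc hηI => integral_mul_sum_mol hE hv hκ hr hη hηc hηI x) t ht

end Smoothing

/-! ### Calculus of first partial derivatives in space and time -/

section Partials

variable {n : ℕ} {I : Opens ℝ} {f ft g gt : ℝ → Space n → ℝ} {fx gx : Fin n → ℝ → Space n → ℝ}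
  {κ : Space n → ℝ} {r : ℝ}

/-- The covector with the given coordinates. -/
noncomputable def covector (c : Fin n → ℝ) : Space n →L[ℝ] ℝ :=
  ∑ j, c j • (EuclideanSpace.proj j : Space n →L[ℝ] ℝ)

lemma covector_apply (c : Fin n → ℝ) (x : Space n) : covector c x = ∑ j, c j * x j := by
  simp [covector]

lemma norm_covector_le (c : Fin n → ℝ) : ‖covector c‖ ≤ ∑ j, |c j| := by
  refine norm_sum_le_of_le _ fun j _ => ?_
  have hp : ‖(EuclideanSpace.proj j : Space n →L[ℝ] ℝ)‖ ≤ 1 :=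
    ContinuousLinearMap.opNorm_le_bound _ zero_le_one fun v => by
      simpa using PiLp.norm_apply_le v j
  rw [norm_smul, Real.norm_eq_abs]
  exact mul_le_of_le_one_right (abs_nonneg _) hp

lemma norm_covector_le_of_forall {c : Fin n → ℝ} {B : ℝ} (h : ∀ j, |c j| ≤ B) :
    ‖covector c‖ ≤ n * B := by
  refine (norm_covector_le c).trans ((Finset.sum_le_sum fun j _ => h j).trans ?_)
  simp

lemma hasSum_covector {ι : Type*} {c : ι → Fin n → ℝ} {b : Fin n → ℝ}
    (h : ∀ j, HasSum (fun i => c i j) (b j)) : HasSum (fun i => covector (c i)) (covector b) := by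
  unfold covector
  exact hasSum_sum fun j _ => (h j).smul_const _

/-- `ft` is the time derivative and `fx` are the spatial partial derivatives of `f` on `I × ℝⁿ`. -/
structure HasPartials (I : Opens ℝ) (f ft : ℝ → Space n → ℝ) (fx : Fin n → ℝ → Space n → ℝ) :
    Prop where
  time : ∀ t ∈ I, ∀ x, HasDerivAt (fun s => f s x) (ft t x) t
  space : ∀ t ∈ I, ∀ x, HasFDerivAt (f t) (covector fun j => fx j t x) x

namespace HasPartials

lemma continuous (h : HasPartials I f ft fx) {t : ℝ} (ht : t ∈ I) : Continuous (f t) :=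
  continuous_iff_continuousAt.2 fun x => (h.space t ht x).continuousAt

lemma congr (h : HasPartials I f ft fx) (hfg : ∀ t ∈ I, ∀ x, g t x = f t x) :
    HasPartials I g ft fx where
  time t ht x := (h.time t ht x).congr_of_eventuallyEq (by
    filter_upwards [I.isOpen.mem_nhds ht] with s hs using hfg s hs x)
  space t ht x := (h.space t ht x).congr_of_eventuallyEq (Eventually.of_forall (hfg t ht))

lemma add (h : HasPartials I f ft fx) (h' : HasPartials I g gt gx) :
    HasPartials I (fun t x => f t x + g t x) (fun t x => ft t x + gt t x)
      (fun j t x => fx j t x + gx j t x) where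
  time t ht x := (h.time t ht x).add (h'.time t ht x)
  space t ht x := ((h.space t ht x).fun_add (h'.space t ht x)).congr_fderiv (by
    ext y; simp only [add_apply, covector_apply, add_mul, Finset.sum_add_distrib])

lemma const_mul (h : HasPartials I f ft fx) (c : ℝ) :
    HasPartials I (fun t x => c * f t x) (fun t x => c * ft t x) (fun j t x => c * fx j t x) where
  time t ht x := (h.time t ht x).const_mul c
  space t ht x := ((h.space t ht x).const_mul c).congr_fderiv (by
    ext y; simp only [smul_apply, smul_eq_mul, covector_apply, Finset.mul_sum, mul_assoc])

lemma zero : HasPartials I (fun _ (_ : Space n) => 0) (fun _ _ => 0) (fun _ _ _ => 0) where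
  time _ _ _ := hasDerivAt_const _ _
  space _ _ x := (hasFDerivAt_const (0 : ℝ) x).congr_fderiv (by ext y; simp [covector_apply])

lemma mul (h : HasPartials I f ft fx) (h' : HasPartials I g gt gx) :
    HasPartials I (fun t x => f t x * g t x) (fun t x => ft t x * g t x + f t x * gt t x)
      (fun j t x => fx j t x * g t x + f t x * gx j t x) where
  time t ht x := (h.time t ht x).mul (h'.time t ht x)
  space t ht x := ((h.space t ht x).fun_mul (h'.space t ht x)).congr_fderiv (by
    ext y
    simp only [add_apply, smul_apply, smul_eq_mul, covector_apply, add_mul, Finset.mul_sum,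
      Finset.sum_add_distrib]
    rw [add_comm]
    congr 1 <;> exact Finset.sum_congr rfl fun j _ => by ring)

lemma tsum {ι : Type*} {f ft : ι → ℝ → Space n → ℝ} {fx : ι → Fin n → ℝ → Space n → ℝ}
    {u : ι → ℝ} (hI : (I : Set ℝ).OrdConnected) (hu : Summable u)
    (h : ∀ i, HasPartials I (f i) (ft i) (fx i)) (hf : ∀ i, ∀ t ∈ I, ∀ x, |f i t x| ≤ u i)
    (hft : ∀ i, ∀ t ∈ I, ∀ x, |ft i t x| ≤ u i)
    (hfx : ∀ i j, ∀ t ∈ I, ∀ x, |fx i j t x| ≤ u i) :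
    HasPartials I (fun t x => ∑' i, f i t x) (fun t x => ∑' i, ft i t x)
      (fun j t x => ∑' i, fx i j t x) where
  time t ht x := hasDerivAt_tsum_of_isPreconnected hu I.isOpen hI.isPreconnected
    (fun i s hs => (h i).time s hs x) (fun i s hs => hft i s hs x) ht
    (Summable.of_norm_bounded hu fun i => hf i t ht x) ht
  space t ht x := by
    have h1 := hasFDerivAt_tsum (hu.mul_left (n : ℝ)) (fun i x => (h i).space t ht x)
      (fun i x => norm_covector_le_of_forall fun j => hfx i j t ht x) (x₀ := x)
      (Summable.of_norm_bounded hu fun i => hf i t ht x) x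
    rwa [(hasSum_covector fun j => (Summable.of_norm_bounded hu
      fun i => hfx i j t ht x).hasSum).tsum_eq] at h1

/-- In time one differentiates under the integral. In space `hasFDerivAt_mol` puts the derivative on
the weight and `mol_pd_eq` moves it back to `f`, cancelling the powers of `r`. -/
lemma mol (hκ : IsKernel κ) (hr : r ≠ 0) (h : HasPartials I f ft fx) {A : ℝ}
    (hft : ∀ t ∈ I, ∀ x, |ft t x| ≤ A) (hftc : ∀ t ∈ I, Continuous (ft t))
    (hfxc : ∀ j, ∀ t ∈ I, Continuous (fx j t)) :
    HasPartials I (fun t => mol κ r (f t)) (fun t => mol κ r (ft t))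
      (fun j t => mol κ r (fx j t)) where
  time t ht x := by
    refine (hasDerivAt_integral_of_dominated_loc_of_deriv_le (I.isOpen.mem_nhds ht)
      (F := fun s y => κ y • f s (x - r • y)) (F' := fun s y => κ y • ft s (x - r • y))
      (bound := fun y => |κ y| * A) ?_ (hκ.integrable_smul_comp (h.continuous ht) r x)
      (hκ.integrable_smul_comp (hftc t ht) r x).aestronglyMeasurable ?_
      (hκ.integrable.abs.mul_const A) ?_).2
    · filter_upwards [I.isOpen.mem_nhds ht] with s hs
      exact (hκ.integrable_smul_comp (h.continuous hs) r x).aestronglyMeasurable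
    · refine Eventually.of_forall fun y s hs => ?_
      rw [norm_smul, Real.norm_eq_abs]
      exact mul_le_mul_of_nonneg_left (hft s hs _) (abs_nonneg _)
    · exact Eventually.of_forall fun y s hs => (h.time s hs _).const_smul (κ y)
  space t ht x := by
    have hd : ∀ y j, fderiv ℝ (f t) y (EuclideanSpace.single j 1) = fx j t y := by
      intro y j
      rw [(h.space t ht y).fderiv, covector_apply]
      simp
    have hC1 : ContDiff ℝ 1 (f t) := by
      rw [contDiff_one_iff_hasFDerivAt]
      exact ⟨_, continuous_finsetSum _ fun j _ => (hfxc j t ht).smul continuous_const, h.space t ht⟩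
    have h1 := hasFDerivAt_mol hκ hr (h.continuous ht) x
    simp only [mol_pd_eq hκ hC1, inv_mul_cancel_left₀ hr, hd] at h1
    exact h1

lemma abs_sub_le (hI : (I : Set ℝ).OrdConnected) (h : HasPartials I f ft fx) {A : ℝ} (hA : 0 ≤ A)
    (hft : ∀ t ∈ I, ∀ x, |ft t x| ≤ A) (hfx : ∀ j, ∀ t ∈ I, ∀ x, |fx j t x| ≤ A) {t t' : ℝ}
    (ht : t ∈ I) (ht' : t' ∈ I) (x x' : Space n) :
    |f t x - f t' x'| ≤ (n + 1) * A * (|t - t'| + ‖x - x'‖) := by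
  have h1 : |f t x - f t' x| ≤ A * |t - t'| := by
    have := Convex.norm_image_sub_le_of_norm_hasDerivWithin_le (f := fun s => f s x)
      (f' := fun s => ft s x) (s := (I : Set ℝ)) (C := A)
      (fun s hs => (h.time s hs x).hasDerivWithinAt) (fun s hs => hft s hs x) hI.convex ht' ht
    simpa [Real.norm_eq_abs] using this
  have h2 : |f t' x - f t' x'| ≤ n * A * ‖x - x'‖ := by
    have := (convex_univ (E := Space n)).norm_image_sub_le_of_norm_hasFDerivWithin_le
      (f := f t') (C := n * A) (fun z _ => (h.space t' ht' z).hasFDerivWithinAt)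
      (fun z _ => norm_covector_le_of_forall fun j => hfx j t' ht' z) (Set.mem_univ x')
      (Set.mem_univ x)
    simpa using this
  have h3 := _root_.abs_sub_le (f t x) (f t' x) (f t' x')
  have h4 : 0 ≤ n * A * |t - t'| := by positivity
  have h5 : 0 ≤ A * ‖x - x'‖ := by positivity
  nlinarith

end HasPartials

end Partials

/-! ### Functions varying at a given scale together with their first derivatives -/

section ScaledC1

variable {n : ℕ} {I : Opens ℝ} {Γ : Submodule ℤ (Space n)} {ν : Measure (Space n)}
  {K : Set (Space n)} {θ A B lam ε : ℝ} {f g : ℝ → Space n → ℝ} {κ : Space n → ℝ}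

/-- Differentiable functions on `I × ℝⁿ` that are bounded by `A` and vary at the scale `lam`, and
whose first derivatives also vary at this scale. -/
def IsScaledC1 (Γ : Submodule ℤ (Space n)) (I : Opens ℝ) (θ A lam : ℝ) (f : ℝ → Space n → ℝ) :
    Prop :=
  ∃ (ft : ℝ → Space n → ℝ) (fx : Fin n → ℝ → Space n → ℝ), HasPartials I f ft fx ∧
    (∀ t ∈ I, ∀ x, |f t x| ≤ A) ∧ (∀ t ∈ I, ∀ γ ∈ Γ, ∀ x, f t (x + γ) = f t x) ∧
    IsScaled Γ I θ (A / lam) lam ft ∧ ∀ j, IsScaled Γ I θ (A / lam) lam (fx j)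

namespace IsScaledC1

lemma nonneg (h : IsScaledC1 Γ I θ A lam f) (hlam : 0 < lam) : 0 ≤ A := by
  obtain ⟨ft, fx, -, -, -, h, -⟩ := h
  have := mul_nonneg h.nonneg hlam.le
  rwa [div_mul_cancel₀ _ hlam.ne'] at this

lemma isScaled (hI : (I : Set ℝ).OrdConnected) (h : IsScaledC1 Γ I θ A lam f) (hlam : 0 < lam)
    {s : ℝ} (hs : 0 ≤ s) (hs1 : s ≤ 1) : IsScaled Γ I s (2 * ((n + 1) * A)) lam f := by
  have hA := h.nonneg hlam
  obtain ⟨ft, fx, hd, hb, hper, hft, hfx⟩ := h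
  refine IsScaled.of_lipschitz hs hs1 hlam (by positivity) (fun t ht x => ?_)
    (fun t ht t' ht' x x' => ?_) hper
  · refine (hb t ht x).trans ?_
    have : 0 ≤ n * A := by positivity
    linarith
  · have := hd.abs_sub_le hI hft.nonneg hft.bound (fun j => (hfx j).bound) ht ht' x x'
    rwa [mul_div_assoc]

lemma mono (h : IsScaledC1 Γ I θ A lam f) (hlam : 0 < lam) (hAB : A ≤ B) :
    IsScaledC1 Γ I θ B lam f := by
  obtain ⟨ft, fx, hd, hb, hper, hft, hfx⟩ := h
  exact ⟨ft, fx, hd, fun t ht x => (hb t ht x).trans hAB, hper, hft.mono hlam (by gcongr),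
    fun j => (hfx j).mono hlam (by gcongr)⟩

lemma congr (h : IsScaledC1 Γ I θ A lam f) (hfg : ∀ t ∈ I, ∀ x, g t x = f t x) :
    IsScaledC1 Γ I θ A lam g := by
  obtain ⟨ft, fx, hd, hb, hper, hft, hfx⟩ := h
  exact ⟨ft, fx, hd.congr hfg, fun t ht x => by rw [hfg t ht]; exact hb t ht x,
    fun t ht γ hγ x => by rw [hfg t ht, hfg t ht]; exact hper t ht γ hγ x, hft, hfx⟩

lemma add (h : IsScaledC1 Γ I θ A lam f) (h' : IsScaledC1 Γ I θ B lam g) :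
    IsScaledC1 Γ I θ (A + B) lam (fun t x => f t x + g t x) := by
  obtain ⟨ft, fx, hd, hb, hper, hft, hfx⟩ := h
  obtain ⟨gt, gx, hd', hb', hper', hgt, hgx⟩ := h'
  refine ⟨_, _, hd.add hd', fun t ht x => (abs_add_le _ _).trans (add_le_add (hb t ht x)
    (hb' t ht x)), fun t ht γ hγ x => by
      simp only [hper t ht γ hγ, hper' t ht γ hγ], ?_, fun j => ?_⟩
  · rw [add_div]; exact hft.add hgt
  · rw [add_div]; exact (hfx j).add (hgx j)

lemma const_mul (h : IsScaledC1 Γ I θ A lam f) (c : ℝ) :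
    IsScaledC1 Γ I θ (|c| * A) lam (fun t x => c * f t x) := by
  obtain ⟨ft, fx, hd, hb, hper, hft, hfx⟩ := h
  refine ⟨_, _, hd.const_mul c, fun t ht x => ?_, fun t ht γ hγ x => by
      simp only [hper t ht γ hγ], ?_,
    fun j => ?_⟩
  · rw [abs_mul]; gcongr; exact hb t ht x
  · rw [mul_div_assoc]; exact hft.const_mul c
  · rw [mul_div_assoc]; exact (hfx j).const_mul c

lemma zero : IsScaledC1 Γ I θ 0 lam (fun _ _ => 0) := by
  refine ⟨_, _, HasPartials.zero, fun t ht x => by simp, fun _ _ _ _ _ => rfl, ?_, fun j => ?_⟩ <;>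
  · rw [zero_div]; exact IsScaled.zero

lemma sum {ι : Type*} (s : Finset ι) {f : ι → ℝ → Space n → ℝ} {A : ι → ℝ}
    (h : ∀ i, IsScaledC1 Γ I θ (A i) lam (f i)) :
    IsScaledC1 Γ I θ (∑ i ∈ s, A i) lam (fun t x => ∑ i ∈ s, f i t x) := by
  classical
  induction s using Finset.induction_on with
  | empty => simpa using zero
  | insert a s ha ih =>
    simp only [Finset.sum_insert ha]
    exact (h a).add ih

lemma mul (hI : (I : Set ℝ).OrdConnected) (h : IsScaledC1 Γ I θ A lam f)
    (h' : IsScaledC1 Γ I θ B lam g) (hlam : 0 < lam) (hθ : 0 ≤ θ) (hθ1 : θ ≤ 1) :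
    IsScaledC1 Γ I θ (8 * (n + 1) * (A * B)) lam (fun t x => f t x * g t x) := by
  have hA := h.nonneg hlam
  have hB := h'.nonneg hlam
  have hf := h.isScaled hI hlam hθ hθ1
  have hg := h'.isScaled hI hlam hθ hθ1
  obtain ⟨ft, fx, hd, hb, hper, hft, hfx⟩ := h
  obtain ⟨gt, gx, hd', hb', hper', hgt, hgx⟩ := h'
  -- The two terms of the product rule: each carries a factor two from `IsScaled.mul` and `2(n + 1)`
  -- from `IsScaledC1.isScaled`.
  have e : 2 * (A / lam * (2 * ((n + 1) * B))) + 2 * (2 * ((n + 1) * A) * (B / lam)) =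
      8 * (n + 1) * (A * B) / lam := by ring
  refine ⟨_, _, hd.mul hd', fun t ht x => ?_, fun t ht γ hγ x => by
    simp only [hper t ht γ hγ, hper' t ht γ hγ], ?_, fun j => ?_⟩
  · rw [abs_mul]
    have h1 := mul_le_mul (hb t ht x) (hb' t ht x) (abs_nonneg _) hA
    have h2 : 0 ≤ A * B := by positivity
    have h3 : 0 ≤ n * (A * B) := by positivity
    linarith
  · rw [← e]; exact (hft.mul hg hlam).add (hf.mul hgt hlam)
  · rw [← e]; exact ((hfx j).mul hg hlam).add (hf.mul (hgx j) hlam)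

lemma czSum (hI : (I : Set ℝ).OrdConnected) (hν : IsPeriodicMean Γ ν K) (hκ : IsKernel κ)
    (h0 : ∫ y, κ y = 0) (h : IsScaledC1 Γ I θ A lam f) (hε : 0 < ε) (hεθ : ε ≤ θ) (hθ1 : θ ≤ 1)
    (hlam : 0 < lam) (hlam1 : lam ≤ 1) :
    IsScaledC1 Γ I (θ - ε) (4 * (n + 1) * czConst ν ε κ * (A * lam ^ (-ε))) lam
      (fun t => czSum κ (f t)) := by
  have hA := h.nonneg hlam
  have hf := h.isScaled hI hlam (hε.le.trans hεθ) hθ1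
  obtain ⟨ft, fx, hd, hb, hper, hft, hfx⟩ := h
  have m := czConst_nonneg ν ε κ
  have hθ : 0 < θ := hε.trans_le hεθ
  -- Termwise differentiation asks for one majorant for the terms and their derivatives; `D`
  -- dominates the `ε`-Hölder constants of `f` and of its partial derivatives.
  set D : ℝ := 2 * (2 * ((n + 1) * A) * lam ^ (-ε)) + 2 * (A / lam * lam ^ (-ε)) with hD
  have hD1 : 2 * (2 * ((n + 1) * A) * lam ^ (-ε)) ≤ D := by
    rw [hD]; exact le_add_of_nonneg_right (by positivity)
  have hD2 : 2 * (A / lam * lam ^ (-ε)) ≤ D := by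
    rw [hD]; exact le_add_of_nonneg_left (by positivity)
  have hb1 := fun (t : ℝ) (ht : t ∈ I) =>
    (hf.isPeriodicHolder hε.le hεθ hlam hlam1 ht).mono hD1
  have hb2 := fun (t : ℝ) (ht : t ∈ I) =>
    (hft.isPeriodicHolder hε.le hεθ hlam hlam1 ht).mono hD2
  have hb3 := fun (j : Fin n) (t : ℝ) (ht : t ∈ I) =>
    ((hfx j).isPeriodicHolder hε.le hεθ hlam hlam1 ht).mono hD2
  have hp : HasPartials I (fun t => EulerReg.czSum κ (f t)) (fun t => EulerReg.czSum κ (ft t))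
      (fun j t => EulerReg.czSum κ (fx j t)) :=
    HasPartials.tsum hI ((summable_dyadic_min hε one_pos).mul_left _)
      (fun k => hd.mol hκ (zpow_ne_zero (-k) two_ne_zero) hft.bound
        (fun t ht => hft.continuous hθ hlam ht) (fun j t ht => (hfx j).continuous hθ hlam ht))
      (fun k t ht x => abs_mol_dyadic_le hν hκ h0 hε (hb1 t ht) k x)
      (fun k t ht x => abs_mol_dyadic_le hν hκ h0 hε (hb2 t ht) k x)
      (fun k j t ht x => abs_mol_dyadic_le hν hκ h0 hε (hb3 j t ht) k x)
  have hc := isScaled_czSum hν hκ h0 hf hε hεθ hlam hlam1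
  have hle : 2 * czConst ν ε κ * (A / lam * lam ^ (-ε)) ≤
      4 * (n + 1) * czConst ν ε κ * (A * lam ^ (-ε)) / lam := by
    rw [div_mul_eq_mul_div, mul_div_assoc', div_le_div_iff_of_pos_right hlam]
    have h1 : 0 ≤ czConst ν ε κ * (A * lam ^ (-ε)) := by positivity
    have h2 : 0 ≤ n * (czConst ν ε κ * (A * lam ^ (-ε))) := by positivity
    linarith
  refine ⟨_, _, hp, fun t ht x => (hc.bound t ht x).trans (le_of_eq (by ring)), hc.periodic,
    (isScaled_czSum hν hκ h0 hft hε hεθ hlam hlam1).mono hlam hle, fun j =>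
    (isScaled_czSum hν hκ h0 (hfx j) hε hεθ hlam hlam1).mono hlam hle⟩

end IsScaledC1

end ScaledC1

lemma abs_mol_le {n : ℕ} {κ f : Space n → ℝ} {r A : ℝ} (hκ : IsKernel κ) (hf : ∀ x, |f x| ≤ A)
    (x : Space n) : |mol κ r f x| ≤ (∫ y, |κ y|) * A :=
  norm_mol_le (G := ℝ) hκ.integrable hf x

/-! ### Averages of a Hölder continuous Euler velocity -/

section HolderEuler

variable {n : ℕ} {I : Opens ℝ} {Γ : Submodule ℤ (Space n)} {ν : Measure (Space n)}
  {K : Set (Space n)} {a A θ lam ε : ℝ} {v : ℝ → Space n → Space n} {P : ℝ → Space n → ℝ}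
  {κ : Space n → ℝ}

/-- `a`-Hölder continuous velocities and pressures whose averages in space satisfy the Euler
equations in the classical sense. -/
structure IsHolderEuler (Γ : Submodule ℤ (Space n)) (I : Opens ℝ) (a A : ℝ)
    (v : ℝ → Space n → Space n) (P : ℝ → Space n → ℝ) : Prop where
  velocity : ∀ l, IsScaled Γ I a A 1 (fun t x => v t x l)
  pressure : IsScaled Γ I a A 1 P
  momentum : ∀ κ : Space n → ℝ, IsKernel κ → ∀ r : ℝ, r ≠ 0 → ∀ l, ∀ t ∈ I, ∀ x,
    HasDerivAt (fun s => mol κ r (fun y => v s y l) x) (-(r⁻¹ *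
      (∑ j, mol (pd j κ) r (fun y => v t y j * v t y l) x + mol (pd l κ) r (P t) x))) t
  divergence_free : ∀ κ : Space n → ℝ, IsKernel κ → ∀ r : ℝ, r ≠ 0 → ∀ t ∈ I, ∀ x,
    ∑ j, mol (pd j κ) r (fun y => v t y j) x = 0

/-- The averages in space of the velocity vary at the scale of the average. -/
lemma IsHolderEuler.exists_isScaledC1_mol (h : IsHolderEuler Γ I a A v P) (ha : 0 < a)
    (hθ : 0 ≤ θ) (hθa : θ ≤ a) (hκ : IsKernel κ) :
    ∃ M, ∀ lam, 0 < lam → ((∫ y, κ y = 0) ∨ lam = 1) → ∀ l,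
      IsScaledC1 Γ I θ (M * lam ^ a) lam (fun t => mol κ lam (fun y => v t y l)) := by
  set c : (Space n → ℝ) → ℝ := fun κ => absMoment a κ + 2 * absMoment (a - θ) κ with hc
  have hc0 : ∀ κ, 0 ≤ c κ := fun κ => by
    have := absMoment_nonneg a κ
    have := absMoment_nonneg (a - θ) κ
    positivity
  have hA := h.pressure.nonneg
  have hκ0 : 0 ≤ ∫ y, |κ y| := integral_nonneg fun _ => abs_nonneg _
  have hs : ∀ b : ℝ, 0 ≤ b → 0 ≤ ∑ j, c (pd j κ) * b := fun b hb =>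
    Finset.sum_nonneg fun j _ => mul_nonneg (hc0 _) hb
  have hs1 := hs (2 * (A * A)) (by positivity)
  have hs2 := hs A hA
  have hm := absMoment_nonneg a κ
  set M : ℝ := (absMoment a κ + ∫ y, |κ y|) * A + (∑ j, c (pd j κ) * (2 * (A * A)) +
    ∑ j, c (pd j κ) * A) with hM
  refine ⟨M, fun lam hlam hor l => ?_⟩
  have hp : 0 ≤ lam ^ a := by positivity
  have hcont : ∀ t ∈ I, Continuous fun y => v t y l := fun t ht =>
    (h.velocity l).continuous ha one_pos ht
  have hsp : ∀ j, IsScaled Γ I θ (c (pd j κ) * A * lam ^ a) lam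
      (fun t => mol (pd j κ) lam (fun y => v t y l)) := fun j =>
    isScaled_mol (hκ.pd j) (hκ.integral_pd j) (h.velocity l) ha hθ hθa hlam
  have hsj : ∀ j, c (pd j κ) * A ≤ ∑ j, c (pd j κ) * A := fun j =>
    Finset.single_le_sum (f := fun j => c (pd j κ) * A) (fun j _ => mul_nonneg (hc0 _) hA)
      (Finset.mem_univ j)
  have hinv : |lam⁻¹| = lam⁻¹ := abs_of_pos (inv_pos.2 hlam)
  -- The time derivative comes from the momentum equation and the spatial ones fall on the weight.
  -- All are `lam⁻¹` times averages with weights of mean zero, hence of size `lam^(a-1)`.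
  refine ⟨fun t x => -lam⁻¹ * (∑ j, mol (pd j κ) lam (fun y => v t y j * v t y l) x +
      mol (pd l κ) lam (P t) x), fun j t x => lam⁻¹ * mol (pd j κ) lam (fun y => v t y l) x,
    ⟨fun t ht x => ?_, fun t ht x => hasFDerivAt_mol hκ hlam.ne' (hcont t ht) x⟩,
    fun t ht x => ?_, fun t ht γ hγ x => ?_, ?_, fun j => ?_⟩
  · rw [neg_mul]; exact h.momentum κ hκ lam hlam.ne' l t ht x
  -- Only the bound on the average itself needs `∫ κ = 0`; at `lam = 1` no gain is required and the
  -- supremum bound suffices.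
  · rcases hor with h0 | h1
    · have := norm_mol_le_of_holder (r := lam) hκ h0 ha.le (hcont t ht)
        (fun x y => by simpa using (h.velocity l).slice ht x y) x
      rw [abs_of_pos hlam, Real.norm_eq_abs] at this
      refine this.trans ?_
      have h2 : 0 ≤ (∫ y, |κ y|) * A := by positivity
      rw [← mul_assoc]
      refine mul_le_mul_of_nonneg_right ?_ hp
      rw [hM]; linarith
    · have := abs_mol_le (r := lam) hκ ((h.velocity l).bound t ht) x
      rw [h1, Real.one_rpow, mul_one, ← h1]
      have h2 : 0 ≤ absMoment a κ * A := by positivity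
      rw [hM]; linarith
  · simp only
    rw [← mol_translate]
    congr 1; ext y
    exact (h.velocity l).periodic t ht γ hγ y
  · have h1 := ((IsScaled.sum Finset.univ fun j => isScaled_mol (hκ.pd j) (hκ.integral_pd j)
      ((h.velocity j).mul (h.velocity l) one_pos) ha hθ hθa hlam).add
      (isScaled_mol (hκ.pd l) (hκ.integral_pd l) h.pressure ha hθ hθa hlam)).const_mul (-lam⁻¹)
    refine h1.mono hlam ?_
    rw [abs_neg, hinv, ← Finset.sum_mul, ← add_mul, div_eq_inv_mul]
    refine mul_le_mul_of_nonneg_left (mul_le_mul_of_nonneg_right ?_ hp) (inv_pos.2 hlam).le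
    have h2 : 0 ≤ (absMoment a κ + ∫ y, |κ y|) * A := by positivity
    have h3 := hsj l
    rw [hM]
    simp only [hc] at h3 ⊢
    linarith
  · refine ((hsp j).const_mul lam⁻¹).mono hlam ?_
    rw [hinv, div_eq_inv_mul]
    refine mul_le_mul_of_nonneg_left (mul_le_mul_of_nonneg_right ?_ hp) (inv_pos.2 hlam).le
    have h2 : 0 ≤ (absMoment a κ + ∫ y, |κ y|) * A := by positivity
    have h3 := hsj j
    rw [hM]
    linarith

end HolderEuler

/-! ### Families indexed by the scale, of size a power of the scale -/

section Families

variable {n : ℕ} {I : Opens ℝ} {Γ : Submodule ℤ (Space n)} {ν : Measure (Space n)}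
  {K : Set (Space n)} {θ b b' ε : ℝ} {F F' : ℝ → ℝ → Space n → ℝ} {κ : Space n → ℝ}

/-- Families of functions that vary at the scale `lam` and have size `lam ^ b`. -/
def IsScaledFamily (Γ : Submodule ℤ (Space n)) (I : Opens ℝ) (θ b : ℝ)
    (F : ℝ → ℝ → Space n → ℝ) : Prop :=
  ∃ M, ∀ lam, 0 < lam → lam ≤ 1 → IsScaledC1 Γ I θ (M * lam ^ b) lam (F lam)

namespace IsScaledFamily

lemma add (h : IsScaledFamily Γ I θ b F) (h' : IsScaledFamily Γ I θ b F') :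
    IsScaledFamily Γ I θ b (fun lam t x => F lam t x + F' lam t x) := by
  obtain ⟨M, hM⟩ := h
  obtain ⟨M', hM'⟩ := h'
  exact ⟨M + M', fun lam h0 h1 => by rw [add_mul]; exact (hM lam h0 h1).add (hM' lam h0 h1)⟩

lemma neg (h : IsScaledFamily Γ I θ b F) :
    IsScaledFamily Γ I θ b (fun lam t x => -F lam t x) := by
  obtain ⟨M, hM⟩ := h
  refine ⟨M, fun lam h0 h1 => ?_⟩
  have := (hM lam h0 h1).const_mul (-1)
  simpa using this

lemma sub (h : IsScaledFamily Γ I θ b F) (h' : IsScaledFamily Γ I θ b F') :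
    IsScaledFamily Γ I θ b (fun lam t x => F lam t x - F' lam t x) := by
  simpa only [sub_eq_add_neg] using h.add h'.neg

lemma sum {ι : Type*} (s : Finset ι) {F : ι → ℝ → ℝ → Space n → ℝ}
    (h : ∀ i, IsScaledFamily Γ I θ b (F i)) :
    IsScaledFamily Γ I θ b (fun lam t x => ∑ i ∈ s, F i lam t x) := by
  choose M hM using h
  exact ⟨∑ i ∈ s, M i, fun lam h0 h1 => by
    rw [Finset.sum_mul]; exact IsScaledC1.sum s fun i => hM i lam h0 h1⟩

lemma mul (hI : (I : Set ℝ).OrdConnected) (h : IsScaledFamily Γ I θ b F)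
    (h' : IsScaledFamily Γ I θ b' F') (hθ : 0 ≤ θ) (hθ1 : θ ≤ 1) :
    IsScaledFamily Γ I θ (b + b') (fun lam t x => F lam t x * F' lam t x) := by
  obtain ⟨M, hM⟩ := h
  obtain ⟨M', hM'⟩ := h'
  refine ⟨8 * (n + 1) * (M * M'), fun lam h0 h1 => ?_⟩
  have := (hM lam h0 h1).mul hI (hM' lam h0 h1) h0 hθ hθ1
  have e : 8 * (n + 1) * (M * lam ^ b * (M' * lam ^ b')) =
      8 * (n + 1) * (M * M') * lam ^ (b + b') := by rw [Real.rpow_add h0]; ring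
  rwa [e] at this

lemma czSum (hI : (I : Set ℝ).OrdConnected) (hν : IsPeriodicMean Γ ν K) (hκ : IsKernel κ)
    (h0 : ∫ y, κ y = 0) (h : IsScaledFamily Γ I θ b F) (hε : 0 < ε) (hεθ : ε ≤ θ) (hθ1 : θ ≤ 1) :
    IsScaledFamily Γ I (θ - ε) (b - ε) (fun lam t => czSum κ (F lam t)) := by
  obtain ⟨M, hM⟩ := h
  refine ⟨4 * (n + 1) * czConst ν ε κ * M, fun lam hl hl1 => ?_⟩
  have := (hM lam hl hl1).czSum hI hν hκ h0 hε hεθ hθ1 hl hl1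
  have e : 4 * (n + 1) * czConst ν ε κ * (M * lam ^ b * lam ^ (-ε)) =
      4 * (n + 1) * czConst ν ε κ * M * lam ^ (b - ε) := by
    rw [sub_eq_add_neg, Real.rpow_add hl]; ring
  rwa [e] at this

end IsScaledFamily

lemma IsHolderEuler.isScaledFamily_mol {a A : ℝ} {v : ℝ → Space n → Space n}
    {P : ℝ → Space n → ℝ} (h : IsHolderEuler Γ I a A v P) (ha : 0 < a)
    (hθ : 0 ≤ θ) (hθa : θ ≤ a) (hκ : IsKernel κ) (h0 : ∫ y, κ y = 0) (l : Fin n) :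
    IsScaledFamily Γ I θ a (fun lam t => mol κ lam (fun y => v t y l)) := by
  obtain ⟨M, hM⟩ := h.exists_isScaledC1_mol ha hθ hθa hκ
  exact ⟨M, fun lam hl _ => hM lam hl (Or.inl h0) l⟩

end Families

/-! ### Products, sums and averages of periodic Hölder functions -/

section PeriodicHolder

variable {n : ℕ} {Γ : Submodule ℤ (Space n)} {s A B : ℝ} {f g κ : Space n → ℝ}

namespace IsPeriodicHolder

lemma mul (hf : IsPeriodicHolder Γ s A f) (hg : IsPeriodicHolder Γ s B g) :
    IsPeriodicHolder Γ s (2 * (A * B)) (fun x => f x * g x) where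
  bound x := by
    rw [abs_mul]
    have := mul_le_mul (hf.bound x) (hg.bound x) (abs_nonneg _) hf.nonneg
    have := mul_nonneg hf.nonneg hg.nonneg
    linarith
  holder x y := by
    have e : f x * g x - f y * g y = (f x - f y) * g x + f y * (g x - g y) := by ring
    rw [e]
    refine (abs_add_le _ _).trans ?_
    rw [abs_mul, abs_mul]
    have hA := hf.nonneg
    have h1 := mul_le_mul (hf.holder x y) (hg.bound x) (abs_nonneg _) (by positivity)
    have h2 := mul_le_mul (hf.bound y) (hg.holder x y) (abs_nonneg _) hA
    linarith
  periodic γ hγ x := by rw [hf.periodic γ hγ, hg.periodic γ hγ]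

lemma mol (hκ : IsKernel κ) (hs : 0 < s) (hf : IsPeriodicHolder Γ s A f) (r : ℝ) :
    IsPeriodicHolder Γ s ((∫ y, |κ y|) * A) (mol κ r f) where
  bound x := abs_mol_le hκ hf.bound x
  holder x y := by
    have hc := hf.continuous hs
    have hc' : Continuous fun z => f (z + (y - x)) := hc.comp (by fun_prop)
    have e : EulerReg.mol κ r f x - EulerReg.mol κ r f y =
        EulerReg.mol κ r (fun z => f z - f (z + (y - x))) x := by
      rw [mol_sub hκ hc hc', mol_translate]
      congr 2; abel
    rw [e, mul_assoc]
    refine abs_mol_le hκ (fun z => ?_) x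
    have := hf.holder z (z + (y - x))
    rwa [sub_add_cancel_left, norm_neg, norm_sub_rev] at this
  periodic γ hγ x := by
    rw [← mol_translate]
    congr 1; ext y
    exact hf.periodic γ hγ y

lemma sum {ι : Type*} (S : Finset ι) {f : ι → Space n → ℝ} {A : ι → ℝ}
    (h : ∀ i, IsPeriodicHolder Γ s (A i) (f i)) :
    IsPeriodicHolder Γ s (∑ i ∈ S, A i) (fun x => ∑ i ∈ S, f i x) where
  bound x := (Finset.abs_sum_le_sum_abs _ _).trans (Finset.sum_le_sum fun i _ => (h i).bound x)
  holder x y := by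
    rw [← Finset.sum_sub_distrib, Finset.sum_mul]
    exact (Finset.abs_sum_le_sum_abs _ _).trans (Finset.sum_le_sum fun i _ => (h i).holder x y)
  periodic γ hγ x := Finset.sum_congr rfl fun i _ => (h i).periodic γ hγ x

end IsPeriodicHolder

end PeriodicHolder

/-! ### The double divergence of products for divergence-free fields -/

section DivergenceForm

variable {n : ℕ} {ρ ψ : Space n → ℝ} {r lam : ℝ}

lemma mol_const_mul (κ : Space n → ℝ) (c : ℝ) (f : Space n → ℝ) (x : Space n) :
    mol κ r (fun y => c * f y) x = c * mol κ r f x := by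
  simp only [mol, smul_eq_mul]
  rw [← integral_const_mul]
  congr 1; ext y; ring

/-- Integration by parts in the double divergence of a product with the divergence of an
antisymmetric matrix. -/
lemma sum_mol_antisymm (hψ : IsKernel ψ) (hr : r ≠ 0) {B : Fin n → Fin n → Space n → ℝ}
    {S : Fin n → Space n → ℝ} (hB : ∀ k i, ContDiff ℝ 1 (B k i)) (hS : ∀ j, ContDiff ℝ 1 (S j))
    (hanti : ∀ k i y, B k i y = -B i k y) (x : Space n) :
    ∑ i, ∑ j, mol (pd i (pd j ψ)) r (fun y =>
      (∑ k, fderiv ℝ (B k i) y (EuclideanSpace.single k 1)) * S j y) x =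
    -∑ i, ∑ j, mol (pd i (pd j ψ)) r (fun y =>
      ∑ k, B k i y * fderiv ℝ (S j) y (EuclideanSpace.single k 1)) x := by
  have cB : ∀ k i, Continuous fun y => fderiv ℝ (B k i) y (EuclideanSpace.single k 1) :=
    fun k i => ((hB k i).continuous_fderiv (by simp)).clm_apply continuous_const
  have cS : ∀ j k, Continuous fun y => fderiv ℝ (S j) y (EuclideanSpace.single k 1) :=
    fun j k => ((hS j).continuous_fderiv (by simp)).clm_apply continuous_const
  have hk : ∀ i j, IsKernel (pd i (pd j ψ)) := fun i j => (hψ.pd j).pd i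
  -- The product rule for `∂ₖ(Bₖᵢ Sⱼ)`, with the derivative transferred to the weight.
  have key : ∀ i j k, mol (pd i (pd j ψ)) r
        (fun y => fderiv ℝ (B k i) y (EuclideanSpace.single k 1) * S j y) x +
      mol (pd i (pd j ψ)) r (fun y => B k i y * fderiv ℝ (S j) y (EuclideanSpace.single k 1)) x =
      r⁻¹ * mol (pd k (pd i (pd j ψ))) r (fun y => B k i y * S j y) x := by
    intro i j k
    rw [mol_pd_eq (hk i j) ((hB k i).mul (hS j)), inv_mul_cancel_left₀ hr,
      ← mol_add (hk i j) ((cB k i).fun_mul (hS j).continuous) ((hB k i).continuous.fun_mul (cS j k))]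
    congr 1; ext y
    have h1 := ((hB k i).differentiable (by simp) y).hasFDerivAt.fun_mul
      ((hS j).differentiable (by simp) y).hasFDerivAt
    rw [h1.fderiv]
    simp only [add_apply, smul_apply, smul_eq_mul]
    ring
  -- Third derivatives of `ψ` are symmetric in `i` and `k` while `B` is antisymmetric.
  have hzero : ∀ j, ∑ i, ∑ k, mol (pd k (pd i (pd j ψ))) r (fun y => B k i y * S j y) x = 0 := by
    intro j
    have h1 : ∑ i, ∑ k, mol (pd k (pd i (pd j ψ))) r (fun y => B k i y * S j y) x =
        -∑ i, ∑ k, mol (pd k (pd i (pd j ψ))) r (fun y => B k i y * S j y) x := by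
      conv_lhs => rw [Finset.sum_comm]
      rw [← Finset.sum_neg_distrib]
      refine Finset.sum_congr rfl fun k _ => ?_
      rw [← Finset.sum_neg_distrib]
      refine Finset.sum_congr rfl fun i _ => ?_
      rw [(hψ.pd j).pd_comm k i, ← neg_one_mul, ← mol_const_mul]
      congr 1; ext y
      rw [hanti k i]; ring
    linarith
  have e1 : ∀ i j, mol (pd i (pd j ψ)) r (fun y =>
      (∑ k, fderiv ℝ (B k i) y (EuclideanSpace.single k 1)) * S j y) x +
      mol (pd i (pd j ψ)) r (fun y =>
        ∑ k, B k i y * fderiv ℝ (S j) y (EuclideanSpace.single k 1)) x =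
      r⁻¹ * ∑ k, mol (pd k (pd i (pd j ψ))) r (fun y => B k i y * S j y) x := by
    intro i j
    simp only [Finset.sum_mul]
    rw [mol_sum _ (hk i j) fun k => (cB k i).fun_mul (hS j).continuous,
      mol_sum _ (hk i j) fun k => (hB k i).continuous.fun_mul (cS j k), ← Finset.sum_add_distrib,
      Finset.mul_sum]
    exact Finset.sum_congr rfl fun k _ => key i j k
  rw [eq_neg_iff_add_eq_zero, ← Finset.sum_add_distrib]
  simp only [← Finset.sum_add_distrib, e1]
  rw [Finset.sum_comm]
  simp only [← Finset.mul_sum, hzero, mul_zero, Finset.sum_const_zero]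

/-- The antisymmetric matrix whose divergence is the difference of two consecutive averages of the
velocity. -/
noncomputable def antiPotential (ψ : Space n → ℝ) (lam : ℝ) (V : Space n → Space n)
    (k i : Fin n) (x : Space n) : ℝ :=
  mol (pd k ψ) lam (fun y => V y i) x - mol (pd i ψ) lam (fun y => V y k) x

/-- The kernel of the sum of two consecutive averages. -/
noncomputable def sumKernel (ρ : Space n → ℝ) (y : Space n) : ℝ :=
  ρ y + 2 ^ n * ρ ((2 : ℝ) • y)

lemma isKernel_sumKernel (hρ : IsKernel ρ) : IsKernel (sumKernel ρ) :=
  hρ.add ((hρ.comp_smul two_ne_zero).const_mul _)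

/-- By the profile identity the weight is `Δψ + 2ρ`, so its average is the dyadic increment plus
twice the average at scale `lam`. -/
lemma mol_sumKernel (hρ : IsKernel ρ) (hψ : IsKernel ψ)
    (h : ∀ y, ∑ j, pd j (pd j ψ) y = 2 ^ n * ρ ((2 : ℝ) • y) - ρ y) {f : Space n → ℝ}
    (hf : Continuous f) (x : Space n) :
    mol (sumKernel ρ) lam f x = mol ρ (lam / 2) f x + mol ρ lam f x := by
  have h1 := mol_half_sub_mol hρ hψ h hf lam x
  have hk : ∀ j, IsKernel (pd j (pd j ψ)) := fun j => (hψ.pd j).pd j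
  rw [← mol_kernel_sum _ hk hf] at h1
  have hs : IsKernel (fun y => ∑ j, pd j (pd j ψ) y) := by
    simp only [h, sub_eq_add_neg]
    have := ((hρ.comp_smul (two_ne_zero (α := ℝ))).const_mul (2 ^ n)).add (hρ.const_mul (-1))
    simpa using this
  have e : sumKernel ρ = fun y => (∑ j, pd j (pd j ψ) y) + (ρ y + ρ y) := by
    ext y; rw [h, sumKernel]; ring
  rw [e, mol_kernel_add hs (hρ.add hρ) hf, mol_kernel_add hρ hρ hf, ← h1]
  ring

/-- The difference of the quadratic expressions in two consecutive averages of a divergence-free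
velocity, in terms of averages with weights of mean zero. -/
lemma sum_mol_mul_sub (hρ : IsKernel ρ) (hψ : IsKernel ψ)
    (h : ∀ y, ∑ j, pd j (pd j ψ) y = 2 ^ n * ρ ((2 : ℝ) • y) - ρ y) {V : Space n → Space n}
    (hV : ∀ l, Continuous fun y => V y l)
    (hdiv : ∀ κ : Space n → ℝ, IsKernel κ → ∀ r : ℝ, r ≠ 0 → ∀ x,
      ∑ j, mol (pd j κ) r (fun y => V y j) x = 0) (hr : r ≠ 0) (hlam : lam ≠ 0) (x : Space n) :
    ∑ i, ∑ j, mol (pd i (pd j ψ)) r (fun y =>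
      mol ρ (lam / 2) (fun y => V y i) y * mol ρ (lam / 2) (fun y => V y j) y -
        mol ρ lam (fun y => V y i) y * mol ρ lam (fun y => V y j) y) x =
    -∑ i, ∑ j, mol (pd i (pd j ψ)) r (fun y =>
      ∑ k, antiPotential ψ lam V k i y * mol (pd k (sumKernel ρ)) lam (fun y => V y j) y) x := by
  have hk : ∀ i j, IsKernel (pd i (pd j ψ)) := fun i j => (hψ.pd j).pd i
  have hlam2 : lam / 2 ≠ 0 := div_ne_zero hlam two_ne_zero
  set S : Fin n → Space n → ℝ := fun j => mol (sumKernel ρ) lam (fun y => V y j) with hS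
  have hSe : ∀ j y, S j y = mol ρ (lam / 2) (fun y => V y j) y + mol ρ lam (fun y => V y j) y :=
    fun j y => mol_sumKernel hρ hψ h (hV j) y
  have hSc : ∀ j, ContDiff ℝ 1 (S j) := fun j =>
    contDiff_one_mol (isKernel_sumKernel hρ) hlam (hV j)
  have hSd : ∀ j k y, fderiv ℝ (S j) y (EuclideanSpace.single k 1) =
      lam⁻¹ * mol (pd k (sumKernel ρ)) lam (fun y => V y j) y := fun j k y =>
    fderiv_mol_single (isKernel_sumKernel hρ) hlam (hV j) y k
  -- The factor `lam` cancels the `lam⁻¹` from differentiating the averages. It cancels once more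
  -- against the derivative of `S` at the end, so no power of `lam` remains in the identity.
  set B : Fin n → Fin n → Space n → ℝ := fun k i y => lam * antiPotential ψ lam V k i y with hB
  have hBc : ∀ k i, ContDiff ℝ 1 (B k i) := fun k i =>
    contDiff_const.mul ((contDiff_one_mol (hψ.pd k) hlam (hV i)).sub
      (contDiff_one_mol (hψ.pd i) hlam (hV k)))
  have hBd : ∀ k i y, fderiv ℝ (B k i) y (EuclideanSpace.single k 1) =
      mol (pd k (pd k ψ)) lam (fun y => V y i) y - mol (pd k (pd i ψ)) lam (fun y => V y k) y := by
    intro k i y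
    have h1 := (((contDiff_one_mol (hψ.pd k) hlam (hV i)).differentiable (by simp) y).hasFDerivAt.fun_sub
      ((contDiff_one_mol (hψ.pd i) hlam (hV k)).differentiable (by simp) y).hasFDerivAt).const_mul lam
    have h2 : fderiv ℝ (B k i) y = _ := h1.fderiv
    rw [h2, smul_apply, sub_apply, fderiv_mol_single (hψ.pd k) hlam (hV i),
      fderiv_mol_single (hψ.pd i) hlam (hV k), smul_eq_mul, ← mul_sub, mul_inv_cancel_left₀ hlam]
  set w : Fin n → Space n → ℝ := fun i y =>
    mol ρ (lam / 2) (fun y => V y i) y - mol ρ lam (fun y => V y i) y with hw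
  -- The first half of `B` contributes `mol (Δψ)` of `Vᵢ`, which is `w i`; the second half
  -- contributes averages of the divergence of `V`, which vanish.
  have hwB : ∀ i y, w i y = ∑ k, fderiv ℝ (B k i) y (EuclideanSpace.single k 1) := by
    intro i y
    simp only [hBd, Finset.sum_sub_distrib, hdiv _ (hψ.pd i) lam hlam, sub_zero]
    exact mol_half_sub_mol hρ hψ h (hV i) lam y
  have hwc : ∀ i, Continuous (w i) := fun i =>
    (continuous_mol hρ (hV i)).sub (continuous_mol hρ (hV i))
  -- A difference of squares: the quadratic increment is `½(wᵢ Sⱼ + wⱼ Sᵢ)`. Both halves agree after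
  -- summation, by symmetry of `∂ᵢ∂ⱼψ`.
  have e1 : ∀ i j, mol (pd i (pd j ψ)) r (fun y =>
      mol ρ (lam / 2) (fun y => V y i) y * mol ρ (lam / 2) (fun y => V y j) y -
        mol ρ lam (fun y => V y i) y * mol ρ lam (fun y => V y j) y) x =
      1 / 2 * mol (pd i (pd j ψ)) r (fun y => w i y * S j y) x +
        1 / 2 * mol (pd j (pd i ψ)) r (fun y => w j y * S i y) x := by
    intro i j
    rw [hψ.pd_comm j i, ← mul_add, ← mol_add (hk i j) ((hwc i).fun_mul (hSc j).continuous)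
      ((hwc j).fun_mul (hSc i).continuous), ← mol_const_mul]
    congr 1; ext y
    simp only [hSe, hw]; ring
  simp only [e1, Finset.sum_add_distrib, ← Finset.mul_sum]
  rw [Finset.sum_comm (f := fun i j => mol (pd j (pd i ψ)) r (fun y => w j y * S i y) x)]
  simp only [hwB]
  rw [← add_mul, add_halves, one_mul, sum_mol_antisymm hψ hr hBc hSc (fun k i y => by
    simp only [hB, antiPotential]; ring)]
  congr 1
  refine Finset.sum_congr rfl fun i _ => Finset.sum_congr rfl fun j _ => ?_
  congr 1; ext y
  refine Finset.sum_congr rfl fun k _ => ?_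
  rw [hSd]
  simp only [hB]
  field_simp

end DivergenceForm

/-! ### Pressures of averaged velocities and their dyadic increments -/

section Decomposition

variable {n : ℕ} {Γ : Submodule ℤ (Space n)} {ν : Measure (Space n)} {K : Set (Space n)}
  {ρ ψ : Space n → ℝ} {a A lam : ℝ} {V : Space n → Space n}

/-- The pressure of the average of the velocity at scale `lam`. -/
noncomputable def smoothPressure (ρ ψ : Space n → ℝ) (lam : ℝ) (V : Space n → Space n)
    (x : Space n) : ℝ :=
  -∑ i, ∑ j, czSum (pd i (pd j ψ))
    (fun y => mol ρ lam (fun y => V y i) y * mol ρ lam (fun y => V y j) y) x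

/-- The difference of the pressures of two consecutive averages of the velocity. -/
noncomputable def pressureIncrement (ρ ψ : Space n → ℝ) (lam : ℝ) (V : Space n → Space n)
    (x : Space n) : ℝ :=
  ∑ i, ∑ j, czSum (pd i (pd j ψ)) (fun y =>
    ∑ k, antiPotential ψ lam V k i y * mol (pd k (sumKernel ρ)) lam (fun y => V y j) y) x

/-- `sum_mol_mul_sub` holds at each dyadic scale, but only after summation over `i` and `j`. The
finite sums are therefore kept inside the series and the two series are compared term by term. -/
lemma smoothPressure_half (hν : IsPeriodicMean Γ ν K) (hρ : IsKernel ρ) (hψ : IsKernel ψ)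
    (h : ∀ y, ∑ j, pd j (pd j ψ) y = 2 ^ n * ρ ((2 : ℝ) • y) - ρ y) (ha : 0 < a)
    (hV : ∀ l, IsPeriodicHolder Γ a A (fun y => V y l))
    (hdiv : ∀ κ : Space n → ℝ, IsKernel κ → ∀ r : ℝ, r ≠ 0 → ∀ x,
      ∑ j, mol (pd j κ) r (fun y => V y j) x = 0) (hlam : lam ≠ 0) (x : Space n) :
    smoothPressure ρ ψ (lam / 2) V x - smoothPressure ρ ψ lam V x =
      pressureIncrement ρ ψ lam V x := by
  have hk : ∀ i j, IsKernel (pd i (pd j ψ)) := fun i j => (hψ.pd j).pd i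
  have hk0 : ∀ i j, ∫ y, pd i (pd j ψ) y = 0 := fun i j => (hψ.pd j).integral_pd i
  have hm : ∀ (lam : ℝ) (i j : Fin n), IsPeriodicHolder Γ a _ (fun y =>
      mol ρ lam (fun y => V y i) y * mol ρ lam (fun y => V y j) y) := fun lam i j =>
    ((hV i).mol hρ ha lam).mul ((hV j).mol hρ ha lam)
  have hR : ∀ i j : Fin n, IsPeriodicHolder Γ a _ (fun y =>
      ∑ k, antiPotential ψ lam V k i y * mol (pd k (sumKernel ρ)) lam (fun y => V y j) y) :=
    fun i j => IsPeriodicHolder.sum Finset.univ fun k =>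
      (((hV i).mol (hψ.pd k) ha lam).sub ((hV k).mol (hψ.pd i) ha lam)).mul
        ((hV j).mol ((isKernel_sumKernel hρ).pd k) ha lam)
  have h1 : smoothPressure ρ ψ (lam / 2) V x - smoothPressure ρ ψ lam V x =
      -∑ i, ∑ j, czSum (pd i (pd j ψ)) (fun y =>
        mol ρ (lam / 2) (fun y => V y i) y * mol ρ (lam / 2) (fun y => V y j) y -
        mol ρ lam (fun y => V y i) y * mol ρ lam (fun y => V y j) y) x := by
    simp only [fun i j => czSum_sub hν (hk i j) (hk0 i j) ha (hm (lam / 2) i j) (hm lam i j) x,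
      Finset.sum_sub_distrib, smoothPressure]
    ring
  have hs1 : HasSum (fun k : ℤ => ∑ i, ∑ j, mol (pd i (pd j ψ)) ((2 : ℝ) ^ (-k)) (fun y =>
        mol ρ (lam / 2) (fun y => V y i) y * mol ρ (lam / 2) (fun y => V y j) y -
        mol ρ lam (fun y => V y i) y * mol ρ lam (fun y => V y j) y) x)
      (∑ i, ∑ j, czSum (pd i (pd j ψ)) (fun y =>
        mol ρ (lam / 2) (fun y => V y i) y * mol ρ (lam / 2) (fun y => V y j) y -
        mol ρ lam (fun y => V y i) y * mol ρ lam (fun y => V y j) y) x) :=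
    hasSum_sum fun i _ => hasSum_sum fun j _ => (summable_mol_dyadic hν (hk i j) (hk0 i j) ha
      ((hm (lam / 2) i j).sub (hm lam i j)) x).hasSum
  have hs2 : HasSum (fun k : ℤ => ∑ i, ∑ j, mol (pd i (pd j ψ)) ((2 : ℝ) ^ (-k)) (fun y =>
        ∑ k, antiPotential ψ lam V k i y * mol (pd k (sumKernel ρ)) lam (fun y => V y j) y) x)
      (pressureIncrement ρ ψ lam V x) :=
    hasSum_sum fun i _ => hasSum_sum fun j _ => (summable_mol_dyadic hν (hk i j) (hk0 i j) ha
      (hR i j) x).hasSum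
  have hr : ∀ k : ℤ, (2 : ℝ) ^ (-k) ≠ 0 := fun k => zpow_ne_zero _ two_ne_zero
  simp only [fun k => sum_mol_mul_sub hρ hψ h (fun l => (hV l).continuous ha) hdiv (hr k) hlam x]
    at hs1
  rw [h1, hs1.unique hs2.neg, neg_neg]

/-- The pressures of the averages of the velocity converge to the pressure. -/
lemma tendsto_smoothPressure (hν : IsPeriodicMean Γ ν K) (hρ : IsKernel ρ) (hψ : IsKernel ψ)
    (hρ1 : ∫ y, ρ y = 1) (ha : 0 < a) (hV : ∀ l, IsPeriodicHolder Γ a A (fun y => V y l))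
    {r : ℕ → ℝ} (hr0 : ∀ m, 0 < r m) (hr : Tendsto r atTop (𝓝 0)) (x : Space n) :
    Tendsto (fun m => smoothPressure ρ ψ (r m) V x) atTop
      (𝓝 (-∑ i, ∑ j, czSum (pd i (pd j ψ)) (fun y => V y i * V y j) x)) := by
  refine (tendsto_finsetSum _ fun i _ => tendsto_finsetSum _ fun j _ => ?_).neg
  have hk : IsKernel (pd i (pd j ψ)) := (hψ.pd j).pd i
  have hk0 : ∫ y, pd i (pd j ψ) y = 0 := (hψ.pd j).integral_pd i
  have hA := (hV i).nonneg
  have hρ0 : 0 ≤ ∫ y, |ρ y| := integral_nonneg fun _ => abs_nonneg _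
  have hm0 := absMoment_nonneg a ρ
  set Q : ℝ := 2 * ((∫ y, |ρ y|) * A * ((∫ y, |ρ y|) * A)) + 2 * (A * A) +
    ((∫ y, |ρ y|) * A * (absMoment a ρ * A) + absMoment a ρ * A * A) with hQ
  have hQ0 : 0 ≤ Q := by positivity
  -- Uniform convergence of the products does not control `czSum`. Interpolating the supremum error
  -- `r^a` with the bounded `a`-Hölder norms gives convergence in `C^(a/2)`, for scales at most one.
  have hD : ∀ m, IsPeriodicHolder Γ (a / 2) (2 * Q * r m ^ (a / 2)) (fun y =>
      mol ρ (r m) (fun y => V y i) y * mol ρ (r m) (fun y => V y j) y - V y i * V y j) ∨ 1 < r m := by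
    intro m
    rcases lt_or_ge 1 (r m) with h1 | h1
    · exact Or.inr h1
    left
    have hrp := hr0 m
    have hH := (((hV i).mol hρ ha (r m)).mul ((hV j).mol hρ ha (r m))).sub ((hV i).mul (hV j))
    have happ : ∀ l y, |mol ρ (r m) (fun y => V y l) y - V y l| ≤ absMoment a ρ * A * r m ^ a := by
      intro l y
      have := norm_mol_sub_le (r := r m) hρ ha.le ((hV l).continuous ha) (hV l).holder y
      rwa [hρ1, one_smul, abs_of_pos hrp, Real.norm_eq_abs, ← mul_assoc] at this
    have hb : ∀ y, |mol ρ (r m) (fun y => V y i) y * mol ρ (r m) (fun y => V y j) y -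
        V y i * V y j| ≤ Q * r m ^ a := by
      intro y
      have e : mol ρ (r m) (fun y => V y i) y * mol ρ (r m) (fun y => V y j) y - V y i * V y j =
          mol ρ (r m) (fun y => V y i) y * (mol ρ (r m) (fun y => V y j) y - V y j) +
          (mol ρ (r m) (fun y => V y i) y - V y i) * V y j := by ring
      rw [e]
      refine (abs_add_le _ _).trans ?_
      rw [abs_mul, abs_mul]
      have h1 := mul_le_mul (((hV i).mol hρ ha (r m)).bound y) (happ j y) (abs_nonneg _)
        (by positivity)
      have h2 := mul_le_mul (happ i y) ((hV j).bound y) (abs_nonneg _) (by positivity)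
      have h3 : 0 ≤ (2 * ((∫ y, |ρ y|) * A * ((∫ y, |ρ y|) * A)) + 2 * (A * A)) * r m ^ a := by
        positivity
      rw [hQ]; linarith
    refine ⟨fun y => (hb y).trans ?_, fun y z => ?_, hH.periodic⟩
    · have h2 : r m ^ a ≤ r m ^ (a / 2) :=
        Real.rpow_le_rpow_of_exponent_ge hrp h1 (by linarith)
      have h3 : 0 ≤ Q * r m ^ (a / 2) := by positivity
      have h4 := mul_le_mul_of_nonneg_left h2 hQ0
      linarith
    · have := abs_sub_le_of_interpolation (X := Q) (d := r m) (s := a) (s' := a / 2)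
        (by positivity) (by linarith) hrp.le hb (fun y z => (hH.holder y z).trans ?_) hQ0 y z
      · rwa [sub_half] at this
      · refine mul_le_mul_of_nonneg_right ?_ (by positivity)
        have h3 : 0 ≤ (∫ y, |ρ y|) * A * (absMoment a ρ * A) + absMoment a ρ * A * A := by
          positivity
        have h4 : 0 ≤ 2 * ((∫ y, |ρ y|) * A * ((∫ y, |ρ y|) * A)) + 2 * (A * A) := by positivity
        rw [hQ]; linarith
  rw [tendsto_iff_norm_sub_tendsto_zero]
  have hlim : Tendsto (fun m => czConst ν (a / 2) (pd i (pd j ψ)) * (2 * Q * r m ^ (a / 2))) atTop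
      (𝓝 0) := by
    have h1 := hr.rpow_const (p := a / 2) (Or.inr (by positivity))
    rw [Real.zero_rpow (by positivity)] at h1
    simpa using (h1.const_mul (2 * Q)).const_mul (czConst ν (a / 2) (pd i (pd j ψ)))
  refine squeeze_zero' (Eventually.of_forall fun _ => norm_nonneg _) ?_ hlim
  filter_upwards [hr.eventually (gt_mem_nhds one_pos)] with m hm
  have hD' := (hD m).resolve_right (not_lt.2 hm.le)
  rw [← czSum_sub hν hk hk0 ha (((hV i).mol hρ ha (r m)).mul ((hV j).mol hρ ha (r m)))
    ((hV i).mul (hV j)), Real.norm_eq_abs]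
  exact abs_czSum_le hν hk hk0 (by positivity) hD' x

end Decomposition

/-! ### Regularity of the pressure from its dyadic series -/

section Series

variable {n : ℕ} {I : Opens ℝ} {Γ : Submodule ℤ (Space n)} {ν : Measure (Space n)}
  {K : Set (Space n)} {θ s a A M b c ε lam : ℝ} {v : ℝ → Space n → Space n}
  {f : ℝ → Space n → ℝ} {ρ ψ : Space n → ℝ}

/-- Below distance `lam` powers of `d / lam ≤ 1` are compared; beyond it the bound `2A` suffices. -/
lemma IsScaled.of_exponent_le (hf : IsScaled Γ I θ A lam f) (hs : 0 ≤ s) (hsθ : s ≤ θ)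
    (hlam : 0 < lam) : IsScaled Γ I s (2 * A) lam f where
  nonneg := by have := hf.nonneg; positivity
  bound t ht x := (hf.bound t ht x).trans (by linarith [hf.nonneg])
  holder t ht t' ht' x x' := by
    have hA := hf.nonneg
    set d := |t - t'| + ‖x - x'‖ with hd
    have hd0 : 0 ≤ d := by positivity
    have e : ∀ q : ℝ, lam ^ (-q) * d ^ q = (d / lam) ^ q := fun q => by
      rw [Real.div_rpow hd0 hlam.le, Real.rpow_neg hlam.le]; field_simp
    have h1 := hf.holder t ht t' ht' x x'
    rw [mul_assoc, e] at h1 ⊢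
    rcases le_total 1 (d / lam) with h | h
    · have h2 := Real.one_le_rpow h hs
      have h3 := abs_sub (f t x) (f t' x')
      have h4 := hf.bound t ht x
      have h5 := hf.bound t' ht' x'
      nlinarith
    · have h2 : (d / lam) ^ θ ≤ (d / lam) ^ s :=
        Real.rpow_le_rpow_of_exponent_ge' (by positivity) h hs hsθ
      have h3 : 0 ≤ (d / lam) ^ s := by positivity
      nlinarith
  periodic := hf.periodic

lemma half_pow_rpow (m : ℕ) (c : ℝ) : (((1 : ℝ) / 2) ^ m) ^ c = ((1 / 2 : ℝ) ^ c) ^ m := by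
  rw [← Real.rpow_natCast, ← Real.rpow_mul (by norm_num), mul_comm,
    Real.rpow_mul (by norm_num), Real.rpow_natCast]

lemma summable_half_pow_rpow (hc : 0 < c) (M : ℝ) :
    Summable fun m : ℕ => M * (((1 : ℝ) / 2) ^ m) ^ c := by
  simp only [half_pow_rpow]
  exact (summable_geometric_of_lt_one (by positivity)
    (Real.rpow_lt_one (by norm_num) (by norm_num) hc)).mul_left M

/-- Sums of functions that vary at dyadic scales. -/
lemma exists_isScaled_tsum {g : ℕ → ℝ → Space n → ℝ} (hs : 0 ≤ s) (hsc : s < c)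
    (hg : ∀ m, IsScaled Γ I s (M * (((1 : ℝ) / 2) ^ m) ^ c) ((1 / 2) ^ m) (g m)) :
    ∃ C, IsScaled Γ I s C 1 (fun t x => ∑' m, g m t x) := by
  have hM : 0 ≤ M := by simpa using (hg 0).nonneg
  have hsum : ∀ t ∈ I, ∀ x, Summable fun m => g m t x := fun t ht x =>
    Summable.of_norm_bounded (summable_half_pow_rpow (hs.trans_lt hsc) M)
      fun m => (hg m).bound t ht x
  have h0 := summable_half_pow_rpow (hs.trans_lt hsc) M
  have h1 := summable_half_pow_rpow (sub_pos.2 hsc) M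
  have hn0 : 0 ≤ ∑' m : ℕ, M * (((1 : ℝ) / 2) ^ m) ^ c := tsum_nonneg fun m => by positivity
  have hn1 : 0 ≤ ∑' m : ℕ, M * (((1 : ℝ) / 2) ^ m) ^ (c - s) := tsum_nonneg fun m => by positivity
  refine ⟨∑' m : ℕ, M * (((1 : ℝ) / 2) ^ m) ^ c + ∑' m : ℕ, M * (((1 : ℝ) / 2) ^ m) ^ (c - s),
    by positivity, fun t ht x => ?_, fun t ht t' ht' x x' => ?_, fun t ht γ hγ x => ?_⟩
  · have := tsum_of_norm_bounded (f := fun m => g m t x) h0.hasSum fun m => (hg m).bound t ht x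
    rw [Real.norm_eq_abs] at this
    linarith
  · rw [Real.one_rpow, mul_one, ← (hsum t ht x).tsum_sub (hsum t' ht' x')]
    -- The seminorm at scale `2⁻ᵐ` costs `2^(ms)`, so the exponent `c - s > 0` is what remains for
    -- convergence.
    have := tsum_of_norm_bounded (f := fun m => g m t x - g m t' x')
      (h1.mul_right ((|t - t'| + ‖x - x'‖) ^ s)).hasSum fun m => by
        have h2 := (hg m).holder t ht t' ht' x x'
        have hp : (0 : ℝ) < (1 / 2) ^ m := by positivity
        rwa [mul_assoc M, ← Real.rpow_add hp, ← sub_eq_add_neg] at h2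
    rw [Real.norm_eq_abs, tsum_mul_right] at this
    refine this.trans (mul_le_mul_of_nonneg_right ?_ (by positivity))
    linarith
  · simp only [(hg _).periodic t ht γ hγ]

/-- Data for the regularity of the pressure: a dyadic decomposition into smooth pieces. -/
lemma exists_pressure_decomposition (hI : (I : Set ℝ).OrdConnected)
    (hν : IsPeriodicMean Γ ν K) (hρ : IsKernel ρ) (hψ : IsKernel ψ) (hρ1 : ∫ y, ρ y = 1)
    (hρψ : ∀ y, ∑ j, pd j (pd j ψ) y = 2 ^ n * ρ ((2 : ℝ) • y) - ρ y)
    (h : IsHolderEuler Γ I a A v (pressure ψ v)) (ha1 : a ≤ 1) (hε : 0 < ε) (hθ : 0 ≤ θ)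
    (hθa : θ + ε ≤ a) :
    ∃ (M : ℝ) (q : ℝ → Space n → ℝ) (g : ℕ → ℝ → Space n → ℝ), IsScaledC1 Γ I θ M 1 q ∧
      (∀ m, IsScaledC1 Γ I θ (M * (((1 : ℝ) / 2) ^ m) ^ (2 * a - ε)) ((1 / 2) ^ m) (g m)) ∧
      ∀ t ∈ I, ∀ x, HasSum (fun m => g m t x) (pressure ψ v t x - q t x) := by
  have ha : 0 < a := by linarith
  have hk : ∀ i j, IsKernel (pd i (pd j ψ)) := fun i j => (hψ.pd j).pd i
  have hk0 : ∀ i j, ∫ y, pd i (pd j ψ) y = 0 := fun i j => (hψ.pd j).integral_pd i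
  have hθε : 0 ≤ θ + ε := by linarith
  have hσ := isKernel_sumKernel hρ
  -- The doubling of the exponent: both factors of the increment are averages with weights of mean
  -- zero, of size `lam^a` each. They are taken with exponent `θ + ε`, to be lowered to `θ` by
  -- `czSum`.
  obtain ⟨M₁, hM₁⟩ : IsScaledFamily Γ I (θ + ε - ε) (a + a - ε)
      (fun lam t => pressureIncrement ρ ψ lam (v t)) := by
    refine IsScaledFamily.sum Finset.univ fun i => IsScaledFamily.sum Finset.univ fun j =>
      IsScaledFamily.czSum hI hν (hk i j) (hk0 i j) ?_ hε (by linarith) (by linarith)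
    exact IsScaledFamily.sum Finset.univ fun k => IsScaledFamily.mul hI
      ((h.isScaledFamily_mol ha hθε hθa (hψ.pd k) (hψ.integral_pd k) i).sub
        (h.isScaledFamily_mol ha hθε hθa (hψ.pd i) (hψ.integral_pd i) k))
      (h.isScaledFamily_mol ha hθε hθa (hσ.pd k) (hσ.integral_pd k) j) hθε (by linarith)
  obtain ⟨M₀, hM₀⟩ := h.exists_isScaledC1_mol ha hθε hθa hρ
  -- The low-frequency part is the pressure of the average at scale one. As `ρ` does not have mean
  -- zero, the alternative `lam = 1` is used.
  have hU := hM₀ 1 one_pos (Or.inr rfl)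
  have hq := (IsScaledC1.sum Finset.univ fun i => IsScaledC1.sum Finset.univ fun j =>
    ((hU i).mul hI (hU j) one_pos hθε (by linarith)).czSum hI hν (hk i j) (hk0 i j) hε
      (by linarith) (by linarith) one_pos le_rfl).const_mul (-1)
  obtain ⟨M₂, hM₂⟩ : ∃ M₂, IsScaledC1 Γ I (θ + ε - ε) M₂ 1
      (fun t => smoothPressure ρ ψ 1 (v t)) := ⟨_, hq.congr fun t ht x => by
    simp only [smoothPressure, neg_one_mul]⟩
  rw [add_sub_cancel_right] at hM₁ hM₂
  have hg : ∀ m : ℕ, IsScaledC1 Γ I θ (max M₁ M₂ * (((1 : ℝ) / 2) ^ m) ^ (2 * a - ε)) ((1 / 2) ^ m)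
      (fun t => pressureIncrement ρ ψ ((1 / 2) ^ m) (v t)) := by
    intro m
    have hp : (0 : ℝ) < (1 / 2) ^ m := by positivity
    refine (hM₁ ((1 / 2) ^ m) hp (pow_le_one₀ (by norm_num) (by norm_num))).mono hp ?_
    rw [← two_mul]
    exact mul_le_mul_of_nonneg_right (le_max_left _ _) (by positivity)
  refine ⟨max M₁ M₂, _, _, hM₂.mono one_pos (le_max_right _ _), hg, fun t ht x => ?_⟩
  have hV : ∀ l, IsPeriodicHolder Γ a A (fun y => v t y l) := fun l =>
    ⟨(h.velocity l).bound t ht, fun x y => by simpa using (h.velocity l).slice ht x y,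
      (h.velocity l).periodic t ht⟩
  have hsum : Summable fun m : ℕ => pressureIncrement ρ ψ ((1 / 2) ^ m) (v t) x := by
    refine Summable.of_norm_bounded (summable_half_pow_rpow (by linarith : 0 < 2 * a - ε)
      (max M₁ M₂)) fun m => ?_
    obtain ⟨_, _, -, hb, -⟩ := hg m
    exact hb t ht x
  rw [hsum.hasSum_iff_tendsto_nat]
  have hstep : ∀ m : ℕ, pressureIncrement ρ ψ ((1 / 2) ^ m) (v t) x =
      smoothPressure ρ ψ ((1 / 2) ^ (m + 1)) (v t) x - smoothPressure ρ ψ ((1 / 2) ^ m) (v t) x := by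
    intro m
    have hp : ((1 : ℝ) / 2) ^ m ≠ 0 := by positivity
    rw [← smoothPressure_half hν hρ hψ hρψ ha hV
      (fun κ hκ r hr x => h.divergence_free κ hκ r hr t ht x) hp, pow_succ, mul_one_div]
  -- Partial sums telescope to the difference of the averaged pressures at the scales `2⁻ᴺ` and `1`.
  simp only [hstep]
  simp only [fun N => Finset.sum_range_sub
    (fun m : ℕ => smoothPressure ρ ψ ((1 / 2) ^ m) (v t) x) N, pow_zero]
  refine Tendsto.sub_const ?_ _
  exact tendsto_smoothPressure hν hρ hψ hρ1 ha hV (r := fun m => (1 / 2) ^ m)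
    (fun m => by positivity) (tendsto_pow_atTop_nhds_zero_of_lt_one (by norm_num) (by norm_num)) x

/-- Double Hölder regularity of the pressure. -/
lemma exists_isScaled_of_decomposition (hI : (I : Set ℝ).OrdConnected) {q P : ℝ → Space n → ℝ}
    {g : ℕ → ℝ → Space n → ℝ} (hq : IsScaledC1 Γ I θ M 1 q)
    (hg : ∀ m, IsScaledC1 Γ I θ (M * (((1 : ℝ) / 2) ^ m) ^ b) ((1 / 2) ^ m) (g m))
    (hP : ∀ t ∈ I, ∀ x, HasSum (fun m => g m t x) (P t x - q t x)) (hs : 0 ≤ s) (hs1 : s ≤ 1)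
    (hsb : s < b) : ∃ C, IsScaled Γ I s C 1 P := by
  obtain ⟨C, hC⟩ := exists_isScaled_tsum (M := 2 * ((n + 1) * M)) hs hsb fun m => by
    have := (hg m).isScaled hI (by positivity) hs hs1
    rwa [← mul_assoc, ← mul_assoc, mul_assoc 2] at this
  exact ⟨_, ((hq.isScaled hI one_pos hs hs1).add hC).congr fun t ht x => by
    rw [(hP t ht x).tsum_eq]; ring⟩

/-- Differentiability of the pressure. -/
lemma exists_hasPartials_of_decomposition (hI : (I : Set ℝ).OrdConnected)
    {q P : ℝ → Space n → ℝ} {g : ℕ → ℝ → Space n → ℝ} (hq : IsScaledC1 Γ I θ M 1 q)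
    (hg : ∀ m, IsScaledC1 Γ I θ (M * (((1 : ℝ) / 2) ^ m) ^ b) ((1 / 2) ^ m) (g m))
    (hP : ∀ t ∈ I, ∀ x, HasSum (fun m => g m t x) (P t x - q t x)) (hθ : 0 ≤ θ)
    (hθb : θ < b - 1) : ∃ (C : ℝ) (Pt : ℝ → Space n → ℝ) (Px : Fin n → ℝ → Space n → ℝ),
      HasPartials I P Pt Px ∧ IsScaled Γ I θ C 1 Pt ∧ ∀ j, IsScaled Γ I θ C 1 (Px j) := by
  have hM : 0 ≤ M := hq.nonneg one_pos
  obtain ⟨qt, qx, hqd, -, -, hqt, hqx⟩ := hq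
  choose gt gx hgd hgb hgper hgt hgx using hg
  -- A derivative costs the inverse of the scale, so the exponent drops from `b` to `b - 1`.
  have e : ∀ m : ℕ, M * (((1 : ℝ) / 2) ^ m) ^ b / (1 / 2) ^ m =
      M * (((1 : ℝ) / 2) ^ m) ^ (b - 1) := fun m => by
    rw [Real.rpow_sub_one (by positivity), mul_div_assoc]
  simp only [e] at hgt hgx
  have hle : ∀ m : ℕ, M * (((1 : ℝ) / 2) ^ m) ^ b ≤ M * (((1 : ℝ) / 2) ^ m) ^ (b - 1) := fun m =>
    mul_le_mul_of_nonneg_left (Real.rpow_le_rpow_of_exponent_ge (by positivity)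
      (pow_le_one₀ (by norm_num) (by norm_num)) (by linarith)) hM
  have hd := HasPartials.tsum hI (summable_half_pow_rpow (hθ.trans_lt hθb) M) hgd
    (fun m t ht x => (hgb m t ht x).trans (hle m)) (fun m => (hgt m).bound)
    (fun m j => (hgx m j).bound)
  obtain ⟨C, hC⟩ := exists_isScaled_tsum hθ hθb hgt
  choose C' hC' using fun j => exists_isScaled_tsum hθ hθb fun m => hgx m j
  have hC'0 : ∀ j, 0 ≤ C' j := fun j => (hC' j).nonneg
  have hM1 : 0 ≤ M / 1 := by rwa [div_one]
  refine ⟨M / 1 + (C + ∑ j, C' j), _, _, (hqd.add hd).congr fun t ht x => ?_,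
    (hqt.add hC).mono one_pos ?_, fun j => ((hqx j).add (hC' j)).mono one_pos ?_⟩
  · rw [(hP t ht x).tsum_eq]; ring
  · have := Finset.sum_nonneg fun j (_ : j ∈ Finset.univ) => hC'0 j
    linarith
  · have := Finset.single_le_sum (fun j _ => hC'0 j) (Finset.mem_univ j)
    have := hC.nonneg
    linarith

end Series

/-! ### From scaled estimates to the Hölder classes of the theorem -/

section Conclusion

variable {n : ℕ} {I : Opens ℝ} {Γ : Submodule ℤ (Space n)} {s C : ℝ} {f ft : ℝ → Space n → ℝ}
  {fx : Fin n → ℝ → Space n → ℝ}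

lemma IsScaled.continuousOn (h : IsScaled Γ I s C 1 f) (hs : 0 < s) :
    ContinuousOn (fun z : ℝ × Space n => f z.1 z.2) (slab n I : Set (ℝ × Space n)) :=
  continuousOn_of_holder (C := C) hs fun t ht t' ht' x x' => by
    simpa using h.holder t ht t' ht' x x'

lemma IsScaled.memHolderTX (h : IsScaled Γ I s C 1 f) (hs : s = 1 →
    ContDiffOn ℝ 1 (fun z : ℝ × Space n => f z.1 z.2) (slab n I : Set (ℝ × Space n))) :
    MemHolderTX s I f where
  bounded := ⟨C, h.bound⟩
  holder := ⟨C, fun t ht t' ht' x x' => by simpa using h.holder t ht t' ht' x x'⟩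
  contDiff_of_eq_one := hs

lemma memHolderTX_vector (hs : s < 1) (h : ∀ j, IsScaled Γ I s C 1 (fx j)) :
    MemHolderTX s I (fun t x => (WithLp.toLp 2 fun j => fx j t x : Space n)) where
  bounded := ⟨n * C, fun t ht x => norm_le_of_forall_abs_le fun j => (h j).bound t ht x⟩
  holder := ⟨n * C, fun t ht t' ht' x x' => by
    rw [mul_assoc]
    refine norm_le_of_forall_abs_le fun j => ?_
    simpa using (h j).holder t ht t' ht' x x'⟩
  contDiff_of_eq_one h1 := absurd h1 hs.ne

lemma HasPartials.hasGradientAt (h : HasPartials I f ft fx) {t : ℝ} (ht : t ∈ I) (x : Space n) :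
    HasGradientAt (f t) (WithLp.toLp 2 fun j => fx j t x) x := by
  rw [hasGradientAt_iff_hasFDerivAt]
  refine (h.space t ht x).congr_fderiv ?_
  ext y
  rw [covector_apply, InnerProductSpace.toDual_apply_apply, PiLp.inner_apply]
  exact Finset.sum_congr rfl fun j _ => by simp [mul_comm]

/-- Jointly continuous partial derivatives imply differentiability in space-time, with a continuous
derivative. -/
lemma HasPartials.contDiffOn (h : HasPartials I f ft fx)
    (hft : ContinuousOn (fun z : ℝ × Space n => ft z.1 z.2) (slab n I : Set (ℝ × Space n)))
    (hfx : ∀ j, ContinuousOn (fun z : ℝ × Space n => fx j z.1 z.2)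
      (slab n I : Set (ℝ × Space n))) :
    ContDiffOn ℝ 1 (fun z : ℝ × Space n => f z.1 z.2) (slab n I : Set (ℝ × Space n)) := by
  have ho := (slab n I).isOpen
  set f₁ : ℝ → Space n → ℝ →L[ℝ] ℝ := fun t x => ContinuousLinearMap.toSpanSingleton ℝ (ft t x)
  set f₂ : ℝ → Space n → Space n →L[ℝ] ℝ := fun t x => covector fun j => fx j t x
  have hc1 : ContinuousOn (fun z : ℝ × Space n => f₁ z.1 z.2) (slab n I : Set (ℝ × Space n)) :=
    (ContinuousLinearMap.toSpanSingletonCLE (𝕜 := ℝ) (E := ℝ)).continuous.comp_continuousOn hft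
  have hc2 : ContinuousOn (fun z : ℝ × Space n => f₂ z.1 z.2) (slab n I : Set (ℝ × Space n)) :=
    continuousOn_finsetSum _ fun j _ => (hfx j).smul continuousOn_const
  have hd : ∀ z ∈ (slab n I : Set (ℝ × Space n)), HasFDerivAt (fun z : ℝ × Space n => f z.1 z.2)
      ((f₁ z.1 z.2).coprod (f₂ z.1 z.2)) z := by
    intro z hz
    have hn := ho.mem_nhds hz
    exact (hasStrictFDerivAt_uncurry_coprod (f := f) (f₁ := f₁) (f₂ := f₂)
      (by filter_upwards [hn] with y hy using (h.time y.1 hy.1 y.2).hasFDerivAt)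
      (by filter_upwards [hn] with y hy using h.space y.1 hy.1 y.2)
      (hc1.continuousAt hn) (hc2.continuousAt hn)).hasFDerivAt
  intro z hz
  refine ContDiffAt.contDiffWithinAt ?_
  rw [contDiffAt_one_iff]
  refine ⟨fun z => (f₁ z.1 z.2).coprod (f₂ z.1 z.2), _, ho.mem_nhds hz, ?_, hd⟩
  exact (ContinuousLinearMap.coprodEquivL (𝕜 := ℝ) (E := ℝ) (F := Space n) (G := ℝ) ℝ).continuous.comp_continuousOn
    (hc1.prodMk hc2)

lemma isRepresentedBy_of_forall {p : 𝓓'(slab n I, ℝ)} (hs : 0 < s) (h : IsScaled Γ I s C 1 f)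
    (hp : ∀ φ : 𝓓(slab n I, ℝ), p φ = ∫ z : ℝ × Space n, f z.1 z.2 * φ z) :
    IsRepresentedBy p f :=
  ⟨(h.continuousOn hs).locallyIntegrableOn (slab n I).isOpen.measurableSet, fun φ => by
    rw [hp, setIntegral_slab_mul_test (fun z => f z.1 z.2)]⟩

end Conclusion

/-! ### Joint regularity of the version and of its pressure -/

section Assembly

variable {n : ℕ} {I : Opens ℝ} {Γ : Submodule ℤ (Space n)} {ν : Measure (Space n)}
  {K : Set (Space n)} {α B C a : ℝ} {V : ℝ → Space n → Space n} {p : 𝓓'(slab n I, ℝ)}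
  {ψ : Space n → ℝ}

lemma IsUniformlyHolder.isScaled_apply (hV : IsUniformlyHolder Γ α B V)
    (hh : ∀ t ∈ I, ∀ t' ∈ I, ∀ x x', ‖V t x - V t' x'‖ ≤ B * (|t - t'| + ‖x - x'‖) ^ α)
    (l : Fin n) : IsScaled Γ I α B 1 (fun t x => V t x l) where
  nonneg := hV.nonneg
  bound t _ x := (PiLp.norm_apply_le (V t x) l).trans (hV.bound t x)
  holder t ht t' ht' x x' := by
    rw [Real.one_rpow, mul_one]
    exact (PiLp.norm_apply_le (V t x - V t' x') l).trans (hh t ht t' ht' x x')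
  periodic t _ γ hγ x := by rw [hV.periodic t γ hγ]

/-- The products `vⁱvʲ` are jointly `α`-Hölder and `czSum` gives up `α - a` of the exponent. This
first joint estimate lets the momentum equation for the averages hold classically. -/
lemma exists_isScaled_pressure (hν : IsPeriodicMean Γ ν K) (hψ : IsKernel ψ)
    (hV : ∀ l, IsScaled Γ I α B 1 (fun t x => V t x l)) (ha : a < α) (ha0 : 0 ≤ a) :
    ∃ A, IsScaled Γ I a A 1 (pressure ψ V) := by
  have h := (IsScaled.sum Finset.univ fun i => IsScaled.sum Finset.univ fun j =>
    isScaled_czSum (ε := α - a) hν ((hψ.pd j).pd i) ((hψ.pd j).integral_pd i)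
      ((hV i).mul (hV j) one_pos) (by linarith) (by linarith) one_pos le_rfl).const_mul (-1)
  rw [sub_sub_cancel] at h
  exact ⟨_, h.congr fun t _ x => by rw [pressure, neg_one_mul]⟩

lemma exists_isHolderEuler (hν : IsPeriodicMean Γ ν K) (hψ : IsKernel ψ)
    (hE : IsPairedEulerSolution V p) (hV : IsUniformlyHolder Γ α B V)
    (hh : ∀ t ∈ I, ∀ t' ∈ I, ∀ x x', ‖V t x - V t' x'‖ ≤ B * (|t - t'| + ‖x - x'‖) ^ α)
    (hP : IsUniformlyHolder Γ α C (pressure ψ V))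
    (hp : ∀ φ : 𝓓(slab n I, ℝ), p φ = ∫ z : ℝ × Space n, pressure ψ V z.1 z.2 * φ z)
    (ha : a < α) (ha0 : 0 < a) : ∃ A, IsHolderEuler Γ I a A V (pressure ψ V) := by
  have hvs := hV.isScaled_apply hh
  obtain ⟨A, hA⟩ := exists_isScaled_pressure hν hψ hvs ha ha0.le
  have hva : ∀ l, IsScaled Γ I a (2 * B) 1 (fun t x => V t x l) := fun l =>
    (hvs l).of_exponent_le ha0.le ha.le one_pos
  exact ⟨max (2 * B) A, fun l => (hva l).mono one_pos (le_max_left _ _),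
    hA.mono one_pos (le_max_right _ _),
    fun κ hκ r hr l t ht x => hasDerivAt_mol_velocity hE hV hP hp ha0 hva hA hκ hr l ht x,
    fun κ hκ r hr t ht x => sum_mol_pd_eq_zero hE hV ha0 hva hκ hr ht x⟩

end Assembly

end EulerReg

/-! ### The main theorem -/

theorem theorem1p1 (n : ℕ) (hn : 2 ≤ n)
    (Γ : Submodule ℤ (EulerReg.Space n)) [DiscreteTopology Γ] [IsZLattice ℝ Γ]
    (I : TopologicalSpace.Opens ℝ) (hI : (I : Set ℝ).OrdConnected)
    (α β : ℝ) (hβ : 0 < β) (hβα : β < α) (hα : α < 1)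
    (v : ℝ → EulerReg.Space n → EulerReg.Space n)
    (p : Distribution (EulerReg.slab n I) ℝ ⊤)
    (hv_per : EulerReg.IsPeriodic Γ I v)
    (hp_per : EulerReg.IsPeriodicDistribution Γ p)
    (hv : EulerReg.MemLinftyHolder α I v)
    (hEuler : EulerReg.IsWeakEulerSolution I v p)
    (hp_mean : EulerReg.HasMeanZero Γ p) :
    -- `v` has a version in `C^α_{t,x}`
    (∃ V : ℝ → EulerReg.Space n → EulerReg.Space n,
      EulerReg.MemHolderTX α I V ∧ EulerReg.IsPeriodic Γ I V ∧
        ∀ᵐ t ∂(MeasureTheory.volume.restrict (I : Set ℝ)), ∀ x, v t x = V t x) ∧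
    -- `v` itself is in `C^α_{t,x}` if it is continuous in time, as in the case `v ∈ C_t C^α_x`
    ((∀ x, ContinuousOn (fun t => v t x) (I : Set ℝ)) → EulerReg.MemHolderTX α I v) ∧
    -- `p ∈ C^{2β}_{t,x}` if `β ≤ 1/2`
    (β ≤ 1 / 2 → ∃ P : ℝ → EulerReg.Space n → ℝ,
      EulerReg.IsRepresentedBy p P ∧ EulerReg.IsPeriodic Γ I P ∧
        EulerReg.MemHolderTX (2 * β) I P) ∧
    -- `(∂ₜ p, ∇ p) ∈ C^{2β-1}_{t,x}` if `β > 1/2`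
    (1 / 2 < β → ∃ (P Pt : ℝ → EulerReg.Space n → ℝ)
        (Px : ℝ → EulerReg.Space n → EulerReg.Space n),
      EulerReg.IsRepresentedBy p P ∧ EulerReg.IsPeriodic Γ I P ∧
        (∀ t ∈ I, ∀ x, HasDerivAt (fun s => P s x) (Pt t x) t) ∧
        (∀ t ∈ I, ∀ x, HasGradientAt (P t) (Px t x) x) ∧
        EulerReg.MemHolderTX (2 * β - 1) I Pt ∧
        EulerReg.MemHolderTX (2 * β - 1) I Px) := by
  have hα0 : 0 < α := hβ.trans hβα
  obtain ⟨ν, K, hν⟩ := EulerReg.exists_isPeriodicMean Γ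
  obtain ⟨ρ, ψ, hρ, hψ, hρ1, hρψ⟩ := EulerReg.exists_profile (n := n) (by omega)
  obtain ⟨w, C, hw, hvw⟩ := EulerReg.exists_isUniformlyHolder hv hv_per
  have hEw := (hEuler.congr hvw).paired hw
  obtain ⟨_, hPw⟩ := EulerReg.exists_isUniformlyHolder_pressure hα0 hα hν hψ C
  obtain ⟨V, B, hV, hVh, hwV⟩ := EulerReg.exists_holder_version hα0 hα hI hEw hw (hPw w hw)
    (EulerReg.apply_eq_integral_pressure hα0 hEw hw hν hp_mean hρ hψ hρ1 hρψ) hρ hρ1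
  have hvV : ∀ᵐ t ∂(volume.restrict (I : Set ℝ)), ∀ x, v t x = V t x := by
    filter_upwards [hvw, hwV] with t h1 h2 x using (h1 x).trans (h2 x)
  have hVα : EulerReg.MemHolderTX α I V :=
    ⟨⟨B, fun t _ x => hV.bound t x⟩, ⟨B, hVh⟩, fun h => absurd h hα.ne⟩
  -- The pressure formula, used for `w` to obtain regularity in time, is now applied to `V`, so that
  -- `p` is represented by a pressure computed from a jointly continuous velocity.
  have hEV := (hEuler.congr hvV).paired hV
  have hpV := EulerReg.apply_eq_integral_pressure hα0 hEV hV hν hp_mean hρ hψ hρ1 hρψ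
  obtain ⟨_, hPV⟩ := EulerReg.exists_isUniformlyHolder_pressure hα0 hα hν hψ B
  have hPper : EulerReg.IsPeriodic Γ I (EulerReg.pressure ψ V) := fun t _ γ hγ x =>
    (hPV V hV).periodic t γ hγ x
  -- Any `a` strictly between `β` and `α` would serve. With `ε = a - β` below, the increments have
  -- size `lam^(2a-ε)` with `2a - ε = a + β > 2β`.
  set a := (α + β) / 2 with ha
  obtain ⟨A, hHE⟩ := EulerReg.exists_isHolderEuler (a := a) hν hψ hEV hV hVh (hPV V hV) hpV
    (by linarith) (by linarith)
  have hrep : EulerReg.IsRepresentedBy p (EulerReg.pressure ψ V) :=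
    EulerReg.isRepresentedBy_of_forall (by linarith) hHE.pressure hpV
  have hdec := fun (θ : ℝ) => EulerReg.exists_pressure_decomposition (θ := θ) (ε := a - β)
    hI hν hρ hψ hρ1 hρψ hHE (by linarith) (by linarith)
  refine ⟨⟨V, hVα, fun t _ γ hγ x => hV.periodic t γ hγ x, hvV⟩, fun hc => ?_, fun hβ2 => ?_,
    fun hβ2 => ?_⟩
  · have hVc : ContinuousOn (fun z : ℝ × EulerReg.Space n => V z.1 z.2)
        (EulerReg.slab n I : Set (ℝ × EulerReg.Space n)) :=
      EulerReg.continuousOn_of_holder hα0 hVh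
    have hEq := EulerReg.eq_of_ae_eq_of_continuousOn (fun x => hVc.comp
      (Continuous.prodMk_left x).continuousOn fun t ht => ⟨ht, Set.mem_univ x⟩) hc hvV
    refine ⟨⟨B, fun t ht x => ?_⟩, ⟨B, fun t ht t' ht' x x' => ?_⟩, fun h => absurd h hα.ne⟩
    · rw [hEq t ht]; exact hV.bound t x
    · rw [hEq t ht, hEq t' ht']; exact hVh t ht t' ht' x x'
  · refine ⟨_, hrep, hPper, ?_⟩
    -- Hölder continuity of the pressure needs no Hölder control on derivatives of the pieces, so `θ
    -- = 0`.
    obtain ⟨M, q, g, hq, hg, hsum⟩ := hdec 0 le_rfl (by linarith)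
    obtain ⟨C', hC'⟩ := EulerReg.exists_isScaled_of_decomposition (s := 2 * β) hI hq hg hsum
      (by linarith) (by linarith) (by linarith)
    refine hC'.memHolderTX fun h1 => ?_
    -- Only for `2β = 1`, where continuous differentiability is also claimed: then `a + β - 1 = a -
    -- β`, and this `θ` is positive and below it, so the derivatives are continuous.
    obtain ⟨M, q, g, hq, hg, hsum⟩ := hdec ((a - β) / 2) (by linarith) (by linarith)
    obtain ⟨C', Pt, Px, hd, hPt, hPx⟩ := EulerReg.exists_hasPartials_of_decomposition hI hq hg hsum
      (by linarith) (by linarith)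
    exact hd.contDiffOn (hPt.continuousOn (by linarith)) fun j =>
      (hPx j).continuousOn (by linarith)
  -- The choice `θ = 2β - 1` is admissible since `θ + ε = a + β - 1 < a`, and the differentiated
  -- series converges since `θ < a + β - 1`.
  · obtain ⟨M, q, g, hq, hg, hsum⟩ := hdec (2 * β - 1) (by linarith) (by linarith)
    obtain ⟨C', Pt, Px, hd, hPt, hPx⟩ := EulerReg.exists_hasPartials_of_decomposition hI hq hg hsum
      (by linarith) (by linarith)
    exact ⟨_, Pt, fun t x => WithLp.toLp 2 fun j => Px j t x, hrep, hPper, hd.time,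
      fun t ht x => hd.hasGradientAt ht x, hPt.memHolderTX fun h => absurd h (by linarith),
      EulerReg.memHolderTX_vector (by linarith) hPx⟩
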